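/- Let $\mathbb H=\{z=x+iy: y>0\}$ and, for $k\in\mathbb Z$, let $$\Delta_k = y^2\Big(\frac{\partial^2}{\partial x^2}+\frac{\partial^2}{\partial y^2}\Big) - iky\Big(\frac{\partial}{\partial x}+i\frac{\partial}{\partial y}\Big).$$ For an integer $m\ge 0$ let $V_k^m(0)$ be the complex vector space of $C^\infty$ functions $f:\mathbb H\to\mathbb C$ such that 1. $f\big(\frac{az+b}{cz+d}\big)=(cz+d)^k f(z)$ for all $\begin{pmatrix}a&b\\c&d\end{pmatrix}\in SL_2(\mathbb Z)$ and $z\in\mathbb H$; 2. $\Delta_k^m f=0$; 3. there is $\alpha\in\mathbb R$ with $f(x+iy)=O(y^\alpha)$ as $y\to\infty$, uniformly in $x\in\mathbb R$. Let $V_k^{m+1/2}(0)$ be the space of $C^\infty$ functions $f:\mathbb H\to\mathbb C$ satisfying 1 and 3 for which $\Delta_k^m f$ is a (possibly zero) holomorphic modular form of weight $k$ for $SL_2(\mathbb Z)$, that is, a holomorphic function on $\mathbb H$ satisfying 1 and 3. For $z\in\mathbb H$ and $\mathrm{Re}(s)>1$ let $$\widehat{\widehat{E}}_2(z,s) = (s+1)\,s\,\pi^{-(s+1)}\,\Gamma(s+1)\,\zeta(2s+2)\cdot\frac12\sum_{\substack{(c,d)\in\mathbb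 Z^2\\ \gcd(c,d)=1}}\frac{y^s}{(cz+d)^2|cz+d|^{2s}}.$$ For each $z\in\mathbb H$ this function continues analytically to an entire function of $s$, again denoted $\widehat{\widehat{E}}_2(z,s)$. Define $G_n(z)$ by the Taylor expansion $\widehat{\widehat{E}}_2(z,s)=\sum_{n\ge 0}G_n(z)s^n$ at $s=0$. Theorem. $G_0(z)=0$ for all $z\in\mathbb H$. For every integer $m\ge 0$, $V_2^m(0)=V_2^{m+1/2}(0)$, this space has dimension $m$ over $\mathbb C$, and $G_1,\dots,G_m$ form a basis of it. -/

import Mathlib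

namespace PolyMaass

noncomputable section

open UpperHalfPlane
open scoped MatrixGroups ContDiff Manifold ModularForm

/-- `f : ℍ → ℂ` is a `C^∞` function of the two real variables `x, y`, `z = x + iy`. -/
def IsSmooth (f : ℍ → ℂ) : Prop :=
  ContDiffOn ℝ ∞ (f ∘ ofComplex) {w : ℂ | 0 < w.im}

/-- The directional derivative of `f : ℍ → ℂ` along the real direction `v`. -/
def pd (v : ℂ) (f : ℍ → ℂ) (z : ℍ) : ℂ :=
  fderiv ℝ (f ∘ ofComplex) (z : ℂ) v

/-- `∂f/∂x`. -/
def pdx (f : ℍ → ℂ) : ℍ → ℂ := pd 1 f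

/-- `∂f/∂y`. -/
def pdy (f : ℍ → ℂ) : ℍ → ℂ := pd Complex.I f

/-- The weight `k` hyperbolic Laplacian
`Δ_k = y² (∂²/∂x² + ∂²/∂y²) - i k y (∂/∂x + i ∂/∂y)`. -/
def lap (k : ℤ) (f : ℍ → ℂ) (z : ℍ) : ℂ :=
  (z.im : ℂ) ^ 2 * (pdx (pdx f) z + pdy (pdy f) z)
    - Complex.I * (k : ℂ) * (z.im : ℂ) * (pdx f z + Complex.I * pdy f z)

/-- Moderate growth at the cusp: `f(x + iy) = O(y^α)` for some real `α`, as `y → ∞`,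
uniformly in `x`. -/
def ModerateGrowth (f : ℍ → ℂ) : Prop :=
  ∃ α : ℝ, f =O[atImInfty] fun z : ℍ => z.im ^ α

/-- Weight `k` modular invariance under the full modular group. -/
def IsModular (k : ℤ) (f : ℍ → ℂ) : Prop :=
  ∀ γ : SL(2, ℤ), f ∣[k] γ = f

/-- Smooth functions on `ℍ`, modular of weight `k`, of moderate growth at the cusp. -/
structure IsModerateForm (k : ℤ) (f : ℍ → ℂ) : Prop where
  smooth : IsSmooth f
  modular : IsModular k f
  growth : ModerateGrowth f

/-- Holomorphic modular forms of weight `k` for the full modular group (zero included). -/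
structure IsHolModForm (k : ℤ) (f : ℍ → ℂ) : Prop where
  holo : MDifferentiable 𝓘(ℂ) 𝓘(ℂ) f
  modular : IsModular k f
  growth : ModerateGrowth f

/-! ### Closure properties, needed to form the vector spaces -/

theorem isOpen_im_pos : IsOpen {w : ℂ | 0 < w.im} :=
  isOpen_lt continuous_const Complex.continuous_im

theorem IsSmooth.differentiableAt {f : ℍ → ℂ} (hf : IsSmooth f) (z : ℍ) :
    DifferentiableAt ℝ (f ∘ ofComplex) (z : ℂ) :=
  (hf.differentiableOn (by simp)).differentiableAt (isOpen_im_pos.mem_nhds z.im_pos)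

theorem IsSmooth.zero : IsSmooth 0 :=
  contDiffOn_const (c := (0 : ℂ))

theorem IsSmooth.add {f g : ℍ → ℂ} (hf : IsSmooth f) (hg : IsSmooth g) : IsSmooth (f + g) :=
  ContDiffOn.add hf hg

theorem IsSmooth.smul (c : ℂ) {f : ℍ → ℂ} (hf : IsSmooth f) : IsSmooth (c • f) :=
  ContDiffOn.const_smul c hf

theorem IsSmooth.mul {f g : ℍ → ℂ} (hf : IsSmooth f) (hg : IsSmooth g) : IsSmooth (f * g) :=
  ContDiffOn.mul hf hg

theorem IsSmooth.const (c : ℂ) : IsSmooth fun _ => c :=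
  contDiffOn_const

theorem IsSmooth.im : IsSmooth fun z => (z.im : ℂ) := by
  have h : ContDiff ℝ ∞ fun w : ℂ => ((w.im : ℝ) : ℂ) :=
    Complex.ofRealCLM.contDiff.comp Complex.imCLM.contDiff
  refine h.contDiffOn.congr fun w hw => ?_
  simp only [Function.comp_apply]
  rw [ofComplex_apply_of_im_pos hw]
  rfl

theorem IsSmooth.pd (v : ℂ) {f : ℍ → ℂ} (hf : IsSmooth f) : IsSmooth (pd v f) := by
  have h : ContDiffOn ℝ ∞ (fun w => fderiv ℝ (f ∘ ofComplex) w v) {w : ℂ | 0 < w.im} :=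
    (ContDiffOn.fderiv_of_isOpen hf isOpen_im_pos (by simp)).clm_apply contDiffOn_const
  refine h.congr fun w hw => ?_
  simp only [Function.comp_apply, PolyMaass.pd]
  rw [ofComplex_apply_of_im_pos hw]

theorem pd_add (v : ℂ) {f g : ℍ → ℂ} (hf : IsSmooth f) (hg : IsSmooth g) :
    pd v (f + g) = pd v f + pd v g := by
  ext z
  have h : ((f + g) ∘ ofComplex : ℂ → ℂ) = (f ∘ ofComplex) + (g ∘ ofComplex) := rfl
  simp only [pd, Pi.add_apply]
  rw [h, fderiv_add (hf.differentiableAt z) (hg.differentiableAt z)]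
  rfl

theorem pd_smul (v c : ℂ) {f : ℍ → ℂ} (hf : IsSmooth f) :
    pd v (c • f) = c • pd v f := by
  ext z
  have h : ((c • f) ∘ ofComplex : ℂ → ℂ) = c • (f ∘ ofComplex) := rfl
  simp only [pd, Pi.smul_apply]
  rw [h, fderiv_const_smul (hf.differentiableAt z)]
  rfl

theorem IsSmooth.lap (k : ℤ) {f : ℍ → ℂ} (hf : IsSmooth f) : IsSmooth (lap k f) := by
  have h1 := ((IsSmooth.im.mul IsSmooth.im).mul
    (((hf.pd 1).pd 1).add ((hf.pd Complex.I).pd Complex.I))).add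
    (((IsSmooth.const (-(Complex.I * (k : ℂ)))).mul IsSmooth.im).mul
      ((hf.pd 1).add ((IsSmooth.const Complex.I).mul (hf.pd Complex.I))))
  convert! h1 using 1
  ext z
  simp only [PolyMaass.lap, pdx, pdy, Pi.add_apply, Pi.mul_apply]
  ring

theorem lap_add (k : ℤ) {f g : ℍ → ℂ} (hf : IsSmooth f) (hg : IsSmooth g) :
    lap k (f + g) = lap k f + lap k g := by
  ext z
  simp only [lap, pdx, pdy, pd_add _ hf hg, pd_add _ (hf.pd _) (hg.pd _), Pi.add_apply]
  ring

theorem lap_smul (k : ℤ) (c : ℂ) {f : ℍ → ℂ} (hf : IsSmooth f) :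
    lap k (c • f) = c • lap k f := by
  ext z
  simp only [lap, pdx, pdy, pd_smul _ _ hf, pd_smul _ _ (hf.pd _), Pi.smul_apply, smul_eq_mul]
  ring

theorem IsSmooth.lap_iterate (k : ℤ) {f : ℍ → ℂ} (hf : IsSmooth f) (m : ℕ) :
    IsSmooth ((PolyMaass.lap k)^[m] f) := by
  induction m with
  | zero => exact hf
  | succ m ih => rw [Function.iterate_succ_apply']; exact ih.lap k

theorem lap_iterate_add (k : ℤ) {f g : ℍ → ℂ} (hf : IsSmooth f) (hg : IsSmooth g) (m : ℕ) :
    (lap k)^[m] (f + g) = (lap k)^[m] f + (lap k)^[m] g := by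
  induction m with
  | zero => rfl
  | succ m ih =>
    simp only [Function.iterate_succ_apply', ih]
    exact lap_add k (hf.lap_iterate k m) (hg.lap_iterate k m)

theorem lap_iterate_smul (k : ℤ) (c : ℂ) {f : ℍ → ℂ} (hf : IsSmooth f) (m : ℕ) :
    (lap k)^[m] (c • f) = c • (lap k)^[m] f := by
  induction m with
  | zero => rfl
  | succ m ih =>
    simp only [Function.iterate_succ_apply', ih]
    exact lap_smul k c (hf.lap_iterate k m)

theorem lap_iterate_zero (k : ℤ) (m : ℕ) : (lap k)^[m] (0 : ℍ → ℂ) = 0 := by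
  simpa using lap_iterate_smul k 0 IsSmooth.zero m

theorem ModerateGrowth.zero : ModerateGrowth 0 :=
  ⟨0, Asymptotics.isBigO_zero _ _⟩

theorem ModerateGrowth.smul (c : ℂ) {f : ℍ → ℂ} (hf : ModerateGrowth f) :
    ModerateGrowth (c • f) := by
  obtain ⟨a, ha⟩ := hf
  exact ⟨a, ha.const_smul_left c⟩

theorem rpow_isBigO_of_le {a b : ℝ} (h : a ≤ b) :
    (fun z : ℍ => z.im ^ a) =O[atImInfty] fun z : ℍ => z.im ^ b := by
  refine Asymptotics.IsBigO.of_bound 1 ?_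
  have h1 : ∀ᶠ z : ℍ in atImInfty, 1 ≤ z.im :=
    (Filter.tendsto_comap (f := UpperHalfPlane.im)).eventually (Filter.eventually_ge_atTop 1)
  filter_upwards [h1] with z hz
  rw [one_mul, Real.norm_of_nonneg (Real.rpow_nonneg z.im_pos.le _),
    Real.norm_of_nonneg (Real.rpow_nonneg z.im_pos.le _)]
  exact Real.rpow_le_rpow_of_exponent_le hz h

theorem ModerateGrowth.add {f g : ℍ → ℂ} (hf : ModerateGrowth f) (hg : ModerateGrowth g) :
    ModerateGrowth (f + g) := by
  obtain ⟨a, ha⟩ := hf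
  obtain ⟨b, hb⟩ := hg
  exact ⟨max a b, (ha.trans (rpow_isBigO_of_le (le_max_left a b))).add
    (hb.trans (rpow_isBigO_of_le (le_max_right a b)))⟩

theorem IsModular.zero (k : ℤ) : IsModular k 0 := fun γ => SlashAction.zero_slash k γ

theorem IsModular.add {k : ℤ} {f g : ℍ → ℂ} (hf : IsModular k f) (hg : IsModular k g) :
    IsModular k (f + g) := fun γ => by
  rw [SlashAction.add_slash, hf γ, hg γ]

theorem IsModular.smul {k : ℤ} (c : ℂ) {f : ℍ → ℂ} (hf : IsModular k f) :
    IsModular k (c • f) := fun γ => by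
  rw [ModularForm.SL_smul_slash, hf γ]

theorem IsModerateForm.zero (k : ℤ) : IsModerateForm k 0 :=
  ⟨IsSmooth.zero, IsModular.zero k, ModerateGrowth.zero⟩

theorem IsModerateForm.add {k : ℤ} {f g : ℍ → ℂ} (hf : IsModerateForm k f)
    (hg : IsModerateForm k g) : IsModerateForm k (f + g) :=
  ⟨hf.smooth.add hg.smooth, hf.modular.add hg.modular, hf.growth.add hg.growth⟩

theorem IsModerateForm.smul {k : ℤ} (c : ℂ) {f : ℍ → ℂ} (hf : IsModerateForm k f) :
    IsModerateForm k (c • f) :=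
  ⟨hf.smooth.smul c, hf.modular.smul c, hf.growth.smul c⟩

theorem IsHolModForm.zero (k : ℤ) : IsHolModForm k 0 :=
  ⟨mdifferentiable_const (c := (0 : ℂ)), IsModular.zero k, ModerateGrowth.zero⟩

theorem IsHolModForm.add {k : ℤ} {f g : ℍ → ℂ} (hf : IsHolModForm k f)
    (hg : IsHolModForm k g) : IsHolModForm k (f + g) :=
  ⟨hf.holo.add hg.holo, hf.modular.add hg.modular, hf.growth.add hg.growth⟩

theorem IsHolModForm.smul {k : ℤ} (c : ℂ) {f : ℍ → ℂ} (hf : IsHolModForm k f) :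
    IsHolModForm k (c • f) :=
  ⟨hf.holo.const_smul c, hf.modular.smul c, hf.growth.smul c⟩

/-! ### The spaces of polyharmonic Maass forms -/

/-- `V_k^m(0)` for an integer depth `m`: the weight `k` forms of moderate growth
with `Δ_k^m f = 0`. -/
def V (k : ℤ) (m : ℕ) : Submodule ℂ (ℍ → ℂ) where
  carrier := {f | IsModerateForm k f ∧ (lap k)^[m] f = 0}
  zero_mem' := ⟨IsModerateForm.zero k, lap_iterate_zero k m⟩
  add_mem' := fun {f g} hf hg => ⟨hf.1.add hg.1, by
    rw [lap_iterate_add k hf.1.smooth hg.1.smooth, hf.2, hg.2, add_zero]⟩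
  smul_mem' := fun c f hf => ⟨hf.1.smul c, by
    rw [lap_iterate_smul k c hf.1.smooth, hf.2, smul_zero]⟩

/-- `V_k^{m+1/2}(0)`: the weight `k` forms of moderate growth for which `Δ_k^m f` is a
holomorphic modular form of weight `k`. -/
def VHalf (k : ℤ) (m : ℕ) : Submodule ℂ (ℍ → ℂ) where
  carrier := {f | IsModerateForm k f ∧ IsHolModForm k ((lap k)^[m] f)}
  zero_mem' := ⟨IsModerateForm.zero k, by
    rw [lap_iterate_zero]; exact IsHolModForm.zero k⟩
  add_mem' := fun {f g} hf hg => ⟨hf.1.add hg.1, by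
    rw [lap_iterate_add k hf.1.smooth hg.1.smooth]; exact hf.2.add hg.2⟩
  smul_mem' := fun c f hf => ⟨hf.1.smul c, by
    rw [lap_iterate_smul k c hf.1.smooth]; exact hf.2.smul c⟩

/-! ### The doubly-completed weight 2 Eisenstein series -/

/-- The defining expression of the doubly-completed weight 2 Eisenstein series
`(s+1) s π^{-(s+1)} Γ(s+1) ζ(2s+2) · ½ ∑_{(c,d)=1} y^s / ((cz+d)² |cz+d|^{2s})`,
where `(c,d)` runs over all coprime pairs of integers. The sum converges absolutely
for `Re s > 0`. -/
def eisSeries2 (z : ℍ) (s : ℂ) : ℂ :=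
  (s + 1) * s * (Real.pi : ℂ) ^ (-(s + 1)) * Complex.Gamma (s + 1) * riemannZeta (2 * s + 2) *
    ((1 / 2) * ∑' p : {p : ℤ × ℤ // IsCoprime p.1 p.2},
      (z.im : ℂ) ^ s /
        (((p.1.1 : ℂ) * (z : ℂ) + (p.1.2 : ℂ)) ^ 2 *
          ((‖(p.1.1 : ℂ) * (z : ℂ) + (p.1.2 : ℂ)‖ : ℝ) : ℂ) ^ (2 * s)))

/-- `g` is the analytic continuation to all `s ∈ ℂ` of the doubly-completed weight 2 Eisenstein
series at `z`. There is at most one such `g`, by the identity theorem. -/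
structure IsContinuation (z : ℍ) (g : ℂ → ℂ) : Prop where
  entire : Differentiable ℂ g
  eq_series : ∀ s : ℂ, 1 < s.re → g s = eisSeries2 z s

/-- The analytically continued doubly-completed weight 2 Eisenstein series. (The existence of the
continuation is not built into the definition; it is asserted by `IsContinuation z (E2 z)`.) -/
def E2 (z : ℍ) : ℂ → ℂ :=
  Classical.epsilon fun g : ℂ → ℂ => IsContinuation z g

/-- The Taylor coefficients `G_n(z)` in `s` at `s = 0`. -/
def G (n : ℕ) (z : ℍ) : ℂ :=
  iteratedDeriv n (E2 z) 0 / (n.factorial : ℂ)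

end

end PolyMaass

/-!
The completed series is `s π / 2` times the Mellin transform at `s + 2` of the theta series
`θ(t) = ∑ ((c z̄ + d) / y)² e^{-π t |c z + d|² / y}`. Poisson summation gives `θ(1/t) = t³ θ(t)`,
and folding the integral at `t = 1` yields `s π / 2 * ∫₁^∞ (t^{s+1} + t^{-s}) θ(t) dt`, which is
entire in `s` and vanishes at `s = 0`. Hence `G_{n+1}` is a multiple of the theta integral
`∫₁^∞ (t + (-1)ⁿ) (log t)ⁿ θ(t) dt`.

The operator `Δ₂` acts on the terms of `θ` through derivatives in `t`, so integrating by parts gives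
`Δ₂ G_{n+2} = G_{n+1} + G_n` and `Δ₂ G_1 = 0`. Conversely `Δ₂` factors as a raising after a
lowering operator: the lowering of a harmonic form of weight two is an antiholomorphic form of
weight zero, hence constant, and it determines the form, as there are no holomorphic forms of
weight two. So `ker Δ₂` is spanned by `G_1`, which is nonzero because `θ` has positive real part at
`z = 2i` for `t ≥ 1`, and the theorem follows by induction on `m`.

Passing to `Δ₂^m f` needs growth conditions on derivatives, which those on `f` do not bound
pointwise. Growth is therefore tested against rescaled bump functions, where derivatives can be
moved onto the test function; for holomorphic functions the mean value property recovers the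
pointwise bound.
-/

namespace PolyMaass

noncomputable section

open UpperHalfPlane hiding I
open Filter Topology MeasureTheory
open Complex (I)
open scoped MatrixGroups ContDiff Manifold ModularForm ComplexConjugate FourierTransform Real

/-! ### Wirtinger calculus -/

section Wirtinger

variable {f g : ℍ → ℂ} {z : ℍ} {a b c d : ℂ}

/-- The real-linear map `v ↦ a v + b v̄`, the differential of a function with Wirtinger
derivatives `∂f/∂z = a` and `∂f/∂z̄ = b`. -/
def wirtingerCLM (a b : ℂ) : ℂ →L[ℝ] ℂ :=
  a • (1 : ℂ →L[ℝ] ℂ) + b • (Complex.conjCLE : ℂ →L[ℝ] ℂ)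

theorem wirtingerCLM_apply (a b v : ℂ) : wirtingerCLM a b v = a * v + b * conj v := by
  simp [wirtingerCLM]

theorem eq_wirtingerCLM (T : ℂ →L[ℝ] ℂ) :
    T = wirtingerCLM ((T 1 - I * T I) / 2) ((T 1 + I * T I) / 2) := by
  ext v
  have hT : T v = v.re * T 1 + v.im * T I := by
    conv_lhs => rw [show v = v.re • (1 : ℂ) + v.im • I by simp]
    rw [map_add, map_smul, map_smul, Complex.real_smul, Complex.real_smul]
  have hv : v = v.re + v.im * I := (Complex.re_add_im v).symm
  have hconj : conj v = v.re - v.im * I := by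
    apply Complex.ext <;> simp
  rw [hT, wirtingerCLM_apply, hconj]
  nth_rewrite 3 [hv]
  linear_combination (T I * v.im) * Complex.I_sq

/-- `f` is real differentiable at `z` with Wirtinger derivatives `∂f/∂z = a` and `∂f/∂z̄ = b`. -/
def HasWirtingerAt (f : ℍ → ℂ) (a b : ℂ) (z : ℍ) : Prop :=
  HasFDerivAt (f ∘ ofComplex) (wirtingerCLM a b) (z : ℂ)

/-- The Wirtinger derivative `∂f/∂z`. -/
def dz (f : ℍ → ℂ) (z : ℍ) : ℂ := (pdx f z - I * pdy f z) / 2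

/-- The Wirtinger derivative `∂f/∂z̄`. -/
def dzbar (f : ℍ → ℂ) (z : ℍ) : ℂ := (pdx f z + I * pdy f z) / 2

theorem IsSmooth.hasWirtingerAt (hf : IsSmooth f) (z : ℍ) :
    HasWirtingerAt f (dz f z) (dzbar f z) z :=
  (hf.differentiableAt z).hasFDerivAt.congr_fderiv (eq_wirtingerCLM _)

theorem HasWirtingerAt.pd_eq (h : HasWirtingerAt f a b z) (v : ℂ) :
    pd v f z = a * v + b * conj v := by
  rw [pd, HasFDerivAt.fderiv h, wirtingerCLM_apply]

theorem HasWirtingerAt.dz_eq (h : HasWirtingerAt f a b z) : dz f z = a := by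
  simp only [dz, pdx, pdy, h.pd_eq, map_one, Complex.conj_I]
  linear_combination (-a / 2 + b / 2) * Complex.I_sq

theorem HasWirtingerAt.dzbar_eq (h : HasWirtingerAt f a b z) : dzbar f z = b := by
  simp only [dzbar, pdx, pdy, h.pd_eq, map_one, Complex.conj_I]
  linear_combination (a / 2 - b / 2) * Complex.I_sq

theorem HasWirtingerAt.add (hf : HasWirtingerAt f a b z) (hg : HasWirtingerAt g c d z) :
    HasWirtingerAt (f + g) (a + c) (b + d) z :=
  (HasFDerivAt.add hf hg).congr_fderiv <| by
    ext v
    simp only [wirtingerCLM_apply, add_apply]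
    ring

theorem HasWirtingerAt.mul (hf : HasWirtingerAt f a b z) (hg : HasWirtingerAt g c d z) :
    HasWirtingerAt (f * g) (f z * c + g z * a) (f z * d + g z * b) z :=
  (HasFDerivAt.mul hf hg).congr_fderiv <| by
    ext v
    simp only [wirtingerCLM_apply, add_apply, smul_apply,
      Function.comp_apply, ofComplex_apply, smul_eq_mul]
    ring

theorem HasWirtingerAt.comp (hf : HasWirtingerAt f a b z) {φ : ℂ → ℂ} {φ' : ℂ}
    (hφ : HasDerivAt φ φ' (f z)) : HasWirtingerAt (φ ∘ f) (φ' * a) (φ' * b) z := by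
  have hφz : HasDerivAt φ φ' ((f ∘ ofComplex) (z : ℂ)) := by simpa using hφ
  refine ((hφz.hasFDerivAt.restrictScalars ℝ).comp (z : ℂ) hf).congr_fderiv ?_
  ext v
  simp [wirtingerCLM_apply]
  ring

theorem HasWirtingerAt.conj (hf : HasWirtingerAt f a b z) :
    HasWirtingerAt (fun z => conj (f z)) (conj b) (conj a) z := by
  refine ((Complex.conjCLE : ℂ →L[ℝ] ℂ).hasFDerivAt.comp (z : ℂ) hf).congr_fderiv ?_
  ext v
  simp [wirtingerCLM_apply]
  ring

theorem hasWirtingerAt_const (c : ℂ) (z : ℍ) : HasWirtingerAt (fun _ => c) 0 0 z :=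
  (hasFDerivAt_const c (z : ℂ)).congr_fderiv <| by
    ext v
    simp [wirtingerCLM_apply]

theorem eqOn_comp_ofComplex {F : ℂ → ℂ} (hF : ∀ z : ℍ, f z = F z) :
    Set.EqOn (f ∘ ofComplex) F {w | 0 < w.im} := fun w hw => by
  rw [Function.comp_apply, hF, ofComplex_apply_of_im_pos hw]

theorem HasWirtingerAt.of_hasFDerivAt {F : ℂ → ℂ} (hF : ∀ z : ℍ, f z = F z)
    (h : HasFDerivAt F (wirtingerCLM a b) z) : HasWirtingerAt f a b z :=
  h.congr_of_eventuallyEq <|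
    (eqOn_comp_ofComplex hF).eventuallyEq_of_mem (isOpen_im_pos.mem_nhds z.im_pos)

theorem HasWirtingerAt.of_hasDerivAt {F : ℂ → ℂ} (hF : ∀ z : ℍ, f z = F z)
    (h : HasDerivAt F a z) : HasWirtingerAt f a 0 z :=
  .of_hasFDerivAt hF <| (h.hasFDerivAt.restrictScalars ℝ).congr_fderiv <| by
    ext v
    simp [wirtingerCLM_apply, mul_comm]

theorem hasWirtingerAt_coe (z : ℍ) : HasWirtingerAt (fun z => (z : ℂ)) 1 0 z :=
  .of_hasDerivAt (fun _ => rfl) (hasDerivAt_id _)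

theorem hasWirtingerAt_im (z : ℍ) : HasWirtingerAt (fun z => (z.im : ℂ)) (-I / 2) (I / 2) z := by
  refine .of_hasFDerivAt (fun _ => rfl)
    ((Complex.ofRealCLM ∘L Complex.imCLM).hasFDerivAt.congr_fderiv ?_)
  ext v
  rw [wirtingerCLM_apply]
  apply Complex.ext <;> simp <;> ring

theorem IsSmooth.congr_coe {F : ℂ → ℂ} (hF : ∀ z : ℍ, f z = F z) (h : ContDiff ℝ ∞ F) :
    IsSmooth f :=
  h.contDiffOn.congr (eqOn_comp_ofComplex hF)

theorem IsSmooth.coe : IsSmooth fun z => (z : ℂ) := .congr_coe (fun _ => rfl) contDiff_id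

theorem IsSmooth.conj (hf : IsSmooth f) : IsSmooth fun z => conj (f z) :=
  (Complex.conjCLE : ℂ →L[ℝ] ℂ).contDiff.comp_contDiffOn hf

theorem IsSmooth.inv (hf : IsSmooth f) (h0 : ∀ z, f z ≠ 0) : IsSmooth f⁻¹ :=
  ContDiffOn.inv hf fun _ _ => h0 _

theorem im_ofReal_ne_zero (z : ℍ) : (z.im : ℂ) ≠ 0 := Complex.ofReal_ne_zero.mpr z.im_ne_zero

theorem dzbar_eq_smul (f : ℍ → ℂ) : dzbar f = (1 / 2 : ℂ) • (pdx f + I • pdy f) := by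
  ext z
  simp only [dzbar, Pi.smul_apply, Pi.add_apply, smul_eq_mul]
  ring

protected theorem IsSmooth.dzbar (hf : IsSmooth f) : IsSmooth (dzbar f) := by
  rw [dzbar_eq_smul]
  exact ((hf.pd 1).add ((hf.pd I).smul I)).smul _

theorem dzbar_add (hf : IsSmooth f) (hg : IsSmooth g) : dzbar (f + g) = dzbar f + dzbar g := by
  ext z
  exact ((hf.hasWirtingerAt z).add (hg.hasWirtingerAt z)).dzbar_eq

theorem dzbar_smul (c : ℂ) (hf : IsSmooth f) : dzbar (c • f) = c • dzbar f := by
  ext z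
  have h := ((hasWirtingerAt_const c z).mul (hf.hasWirtingerAt z)).dzbar_eq
  rw [mul_zero, add_zero] at h
  exact h

theorem pd_pd_eq_fderiv_fderiv (v w : ℂ) (hf : IsSmooth f) (z : ℍ) :
    pd v (pd w f) z = fderiv ℝ (fderiv ℝ (f ∘ ofComplex)) (z : ℂ) v w := by
  have hd : DifferentiableAt ℝ (fderiv ℝ (f ∘ ofComplex)) (z : ℂ) :=
    ((ContDiffOn.fderiv_of_isOpen (m := ∞) hf isOpen_im_pos (by simp)).differentiableOn
      (by simp)).differentiableAt (isOpen_im_pos.mem_nhds z.im_pos)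
  have he : pd w f ∘ ofComplex =ᶠ[𝓝 (z : ℂ)] fun u => fderiv ℝ (f ∘ ofComplex) u w :=
    (eqOn_comp_ofComplex fun z => by rw [pd]).eventuallyEq_of_mem
      (isOpen_im_pos.mem_nhds z.im_pos)
  rw [pd, he.fderiv_eq, fderiv_clm_apply hd (by fun_prop)]
  simp

theorem pd_comm (v w : ℂ) (hf : IsSmooth f) : pd v (pd w f) = pd w (pd v f) := by
  ext z
  have h2 : ((2 : ℕ∞) : ℕ∞ω) ≤ ∞ := WithTop.coe_le_coe.mpr le_top
  rw [pd_pd_eq_fderiv_fderiv v w hf, pd_pd_eq_fderiv_fderiv w v hf]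
  exact (hf.contDiffAt (isOpen_im_pos.mem_nhds z.im_pos)).isSymmSndFDerivAt (by simpa using h2) v w

theorem mdifferentiable_of_dzbar_eq_zero (hf : IsSmooth f) (h : ∀ z, dzbar f z = 0) :
    MDifferentiable 𝓘(ℂ) 𝓘(ℂ) f := by
  intro z
  rw [UpperHalfPlane.mdifferentiableAt_iff, differentiableAt_complex_iff_differentiableAt_real]
  refine ⟨hf.differentiableAt z, ?_⟩
  have hz := h z
  simp only [dzbar, pdx, pdy, pd] at hz
  rw [smul_eq_mul]
  linear_combination -2 * I * hz + (fderiv ℝ (f ∘ ofComplex) z I) * Complex.I_sq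

end Wirtinger

/-! ### Raising, lowering and the modular group -/

section Modular

variable {k : ℤ} {f : ℍ → ℂ}

/-- The operator `y² ∂/∂z̄`, lowering the weight by `2`. -/
def lower (f : ℍ → ℂ) (z : ℍ) : ℂ := (z.im : ℂ) ^ 2 * dzbar f z

/-- The operator `∂/∂z + k / (2iy)`, raising the weight from `k` to `k + 2`. -/
def raise (k : ℤ) (f : ℍ → ℂ) (z : ℍ) : ℂ := dz f z + k / (2 * I * z.im) * f z

theorem lower_eq_mul (f : ℍ → ℂ) :
    lower f = ((fun z : ℍ => (z.im : ℂ)) * fun z => (z.im : ℂ)) * dzbar f := by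
  ext z
  simp [lower, sq]

protected theorem IsSmooth.lower (hf : IsSmooth f) : IsSmooth (lower f) := by
  rw [lower_eq_mul]
  exact (IsSmooth.im.mul IsSmooth.im).mul hf.dzbar

theorem four_mul_dz_dzbar (hf : IsSmooth f) (z : ℍ) :
    4 * dz (dzbar f) z = pdx (pdx f) z + pdy (pdy f) z := by
  have hx : IsSmooth (pdx f) := hf.pd 1
  have hy : IsSmooth (pdy f) := hf.pd I
  have hpd : ∀ v, pd v (dzbar f) z = (pd v (pdx f) z + I * pd v (pdy f) z) / 2 := fun v => by
    rw [dzbar_eq_smul, pd_smul _ _ (hx.add (hy.smul _)), pd_add _ hx (hy.smul _), pd_smul _ _ hy]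
    simp only [Pi.smul_apply, Pi.add_apply, smul_eq_mul]
    ring
  have hxy : pd I (pdx f) z = pd 1 (pdy f) z := congrFun (pd_comm I 1 hf) z
  rw [dz, pdx, pdy, hpd, hpd, hxy]
  simp only [pdx, pdy]
  linear_combination -pd I (pd I f) z * Complex.I_sq

theorem lap_eq_raise_lower (hf : IsSmooth f) : lap k f = (4 : ℂ) • raise (k - 2) (lower f) := by
  ext z
  have hy_sq := (hasWirtingerAt_im z).mul (hasWirtingerAt_im z)
  have hdz := (hy_sq.mul (hf.dzbar.hasWirtingerAt z)).dz_eq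
  rw [← lower_eq_mul] at hdz
  have hy := im_ofReal_ne_zero z
  rw [Pi.smul_apply, smul_eq_mul, raise, hdz, lap, ← four_mul_dz_dzbar hf, lower, Pi.mul_apply,
    show pdx f z + I * pdy f z = 2 * dzbar f z by rw [dzbar]; ring]
  field_simp
  push_cast
  linear_combination (8 - 4 * k) * dzbar f z * Complex.I_sq

theorem IsModular.apply_smul (hf : IsModular k f) (γ : SL(2, ℤ)) (z : ℍ) :
    f (γ • z) = denom γ z ^ k * f z := by
  have h := congrFun (hf γ) z
  rw [ModularForm.SL_slash_apply] at h
  rw [← h, mul_comm, mul_assoc, ← zpow_add₀ (denom_ne_zero γ z)]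
  simp

theorem isModular_of_apply_smul
    (hf : ∀ (γ : SL(2, ℤ)) (z : ℍ), f (γ • z) = denom γ z ^ k * f z) : IsModular k f := by
  intro γ
  ext z
  rw [ModularForm.SL_slash_apply, hf, mul_comm, ← mul_assoc, ← zpow_add₀ (denom_ne_zero γ z)]
  simp

theorem hasWirtingerAt_comp_smul (γ : SL(2, ℤ)) {z : ℍ} {a b : ℂ}
    (hf : HasWirtingerAt f a b (γ • z)) :
    HasWirtingerAt (fun z => f (γ • z)) (a * (denom γ z ^ 2)⁻¹) (b * conj (denom γ z ^ 2)⁻¹) z := by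
  have hdet : (γ : GL (Fin 2) ℝ).val.det = 1 := Matrix.SpecialLinearGroup.det_coe _
  have hγ := (hasStrictDerivAt_smul (hdet ▸ one_pos) z).hasDerivAt.hasFDerivAt.restrictScalars ℝ
  have hf' : HasFDerivAt (f ∘ ofComplex) (wirtingerCLM a b)
      (((γ : GL (Fin 2) ℝ) • ofComplex (z : ℂ) : ℍ) : ℂ) := by
    rw [ofComplex_apply]
    exact hf
  rw [hdet] at hγ
  rw [HasWirtingerAt]
  convert! hf'.comp (z : ℂ) hγ using 1
  · ext w
    simp only [Function.comp_apply, ofComplex_apply]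
    rfl
  · ext v
    simp [wirtingerCLM_apply]
    ring

theorem hasWirtingerAt_denom_zpow (γ : SL(2, ℤ)) (k : ℤ) (z : ℍ) :
    HasWirtingerAt (fun z => denom γ z ^ k)
      (k * (γ : GL (Fin 2) ℝ) 1 0 * denom γ z ^ (k - 1)) 0 z :=
  .of_hasDerivAt (fun _ => rfl) (hasDerivAt_denom_zpow (γ : GL (Fin 2) ℝ) k z)

theorem im_smul_eq_div_denom (γ : SL(2, ℤ)) (z : ℍ) :
    ((γ • z).im : ℂ) = z.im / (denom γ z * conj (denom γ z)) := by
  rw [Complex.mul_conj, ModularGroup.im_smul_eq_div_normSq]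
  push_cast
  rfl

theorem denom_sub_conj_denom (γ : SL(2, ℤ)) (z : ℍ) :
    denom γ z - conj (denom γ z) = 2 * I * z.im * (γ : GL (Fin 2) ℝ) 1 0 := by
  rw [Complex.sub_conj, ModularGroup.denom_apply]
  simp
  ring

theorem IsModular.dz_apply_smul (hs : IsSmooth f) (hf : IsModular k f) (γ : SL(2, ℤ)) (z : ℍ) :
    dz f (γ • z) = denom γ z ^ 2 *
      (denom γ z ^ k * dz f z + f z * (k * (γ : GL (Fin 2) ℝ) 1 0 * denom γ z ^ (k - 1))) := by
  have hcomp := (hasWirtingerAt_comp_smul γ (hs.hasWirtingerAt (γ • z))).dz_eq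
  have hmul := ((hasWirtingerAt_denom_zpow γ k z).mul (hs.hasWirtingerAt z)).dz_eq
  rw [show (fun z => f (γ • z)) = (fun z : ℍ => denom γ z ^ k) * f from
    funext fun z => hf.apply_smul γ z, hmul] at hcomp
  have hj : denom γ z ≠ 0 := denom_ne_zero _ _
  rw [hcomp]
  field_simp

theorem IsModular.dzbar_apply_smul (hs : IsSmooth f) (hf : IsModular k f) (γ : SL(2, ℤ)) (z : ℍ) :
    dzbar f (γ • z) = denom γ z ^ k * conj (denom γ z) ^ 2 * dzbar f z := by
  have hcomp := (hasWirtingerAt_comp_smul γ (hs.hasWirtingerAt (γ • z))).dzbar_eq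
  have hmul := ((hasWirtingerAt_denom_zpow γ k z).mul (hs.hasWirtingerAt z)).dzbar_eq
  rw [show (fun z => f (γ • z)) = (fun z : ℍ => denom γ z ^ k) * f from
    funext fun z => hf.apply_smul γ z, hmul, mul_zero, add_zero, map_inv₀, map_pow] at hcomp
  have hj : conj (denom γ z) ≠ 0 := by simp [denom_ne_zero]
  field_simp at hcomp
  rw [← hcomp]
  ring

protected theorem IsModular.lower (hs : IsSmooth f) (hf : IsModular k f) :
    IsModular (k - 2) (lower f) := by
  refine isModular_of_apply_smul fun γ z => ?_
  have hj : denom γ z ≠ 0 := denom_ne_zero _ _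
  have hj' : conj (denom γ z) ≠ 0 := by simp [hj]
  rw [lower, lower, hf.dzbar_apply_smul hs, im_smul_eq_div_denom, zpow_sub₀ hj]
  field_simp

protected theorem IsModular.raise (hs : IsSmooth f) (hf : IsModular k f) :
    IsModular (k + 2) (raise k f) := by
  refine isModular_of_apply_smul fun γ z => ?_
  have hj : denom γ z ≠ 0 := denom_ne_zero _ _
  have hy := im_ofReal_ne_zero z
  rw [raise, raise, hf.dz_apply_smul hs, hf.apply_smul, im_smul_eq_div_denom, zpow_add₀ hj,
    zpow_sub_one₀ hj, zpow_two]
  field_simp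
  linear_combination -(k * f z) * denom_sub_conj_denom γ z

protected theorem IsModular.lap (hs : IsSmooth f) (hf : IsModular k f) :
    IsModular k (lap k f) := by
  rw [lap_eq_raise_lower hs]
  exact (sub_add_cancel k 2 ▸ (hf.lower hs).raise hs.lower :).smul 4

end Modular

/-! ### Holomorphic modular forms of moderate growth -/

section Holomorphic

open Function.Periodic

theorem cuspFunction_isLittleO_inv {h : ℝ} (hh : 0 < h) {F : ℂ → ℂ}
    (hF : F =o[comap Complex.im atTop] fun w => (qParam h w)⁻¹) :
    cuspFunction h F =o[𝓝[≠] 0] fun q : ℂ => q⁻¹ := by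
  refine (hF.comp_tendsto (invQParam_tendsto hh)).congr' ?_ ?_
  · filter_upwards [self_mem_nhdsWithin] with q hq
    rw [cuspFunction_eq_of_nonzero _ _ hq, Function.comp_apply]
  · filter_upwards [self_mem_nhdsWithin] with q hq
    rw [Function.comp_apply, qParam_right_inv hh.ne' hq]

/-- Riemann's theorem on removable singularities, at the cusp. -/
theorem exists_tendsto_comap_im_of_isLittleO {h : ℝ} (hh : 0 < h) {F : ℂ → ℂ}
    (hper : Function.Periodic F h)
    (hdiff : ∀ᶠ w in comap Complex.im atTop, DifferentiableAt ℂ F w)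
    (hF : F =o[comap Complex.im atTop] fun w => (qParam h w)⁻¹) :
    ∃ c, Tendsto F (comap Complex.im atTop) (𝓝 c) := by
  have hsub : (fun q => cuspFunction h F q - cuspFunction h F 0) =o[𝓝[≠] 0]
      fun q : ℂ => (q - 0)⁻¹ := by
    simp only [sub_zero]
    refine (cuspFunction_isLittleO_inv hh hF).sub ?_
    rw [Asymptotics.isLittleO_const_left]
    exact .inr <| by simpa [Function.comp_def] using tendsto_norm_inv_nhdsNE_zero_atTop (α := ℂ)
  have hlim := Complex.tendsto_limUnder_of_differentiable_on_punctured_nhds_of_isLittleO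
    (eventually_differentiableAt_cuspFunction_nhds_ne_zero hh hper hdiff) hsub
  refine ⟨_, (hlim.comp (qParam_tendsto hh)).congr fun w => ?_⟩
  exact eq_cuspFunction hh.ne' hper w

theorem ModerateGrowth.isLittleO_inv_qParam {f : ℍ → ℂ} (hf : ModerateGrowth f) {h : ℝ}
    (hh : 0 < h) : (f ∘ ofComplex) =o[comap Complex.im atTop] fun w => (qParam h w)⁻¹ := by
  obtain ⟨α, hα⟩ := hf
  have hpow : (f ∘ ofComplex) =O[comap Complex.im atTop] fun w => w.im ^ α := by
    refine (hα.comp_tendsto tendsto_comap_im_ofComplex).congr' .rfl ?_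
    filter_upwards [preimage_mem_comap (Ioi_mem_atTop 0)] with w hw
    rw [Function.comp_apply, ofComplex_apply_of_im_pos hw]
    rfl
  have hexp := (isLittleO_rpow_exp_pos_mul_atTop α (div_pos Real.two_pi_pos hh)).comp_tendsto
    (tendsto_comap (f := Complex.im))
  refine (hpow.trans_isLittleO hexp).trans_isBigO (Asymptotics.isBigO_of_le _ fun w => ?_)
  rw [norm_inv, norm_qParam, ← Real.exp_neg, Function.comp_apply, Real.norm_eq_abs, Real.abs_exp]
  refine Real.exp_le_exp.mpr (le_of_eq ?_)
  ring

theorem IsModular.periodic {k : ℤ} {f : ℍ → ℂ} (hf : IsModular k f) :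
    Function.Periodic (f ∘ ofComplex) 1 := by
  let F : SlashInvariantForm 𝒮ℒ k :=
    { toFun := f
      slash_action_eq' := by
        rintro _ ⟨γ, rfl⟩
        exact hf γ }
  simpa using! SlashInvariantFormClass.periodic_comp_ofComplex F one_mem_strictPeriods_SL

theorem IsHolModForm.isBoundedAtImInfty {k : ℤ} {f : ℍ → ℂ} (hf : IsHolModForm k f) :
    IsBoundedAtImInfty f := by
  have hdiff : ∀ᶠ w in comap Complex.im atTop, DifferentiableAt ℂ (f ∘ ofComplex) w := by
    filter_upwards [preimage_mem_comap (Ioi_mem_atTop 0)] with w hw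
    exact (UpperHalfPlane.mdifferentiable_iff.mp hf.holo w hw).differentiableAt
      (isOpen_im_pos.mem_nhds hw)
  obtain ⟨c, hc⟩ := exists_tendsto_comap_im_of_isLittleO one_pos (mod_cast hf.modular.periodic)
    hdiff (hf.growth.isLittleO_inv_qParam one_pos)
  refine ((hc.comp tendsto_coe_atImInfty).isBigO_one ℝ).congr_left fun z => ?_
  simp

/-- A holomorphic modular form of moderate growth, as an element of Mathlib's `ModularForm`. -/
def IsHolModForm.toModularForm {k : ℤ} {f : ℍ → ℂ} (hf : IsHolModForm k f) :
    ModularForm 𝒮ℒ k where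
  toFun := f
  slash_action_eq' := by
    rintro _ ⟨γ, rfl⟩
    exact hf.modular γ
  holo' := hf.holo
  bdd_at_cusps' {c} hc := by
    rw [Subgroup.IsArithmetic.isCusp_iff_isCusp_SL2Z] at hc
    rw [OnePoint.isBoundedAt_iff_forall_SL2Z hc]
    intro γ _
    rw [hf.modular γ]
    exact hf.isBoundedAtImInfty

theorem IsHolModForm.eq_zero_of_weight_two {f : ℍ → ℂ} (hf : IsHolModForm 2 f) : f = 0 :=
  congrArg DFunLike.coe <|
    rank_zero_iff_forall_zero.mp ModularForm.levelOne_weight_two_rank_zero hf.toModularForm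

theorem IsHolModForm.eq_const_of_weight_zero {f : ℍ → ℂ} (hf : IsHolModForm 0 f) :
    ∃ c, ∀ z, f z = c :=
  (ModularFormClass.levelOne_weight_zero_const hf.toModularForm).imp fun _ => congrFun

end Holomorphic

/-! ### The mean value property against radial weights -/

section RadialMean

theorem measurePreserving_circleMap_mul (θ : ℝ) :
    MeasurePreserving fun u : ℂ => circleMap 0 1 θ * u := by
  convert! (rotation (Circle.exp θ)).measurePreserving using 1
  ext u
  simp [circleMap_zero]

theorem integral_circleAverage_mul {g : ℂ → ℂ} (hg : Continuous g) (hgi : Integrable g) :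
    ∫ u, Real.circleAverage (fun ζ => g (ζ * u)) 0 1 = ∫ u, g u := by
  have hcomp : ∀ (θ : ℝ) {F : Type} [NormedAddCommGroup F] [NormedSpace ℝ F] {G : ℂ → F},
      Continuous G → ∫ u, G (circleMap 0 1 θ * u) = ∫ u, G u := fun θ F _ _ G hG => by
    have h := measurePreserving_circleMap_mul θ
    rw [← integral_map h.measurable.aemeasurable hG.aestronglyMeasurable, h.map_eq]
  have hint : Integrable (Function.uncurry fun (θ : ℝ) (u : ℂ) => g (circleMap 0 1 θ * u))
      ((volume.restrict (Set.uIoc 0 (2 * π))).prod volume) := by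
    rw [integrable_prod_iff (Continuous.aestronglyMeasurable (by fun_prop))]
    refine ⟨.of_forall fun θ => ?_, ?_⟩
    · exact ((measurePreserving_circleMap_mul θ).integrable_comp hgi.aestronglyMeasurable).mpr hgi
    · simp only [Function.uncurry_apply_pair, hcomp _ hg.norm]
      exact integrableOn_const (by simp [ENNReal.mul_eq_top])
  simp only [Real.circleAverage_def, integral_smul]
  rw [← intervalIntegral_integral_swap hint]
  simp only [hcomp _ hg, intervalIntegral.integral_const, sub_zero, smul_smul]
  rw [inv_mul_cancel₀ Real.two_pi_pos.ne', one_smul]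

theorem integral_mul_radial {H : ℂ → ℂ} {r R : ℝ} (hrR : r < R)
    (hH : DifferentiableOn ℂ H (Metric.ball 0 R)) {ρ : ℝ → ℂ} (hρ : Continuous ρ)
    (hρ0 : ∀ s, r ≤ s → ρ s = 0) :
    ∫ u, H u * ρ ‖u‖ = H 0 * ∫ u : ℂ, ρ ‖u‖ := by
  have hsupp : tsupport (fun u => H u * ρ ‖u‖) ⊆ Metric.closedBall 0 r := by
    refine closure_minimal (fun u hu => ?_) Metric.isClosed_closedBall
    by_contra! hru
    rw [Metric.mem_closedBall, dist_zero_right, not_le] at hru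
    exact hu (by simp only [hρ0 _ hru.le, mul_zero])
  have hcont : Continuous fun u => H u * ρ ‖u‖ := by
    refine continuous_of_tsupport fun u hu => ?_
    have hu' : Metric.ball (0 : ℂ) R ∈ 𝓝 u :=
      Metric.isOpen_ball.mem_nhds (Metric.closedBall_subset_ball hrR (hsupp hu))
    exact (hH.continuousOn.continuousAt hu').mul (by fun_prop)
  have hmean : ∀ u : ℂ, Real.circleAverage (fun ζ => H (ζ * u) * ρ ‖ζ * u‖) 0 1
      = H 0 * ρ ‖u‖ := fun u => by
    have hcircle : Set.EqOn (fun ζ => H (ζ * u) * ρ ‖ζ * u‖) (ρ ‖u‖ • fun ζ => H (ζ * u))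
        (Metric.sphere 0 |1|) := fun ζ hζ => by
      simp_all [mul_comm]
    rw [Real.circleAverage_congr_sphere hcircle, Real.circleAverage_smul, smul_eq_mul, mul_comm]
    rcases le_or_gt r ‖u‖ with hu | hu
    · simp [hρ0 _ hu]
    · have hmaps : Set.MapsTo (fun ζ => ζ * u) (Metric.closedBall 0 |1|) (Metric.ball 0 R) :=
        fun ζ hζ => by
          simp only [abs_one, Metric.mem_closedBall, dist_zero_right, Metric.mem_ball,
            norm_mul] at hζ ⊢
          nlinarith [norm_nonneg u]
      have hdiff : DiffContOnCl ℂ (fun ζ => H (ζ * u)) (Metric.ball 0 |1|) :=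
        ((hH.comp (by fun_prop) hmaps).mono Metric.closure_ball_subset_closedBall).diffContOnCl
      rw [hdiff.circleAverage, zero_mul]
  rw [← integral_circleAverage_mul hcont (hcont.integrable_of_hasCompactSupport <|
    (isCompact_closedBall 0 r).of_isClosed_subset (isClosed_tsupport _) hsupp)]
  simp only [hmean, integral_const_mul]

end RadialMean

/-! ### Moderate growth in the weak sense -/

section WeakGrowth

variable {f g : ℍ → ℂ} {φ : ℂ → ℂ}

/-- Smooth functions with compact support inside the upper half-plane. -/
structure IsTestFun (φ : ℂ → ℂ) : Prop where
  smooth : ContDiff ℝ ∞ φ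
  compact : HasCompactSupport φ
  subset : tsupport φ ⊆ {w : ℂ | 0 < w.im}

/-- The pairing `∫ f(x + Yw) φ(w) dw` of `f` with a test function transported to height `Y`. -/
def testPairing (f : ℍ → ℂ) (φ : ℂ → ℂ) (x Y : ℝ) : ℂ :=
  ∫ w : ℂ, (f ∘ ofComplex) (x + Y * w) * φ w

/-- Moderate growth at the cusp after pairing with arbitrary rescaled test functions. Unlike
`ModerateGrowth`, it is inherited by derivatives. -/
def WeakGrowth (f : ℍ → ℂ) : Prop :=
  ∃ α : ℝ, ∀ φ, IsTestFun φ → ∃ C : ℝ, ∀ᶠ Y : ℝ in atTop, ∀ x : ℝ,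
    ‖testPairing f φ x Y‖ ≤ C * Y ^ α

theorem IsTestFun.of_support_subset_closedBall {c : ℂ} {r : ℝ} (hφ : ContDiff ℝ ∞ φ)
    (hr : r < c.im) (hsupp : Function.support φ ⊆ Metric.closedBall c r) : IsTestFun φ where
  smooth := hφ
  compact := HasCompactSupport.of_support_subset_isCompact (isCompact_closedBall c r) hsupp
  subset w hw := by
    have hwc : ‖w - c‖ ≤ r :=
      mem_closedBall_iff_norm.mp (closure_minimal hsupp Metric.isClosed_closedBall hw)
    have him := (abs_le.mp ((Complex.abs_im_le_norm _).trans hwc)).1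
    rw [Complex.sub_im] at him
    exact show 0 < w.im by linarith

theorem IsTestFun.const_mul (h : IsTestFun φ) (c : ℂ) : IsTestFun fun w => c * φ w :=
  ⟨contDiff_const.mul h.smooth, h.compact.mul_left, tsupport_mul_subset_right.trans h.subset⟩

theorem IsTestFun.im_mul (h : IsTestFun φ) : IsTestFun fun w => (w.im : ℂ) * φ w :=
  ⟨(Complex.ofRealCLM.contDiff.comp Complex.imCLM.contDiff).mul h.smooth, h.compact.mul_left,
    tsupport_mul_subset_right.trans h.subset⟩

theorem IsTestFun.fderiv_apply (h : IsTestFun φ) (v : ℂ) : IsTestFun fun w => fderiv ℝ φ w v :=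
  ⟨(h.smooth.fderiv_right (m := ∞) (by simp)).clm_apply contDiff_const, h.compact.fderiv_apply ℝ v,
    (tsupport_fderiv_apply_subset ℝ v).trans h.subset⟩

theorem IsTestFun.integrable_mul (h : IsTestFun φ) {F : ℂ → ℂ}
    (hF : ContinuousOn F {w | 0 < w.im}) : Integrable fun w => F w * φ w := by
  refine (continuous_of_tsupport fun w hw => ?_).integrable_of_hasCompactSupport h.compact.mul_left
  have hw' := h.subset (tsupport_mul_subset_right hw)
  exact (hF.continuousAt (isOpen_im_pos.mem_nhds hw')).mul h.smooth.continuous.continuousAt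

theorem IsTestFun.mul_congr (h : IsTestFun φ) {F G : ℂ → ℂ}
    (hFG : Set.EqOn F G {w | 0 < w.im}) (w : ℂ) : F w * φ w = G w * φ w := by
  by_cases hw : w ∈ tsupport φ
  · rw [hFG (h.subset hw)]
  · rw [image_eq_zero_of_notMem_tsupport hw, mul_zero, mul_zero]

theorem IsTestFun.integral_fderiv_mul (h : IsTestFun φ) {F : ℂ → ℂ}
    (hF : ContDiffOn ℝ 1 F {w | 0 < w.im}) (v : ℂ) :
    ∫ w, fderiv ℝ F w v * φ w = -∫ w, F w * fderiv ℝ φ w v := by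
  have hF' : ContinuousOn (fun w => fderiv ℝ F w v) {w | 0 < w.im} :=
    (hF.continuousOn_fderiv_of_isOpen isOpen_im_pos le_rfl).clm_apply continuousOn_const
  rw [integral_mul_fderiv_eq_neg_fderiv_mul_of_integrable (h.integrable_mul hF')
    ((h.fderiv_apply v).integrable_mul hF.continuousOn) (h.integrable_mul hF.continuousOn)
    (fun w hw => (hF.differentiableOn one_ne_zero).differentiableAt
      (isOpen_im_pos.mem_nhds (h.subset hw)))
    fun w _ => h.smooth.differentiable (by simp) w, neg_neg]

theorem im_rescale_pos (x : ℝ) {Y : ℝ} (hY : 0 < Y) {w : ℂ} (hw : 0 < w.im) :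
    0 < ((x : ℂ) + Y * w).im := by
  simpa using mul_pos hY hw

theorem im_ofComplex_rescale (x : ℝ) {Y : ℝ} (hY : 0 < Y) {w : ℂ} (hw : 0 < w.im) :
    (ofComplex ((x : ℂ) + Y * w)).im = Y * w.im := by
  rw [ofComplex_apply_of_im_pos (im_rescale_pos x hY hw)]
  simp [← UpperHalfPlane.coe_im]

theorem IsSmooth.contDiffOn_rescale (hf : IsSmooth f) (x : ℝ) {Y : ℝ} (hY : 0 < Y) :
    ContDiffOn ℝ ∞ (fun w : ℂ => (f ∘ ofComplex) (x + Y * w)) {w | 0 < w.im} :=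
  ContDiffOn.comp (g := f ∘ ofComplex) hf (by fun_prop) fun _ hw => im_rescale_pos x hY hw

theorem fderiv_rescale (hf : IsSmooth f) (v : ℂ) (x : ℝ) {Y : ℝ} (hY : 0 < Y) :
    Set.EqOn (fun w : ℂ => fderiv ℝ (fun w : ℂ => (f ∘ ofComplex) (x + Y * w)) w v)
      (fun w => Y * (pd v f ∘ ofComplex) (x + Y * w)) {w | 0 < w.im} := fun w hw => by
  have hpos := im_rescale_pos x hY hw
  have hscale : HasFDerivAt (fun w : ℂ => (x : ℂ) + Y * w) (Y • (1 : ℂ →L[ℝ] ℂ)) w := by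
    simpa using! ((1 : ℂ →L[ℝ] ℂ).hasFDerivAt.const_smul Y).const_add (x : ℂ)
  have hfd := ((hf.differentiableOn (by simp)).differentiableAt
    (isOpen_im_pos.mem_nhds hpos)).hasFDerivAt.comp w hscale
  have hpd : (pd v f ∘ ofComplex) (x + Y * w) = fderiv ℝ (f ∘ ofComplex) (x + Y * w) v := by
    rw [Function.comp_apply, pd, ofComplex_apply_of_im_pos hpos]
  beta_reduce
  rw [show fderiv ℝ (fun w : ℂ => (f ∘ ofComplex) (x + Y * w)) w = _ from hfd.fderiv, hpd]
  simp

theorem testPairing_add (hf : IsSmooth f) (hg : IsSmooth g) (h : IsTestFun φ) (x : ℝ) {Y : ℝ}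
    (hY : 0 < Y) : testPairing (f + g) φ x Y = testPairing f φ x Y + testPairing g φ x Y := by
  rw [testPairing, testPairing, testPairing,
    ← integral_add (h.integrable_mul (hf.contDiffOn_rescale x hY).continuousOn)
      (h.integrable_mul (hg.contDiffOn_rescale x hY).continuousOn)]
  simp only [← add_mul]
  rfl

theorem testPairing_smul (c : ℂ) (f : ℍ → ℂ) (φ : ℂ → ℂ) (x Y : ℝ) :
    testPairing (c • f) φ x Y = testPairing f (fun w => c * φ w) x Y := by
  simp only [testPairing, Function.comp_apply, Pi.smul_apply, smul_eq_mul, mul_assoc,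
    mul_left_comm c]

theorem testPairing_im_mul (f : ℍ → ℂ) (h : IsTestFun φ) (x : ℝ) {Y : ℝ} (hY : 0 < Y) :
    testPairing ((fun z : ℍ => (z.im : ℂ)) * f) φ x Y
      = Y * testPairing f (fun w => (w.im : ℂ) * φ w) x Y := by
  have him : Set.EqOn (fun w : ℂ => (((fun z : ℍ => (z.im : ℂ)) * f) ∘ ofComplex) (x + Y * w))
      (fun w => Y * w.im * (f ∘ ofComplex) (x + Y * w)) {w | 0 < w.im} := fun w hw => by
    simp only [Function.comp_apply, Pi.mul_apply, im_ofComplex_rescale x hY hw, Complex.ofReal_mul]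
  rw [testPairing, testPairing, ← integral_const_mul]
  congr 1 with w
  rw [h.mul_congr him]
  ring

theorem testPairing_pd (hf : IsSmooth f) (h : IsTestFun φ) (v : ℂ) (x : ℝ) {Y : ℝ} (hY : 0 < Y) :
    testPairing (pd v f) φ x Y
      = (Y : ℂ)⁻¹ * testPairing f (fun w => -1 * fderiv ℝ φ w v) x Y := by
  have hparts := h.integral_fderiv_mul ((hf.contDiffOn_rescale x hY).of_le (by simp)) v
  simp only [h.mul_congr (fderiv_rescale hf v x hY), mul_assoc, integral_const_mul] at hparts
  rw [testPairing, testPairing, eq_inv_mul_iff_mul_eq₀ (Complex.ofReal_ne_zero.mpr hY.ne'), hparts]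
  simp only [neg_one_mul, mul_neg, integral_neg]

theorem WeakGrowth.add (hf : IsSmooth f) (hg : IsSmooth g) (wf : WeakGrowth f)
    (wg : WeakGrowth g) : WeakGrowth (f + g) := by
  obtain ⟨a, ha⟩ := wf
  obtain ⟨b, hb⟩ := wg
  refine ⟨max a b, fun φ h => ?_⟩
  obtain ⟨C, hC⟩ := ha φ h
  obtain ⟨D, hD⟩ := hb φ h
  refine ⟨|C| + |D|, ?_⟩
  filter_upwards [hC, hD, eventually_ge_atTop 1] with Y hCY hDY hY x
  rw [testPairing_add hf hg h x (by linarith), add_mul]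
  have hpow : ∀ {c e : ℝ}, e ≤ max a b → c * Y ^ e ≤ |c| * Y ^ max a b := fun he =>
    mul_le_mul (le_abs_self _) (Real.rpow_le_rpow_of_exponent_le hY he) (by positivity)
      (abs_nonneg _)
  exact (norm_add_le _ _).trans (add_le_add ((hCY x).trans (hpow (le_max_left a b)))
    ((hDY x).trans (hpow (le_max_right a b))))

theorem WeakGrowth.of_testPairing_eq (wf : WeakGrowth f) (b : ℝ)
    (hfg : ∀ φ, IsTestFun φ → ∃ ψ, IsTestFun ψ ∧ ∀ (x : ℝ) {Y : ℝ}, 0 < Y →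
      testPairing g φ x Y = (Y ^ b : ℝ) * testPairing f ψ x Y) : WeakGrowth g := by
  obtain ⟨a, ha⟩ := wf
  refine ⟨b + a, fun φ h => ?_⟩
  obtain ⟨ψ, hψ, heq⟩ := hfg φ h
  obtain ⟨C, hC⟩ := ha ψ hψ
  refine ⟨C, ?_⟩
  filter_upwards [hC, eventually_gt_atTop 0] with Y hCY hY x
  rw [heq x hY, norm_mul, Complex.norm_real, Real.norm_of_nonneg (by positivity), Real.rpow_add hY,
    mul_left_comm]
  exact mul_le_mul_of_nonneg_left (hCY x) (by positivity)

theorem WeakGrowth.smul (c : ℂ) (wf : WeakGrowth f) : WeakGrowth (c • f) :=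
  wf.of_testPairing_eq 0 fun φ h => ⟨_, h.const_mul c, fun x Y _ => by simp [testPairing_smul]⟩

theorem WeakGrowth.im_mul (wf : WeakGrowth f) : WeakGrowth ((fun z : ℍ => (z.im : ℂ)) * f) :=
  wf.of_testPairing_eq 1 fun φ h => ⟨_, h.im_mul, fun x Y hY => by
    rw [testPairing_im_mul f h x hY, Real.rpow_one]⟩

protected theorem WeakGrowth.pd (hf : IsSmooth f) (wf : WeakGrowth f) (v : ℂ) :
    WeakGrowth (pd v f) :=
  wf.of_testPairing_eq (-1) fun φ h => ⟨_, (h.fderiv_apply v).const_mul (-1), fun x Y hY => by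
    rw [testPairing_pd hf h v x hY, Real.rpow_neg_one, Complex.ofReal_inv]⟩

theorem lap_eq_im_mul (k : ℤ) (f : ℍ → ℂ) :
    lap k f = (fun z : ℍ => (z.im : ℂ)) * ((fun z : ℍ => (z.im : ℂ)) * (pdx (pdx f) + pdy (pdy f)))
      + (-(I * k)) • ((fun z : ℍ => (z.im : ℂ)) * (pdx f + I • pdy f)) := by
  ext z
  simp only [lap, Pi.add_apply, Pi.mul_apply, Pi.smul_apply, smul_eq_mul]
  ring

protected theorem WeakGrowth.lap (hf : IsSmooth f) (wf : WeakGrowth f) (k : ℤ) :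
    WeakGrowth (lap k f) := by
  have hpd : ∀ v, IsSmooth (pd v f) := hf.pd
  have wpd : ∀ v, WeakGrowth (pd v f) := wf.pd hf
  have h1 : WeakGrowth (pdx (pdx f) + pdy (pdy f)) :=
    ((wpd 1).pd (hpd 1) 1).add ((hpd 1).pd 1) ((hpd I).pd I) ((wpd I).pd (hpd I) I)
  have h2 : WeakGrowth (pdx f + I • pdy f) :=
    (wpd 1).add (hpd 1) ((hpd I).smul I) ((wpd I).smul I)
  rw [lap_eq_im_mul]
  exact h1.im_mul.im_mul.add
    (IsSmooth.im.mul (IsSmooth.im.mul (((hpd 1).pd 1).add ((hpd I).pd I))))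
    ((IsSmooth.im.mul ((hpd 1).add ((hpd I).smul I))).smul _) (h2.im_mul.smul _)

protected theorem WeakGrowth.lower (hf : IsSmooth f) (wf : WeakGrowth f) :
    WeakGrowth (lower f) := by
  rw [lower_eq_mul, mul_assoc, dzbar_eq_smul]
  exact (((wf.pd hf 1).add (hf.pd 1) ((hf.pd I).smul I) ((wf.pd hf I).smul I)).smul _).im_mul.im_mul

theorem WeakGrowth.conj (wf : WeakGrowth f) : WeakGrowth fun z => conj (f z) := by
  obtain ⟨a, ha⟩ := wf
  refine ⟨a, fun φ h => ?_⟩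
  have hconj : IsTestFun fun w => conj (φ w) :=
    ⟨(Complex.conjCLE : ℂ →L[ℝ] ℂ).contDiff.comp h.smooth,
      h.compact.comp_left (g := starRingEnd ℂ) (by simp),
      (closure_mono (Function.support_comp_subset (map_zero (starRingEnd ℂ)) φ)).trans h.subset⟩
  obtain ⟨C, hC⟩ := ha _ hconj
  refine ⟨C, hC.mono fun Y hY x => ?_⟩
  have heq : testPairing (fun z => conj (f z)) φ x Y
      = conj (testPairing f (fun w => conj (φ w)) x Y) := by
    rw [testPairing, testPairing, ← integral_conj]
    simp
  rw [heq, RCLike.norm_conj]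
  exact hY x

theorem ModerateGrowth.weakGrowth (gf : ModerateGrowth f) : WeakGrowth f := by
  obtain ⟨α, hα⟩ := gf
  refine ⟨α, fun φ h => ?_⟩
  obtain ⟨K, hK⟩ := hα.bound
  obtain ⟨A, hA⟩ := (atImInfty_mem _).mp hK
  obtain ⟨δ, hδ, hφ⟩ := h.compact.isCompact.exists_forall_le' (f := Complex.im) (a := 0)
    Complex.continuous_im.continuousOn fun w hw => h.subset hw
  have hcont : ContinuousOn (fun w : ℂ => ((w.im ^ α : ℝ) : ℂ)) {w | 0 < w.im} :=
    Complex.continuous_ofReal.comp_continuousOn <|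
      Complex.continuous_im.continuousOn.rpow_const fun w hw => .inl (ne_of_gt hw)
  refine ⟨K * ∫ w : ℂ, ‖((w.im ^ α : ℝ) : ℂ) * φ w‖, ?_⟩
  filter_upwards [eventually_gt_atTop 0, eventually_ge_atTop (A / δ)] with Y hY hYA x
  rw [testPairing, mul_right_comm, ← integral_const_mul]
  refine norm_integral_le_of_norm_le ((h.integrable_mul hcont).norm.const_mul _)
    (.of_forall fun w => ?_)
  by_cases hw : w ∈ tsupport φ
  · have hw0 : 0 < w.im := h.subset hw
    have him := im_ofComplex_rescale x hY hw0
    have hAY : A ≤ (ofComplex ((x : ℂ) + Y * w)).im := by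
      rw [him]
      exact ((div_le_iff₀ hδ).mp hYA).trans (mul_le_mul_of_nonneg_left (hφ w hw) hY.le)
    have hbound : ‖f (ofComplex (x + Y * w))‖ ≤ K * ‖(ofComplex (x + Y * w)).im ^ α‖ := hA _ hAY
    rw [him, Real.norm_of_nonneg (by positivity), Real.mul_rpow hY.le hw0.le] at hbound
    rw [norm_mul, norm_mul, Complex.norm_real, Real.norm_of_nonneg (by positivity), ← mul_assoc,
      mul_assoc K]
    exact mul_le_mul_of_nonneg_right hbound (norm_nonneg _)
  · simp [image_eq_zero_of_notMem_tsupport hw]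

/-- The profile of a radial bump function on `ℂ` supported in the disc of radius `1 / 2`. -/
def radialBump (r : ℝ) : ℝ := Real.smoothTransition (1 - 4 * r ^ 2)

theorem radialBump_eq_zero {r : ℝ} (hr : 1 / 2 ≤ r) : radialBump r = 0 :=
  Real.smoothTransition.zero_of_nonpos (by nlinarith)

theorem contDiff_radialBump_norm : ContDiff ℝ ∞ fun u : ℂ => radialBump ‖u‖ :=
  Real.smoothTransition.contDiff.comp (contDiff_const.sub (contDiff_const.mul (contDiff_norm_sq ℝ)))

theorem support_radialBump_norm_subset (c : ℂ) :
    Function.support (fun u : ℂ => radialBump ‖u - c‖) ⊆ Metric.closedBall c (1 / 2) := by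
  intro u hu
  by_contra! hu'
  rw [Metric.mem_closedBall, dist_eq_norm, not_le] at hu'
  exact hu (radialBump_eq_zero hu'.le)

theorem isTestFun_radialBump : IsTestFun fun w : ℂ => (radialBump ‖w - I‖ : ℂ) := by
  refine .of_support_subset_closedBall (c := I) (r := 1 / 2)
    (Complex.ofRealCLM.contDiff.comp
      (contDiff_radialBump_norm.comp (contDiff_id.sub contDiff_const))) (by norm_num) ?_
  exact (Function.support_comp_subset Complex.ofReal_zero _).trans
    (support_radialBump_norm_subset I)

theorem integral_radialBump_norm_ne_zero : (∫ u : ℂ, (radialBump ‖u‖ : ℂ)) ≠ 0 := by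
  have hpos : 0 < ∫ u : ℂ, radialBump ‖u‖ := by
    refine contDiff_radialBump_norm.continuous.integral_pos_of_hasCompactSupport_nonneg_nonzero
      (x := 0) ?_ (fun u => Real.smoothTransition.nonneg _) (by simp [radialBump])
    refine HasCompactSupport.of_support_subset_isCompact (isCompact_closedBall (0 : ℂ) (1 / 2)) ?_
    simpa using support_radialBump_norm_subset 0
  rw [integral_complex_ofReal]
  exact Complex.ofReal_ne_zero.mpr hpos.ne'

theorem testPairing_radialBump (hf : MDifferentiable 𝓘(ℂ) 𝓘(ℂ) f) (z : ℍ) :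
    testPairing f (fun w => (radialBump ‖w - I‖ : ℂ)) z.re z.im
      = f z * ∫ u : ℂ, (radialBump ‖u‖ : ℂ) := by
  have hdiff : DifferentiableOn ℂ (fun u : ℂ => (f ∘ ofComplex) (z + z.im * u))
      (Metric.ball 0 1) := by
    refine (UpperHalfPlane.mdifferentiable_iff.mp hf).comp (by fun_prop) fun u hu => ?_
    have hu1 := (abs_lt.mp ((Complex.abs_im_le_norm u).trans_lt (mem_ball_zero_iff.mp hu))).1
    have him : ((z : ℂ) + z.im * u).im = z.im * (1 + u.im) := by simp; ring
    rw [Set.mem_ofPred_eq, him]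
    exact mul_pos z.im_pos (by linarith)
  have hmean := integral_mul_radial (by norm_num : (1 / 2 : ℝ) < 1) hdiff
    (ρ := fun r => (radialBump r : ℂ))
    (Complex.continuous_ofReal.comp (Real.smoothTransition.continuous.comp (by fun_prop)))
    fun r hr => by rw [radialBump_eq_zero hr, Complex.ofReal_zero]
  have hz : (z : ℂ) = z.re + z.im * I := (Complex.re_add_im (z : ℂ)).symm
  simp only [mul_zero, add_zero, Function.comp_apply, ofComplex_apply] at hmean
  rw [testPairing, ← integral_add_right_eq_self _ I, ← hmean]
  congr 1 with u
  rw [Function.comp_apply, add_sub_cancel_right, mul_add, add_comm (_ * u), ← add_assoc, ← hz]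

theorem WeakGrowth.moderateGrowth (hf : MDifferentiable 𝓘(ℂ) 𝓘(ℂ) f) (wf : WeakGrowth f) :
    ModerateGrowth f := by
  obtain ⟨α, hα⟩ := wf
  obtain ⟨C, hC⟩ := hα _ isTestFun_radialBump
  refine ⟨α, .of_bound (C / ‖∫ u : ℂ, (radialBump ‖u‖ : ℂ)‖) ?_⟩
  filter_upwards [(tendsto_comap (f := UpperHalfPlane.im)).eventually hC] with z hz
  have hzC := hz z.re
  have hpow : 0 ≤ z.im ^ α := Real.rpow_nonneg z.im_pos.le α
  rw [testPairing_radialBump hf, norm_mul] at hzC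
  rwa [Real.norm_of_nonneg hpow, div_mul_eq_mul_div,
    le_div_iff₀ (norm_pos_iff.mpr integral_radialBump_norm_ne_zero)]

end WeakGrowth

/-! ### Harmonic forms of weight two -/

section WeakForm

variable {k : ℤ} {f g : ℍ → ℂ}

/-- Smooth modular forms of weight `k` and of moderate growth in the weak sense. In contrast to
`IsModerateForm`, these are visibly stable under differential operators such as `lap k`. -/
structure IsWeakForm (k : ℤ) (f : ℍ → ℂ) : Prop where
  smooth : IsSmooth f
  modular : IsModular k f
  growth : WeakGrowth f

theorem IsModerateForm.isWeakForm (hf : IsModerateForm k f) : IsWeakForm k f :=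
  ⟨hf.smooth, hf.modular, hf.growth.weakGrowth⟩

theorem IsWeakForm.add (hf : IsWeakForm k f) (hg : IsWeakForm k g) : IsWeakForm k (f + g) :=
  ⟨hf.smooth.add hg.smooth, hf.modular.add hg.modular, hf.growth.add hf.smooth hg.smooth hg.growth⟩

theorem IsWeakForm.smul (c : ℂ) (hf : IsWeakForm k f) : IsWeakForm k (c • f) :=
  ⟨hf.smooth.smul c, hf.modular.smul c, hf.growth.smul c⟩

theorem IsWeakForm.conj (hf : IsWeakForm 0 f) : IsWeakForm 0 fun z => conj (f z) where
  smooth := hf.smooth.conj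
  modular := isModular_of_apply_smul fun γ z => by
    rw [hf.modular.apply_smul γ z, map_mul, zpow_zero, map_one]
  growth := hf.growth.conj

protected theorem IsWeakForm.lower (hf : IsWeakForm k f) : IsWeakForm (k - 2) (lower f) :=
  ⟨hf.smooth.lower, hf.modular.lower hf.smooth, hf.growth.lower hf.smooth⟩

protected theorem IsWeakForm.lap_iterate (hf : IsWeakForm k f) (m : ℕ) :
    IsWeakForm k ((lap k)^[m] f) := by
  induction m with
  | zero => exact hf
  | succ m ih =>
    rw [Function.iterate_succ_apply']
    exact ⟨ih.smooth.lap k, ih.modular.lap ih.smooth, ih.growth.lap ih.smooth k⟩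

theorem IsWeakForm.isHolModForm (hf : IsWeakForm k f) (h : ∀ z, dzbar f z = 0) :
    IsHolModForm k f :=
  have hol := mdifferentiable_of_dzbar_eq_zero hf.smooth h
  ⟨hol, hf.modular, hf.growth.moderateGrowth hol⟩

theorem IsWeakForm.eq_zero_of_lower_eq_zero (hf : IsWeakForm 2 f) (h : lower f = 0) : f = 0 :=
  (hf.isHolModForm fun z => by
    simpa [lower, z.im_ne_zero] using congrFun h z).eq_zero_of_weight_two

theorem IsWeakForm.lower_eq_const (hf : IsWeakForm 2 f) (h : lap 2 f = 0) :
    ∃ c, ∀ z, lower f z = c := by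
  have hdz : ∀ z, dz (lower f) z = 0 := fun z => by
    simpa [lap_eq_raise_lower hf.smooth, raise] using congrFun h z
  have hdzbar : ∀ z, dzbar (fun z => conj (lower f z)) z = 0 := fun z => by
    rw [(hf.smooth.lower.hasWirtingerAt z).conj.dzbar_eq, hdz, map_zero]
  obtain ⟨c, hc⟩ := (IsWeakForm.conj hf.lower).isHolModForm hdzbar |>.eq_const_of_weight_zero
  exact ⟨conj c, fun z => by rw [← hc z, Complex.conj_conj]⟩

theorem lower_add (hf : IsSmooth f) (hg : IsSmooth g) : lower (f + g) = lower f + lower g := by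
  simp only [lower_eq_mul, dzbar_add hf hg, mul_add]

theorem lower_smul (c : ℂ) (hf : IsSmooth f) : lower (c • f) = c • lower f := by
  simp only [lower_eq_mul, dzbar_smul c hf, mul_smul_comm]

theorem IsWeakForm.exists_eq_smul (hf : IsWeakForm 2 f) (hg : IsWeakForm 2 g)
    (lf : lap 2 f = 0) (lg : lap 2 g = 0) (hg0 : g ≠ 0) : ∃ c : ℂ, f = c • g := by
  obtain ⟨a, ha⟩ := hf.lower_eq_const lf
  obtain ⟨b, hb⟩ := hg.lower_eq_const lg
  have hb0 : b ≠ 0 := fun h => hg0 <| hg.eq_zero_of_lower_eq_zero <| funext fun z => by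
    rw [hb, h, Pi.zero_apply]
  have hdiff : f + (-(a / b)) • g = 0 := (hf.add (hg.smul _)).eq_zero_of_lower_eq_zero <| by
    ext z
    rw [lower_add hf.smooth (hg.smooth.smul _), lower_smul _ hg.smooth, Pi.add_apply,
      Pi.smul_apply, ha, hb, smul_eq_mul, neg_mul, div_mul_cancel₀ a hb0, add_neg_cancel,
      Pi.zero_apply]
  exact ⟨a / b, funext fun z => by
    simpa [← sub_eq_add_neg, sub_eq_zero] using congrFun hdiff z⟩

end WeakForm

/-! ### Theta integrals over binary quadratic forms -/

section Lattice

/-- The measure on `ℤ² × ℝ` for summation over `ℤ²` and integration over `(1, ∞)`. -/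
def latticeMeasure : Measure ((Fin 2 → ℤ) × ℝ) :=
  (Measure.count : Measure (Fin 2 → ℤ)).prod (volume.restrict (Set.Ioi (1 : ℝ)))

theorem ae_latticeMeasure_one_lt : ∀ᵐ p ∂latticeMeasure, 1 < p.2 :=
  Measure.quasiMeasurePreserving_snd.ae
    (ae_restrict_mem measurableSet_Ioi : ∀ᵐ t ∂(volume.restrict (Set.Ioi (1 : ℝ))), 1 < t)

/-- An integrable function on `ℤ² × (1, ∞)`, used to dominate exponentially damped integrands of
polynomial growth. At the origin of `ℤ²` it takes the junk value `0`. -/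
def latticeDecay (p : (Fin 2 → ℤ) × ℝ) : ℝ := ‖p.1‖ ^ (-4 : ℝ) * p.2 ^ (-4 : ℝ)

theorem integrable_latticeDecay : Integrable latticeDecay latticeMeasure :=
  Integrable.mul_prod (f := fun v : Fin 2 → ℤ => ‖v‖ ^ (-4 : ℝ)) (g := fun t : ℝ => t ^ (-4 : ℝ))
    (integrable_count_iff.mpr
      (EisensteinSeries.summable_one_div_norm_rpow (k := 4) (by norm_num)).norm)
    (integrableOn_Ioi_rpow_of_lt (by norm_num) one_pos)

theorem abs_coord_le_norm (v : Fin 2 → ℤ) (i : Fin 2) : |(v i : ℝ)| ≤ ‖v‖ := by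
  simpa only [Int.norm_eq_abs] using norm_le_pi_norm v i

theorem one_le_norm_of_ne_zero {v : Fin 2 → ℤ} (hv : v ≠ 0) : 1 ≤ ‖v‖ := by
  obtain ⟨i, hi⟩ := Function.ne_iff.mp hv
  exact le_trans (mod_cast Int.one_le_abs hi) (abs_coord_le_norm v i)

theorem pow_mul_exp_neg_le {c u : ℝ} (hc : 0 < c) (hu : 0 ≤ u) (n : ℕ) :
    u ^ n * Real.exp (-(c * u)) ≤ n.factorial / c ^ n := by
  have h := Real.pow_div_factorial_le_exp (x := c * u) (by positivity) n
  rw [div_le_iff₀ (by positivity), mul_pow] at h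
  rw [Real.exp_neg, le_div_iff₀ (by positivity), ← div_eq_mul_inv, div_mul_eq_mul_div,
    div_le_iff₀ (Real.exp_pos _)]
  linarith

end Lattice

section Weights

variable {a b : (Fin 2 → ℤ) × ℝ → ℂ}

/-- Coefficient functions of polynomial growth on `ℤ² × (1, ∞)` which vanish at the origin
of `ℤ²`. -/
structure IsWeight (a : (Fin 2 → ℤ) × ℝ → ℂ) : Prop where
  measurable : Measurable a
  zero : ∀ t, a (0, t) = 0
  bound : ∃ (C : ℝ) (n : ℕ), 0 ≤ C ∧ ∀ v t, 1 < t → ‖a (v, t)‖ ≤ C * (‖v‖ * t) ^ n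

theorem IsWeight.bounded_mul (ha : IsWeight a) (hb : Measurable b)
    (h : ∃ (C : ℝ) (n : ℕ), 0 ≤ C ∧ ∀ v t, v ≠ 0 → 1 < t → ‖b (v, t)‖ ≤ C * (‖v‖ * t) ^ n) :
    IsWeight (b * a) := by
  obtain ⟨C, n, hC, hn⟩ := ha.bound
  obtain ⟨D, k, hD, hk⟩ := h
  refine ⟨hb.mul ha.measurable, fun t => by simp [ha.zero], C * D, n + k, by positivity,
    fun v t ht => ?_⟩
  obtain rfl | hv := eq_or_ne v 0
  · simp only [Pi.mul_apply, ha.zero, mul_zero, norm_zero]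
    positivity
  · calc ‖b (v, t) * a (v, t)‖ = ‖b (v, t)‖ * ‖a (v, t)‖ := norm_mul _ _
      _ ≤ (D * (‖v‖ * t) ^ k) * (C * (‖v‖ * t) ^ n) :=
        mul_le_mul (hk v t hv ht) (hn v t ht) (norm_nonneg _) (by positivity)
      _ = C * D * (‖v‖ * t) ^ (n + k) := by ring

theorem IsWeight.coord_mul (ha : IsWeight a) (i : Fin 2) :
    IsWeight ((fun p => (p.1 i : ℂ)) * a) := by
  refine ha.bounded_mul (by fun_prop) ⟨1, 1, zero_le_one, fun v t _ ht => ?_⟩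
  rw [one_mul, pow_one, Complex.norm_intCast]
  nlinarith [norm_nonneg v, abs_coord_le_norm v i]

theorem IsWeight.snd_mul (ha : IsWeight a) : IsWeight ((fun p => (p.2 : ℂ)) * a) := by
  refine ha.bounded_mul (by fun_prop) ⟨1, 1, zero_le_one, fun v t hv ht => ?_⟩
  rw [one_mul, pow_one, Complex.norm_of_nonneg (by linarith)]
  nlinarith [one_le_norm_of_ne_zero hv]

theorem IsWeight.const_mul (ha : IsWeight a) (c : ℂ) : IsWeight ((fun _ => c) * a) :=
  ha.bounded_mul measurable_const ⟨‖c‖, 0, norm_nonneg _, fun v t _ _ => by simp⟩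

theorem IsWeight.exists_norm_mul_exp_le (ha : IsWeight a) :
    ∃ (B : ℝ) (N : ℕ), ∀ κ > 0, ∀ p, 1 < p.2 →
      ‖a p‖ * Real.exp (-(π * p.2 * (κ * ‖p.1‖ ^ 2))) ≤ B / κ ^ N * latticeDecay p := by
  obtain ⟨C, n, hC, hn⟩ := ha.bound
  refine ⟨C * ((n + 4).factorial / π ^ (n + 4)), n + 4, fun κ hκ ⟨v, t⟩ ht => ?_⟩
  obtain rfl | hv := eq_or_ne v 0
  · simp [ha.zero, latticeDecay]
  have hv1 := one_le_norm_of_ne_zero hv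
  have hv0 : 0 < ‖v‖ := by linarith
  have ht0 : 0 < t := one_pos.trans ht
  have hexp : Real.exp (-(π * t * (κ * ‖v‖ ^ 2))) ≤ Real.exp (-(π * κ * (‖v‖ * t))) := by
    rw [Real.exp_le_exp, neg_le_neg_iff]
    calc π * κ * (‖v‖ * t) ≤ π * κ * (‖v‖ ^ 2 * t) := by
          gcongr; exact le_self_pow₀ hv1 two_ne_zero
      _ = π * t * (κ * ‖v‖ ^ 2) := by ring
  have hdecay : latticeDecay (v, t) = ((‖v‖ * t) ^ 4)⁻¹ := by
    rw [latticeDecay, ← Real.mul_rpow hv0.le ht0.le, Real.rpow_neg (by positivity)]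
    norm_cast
  calc ‖a (v, t)‖ * Real.exp (-(π * t * (κ * ‖v‖ ^ 2)))
      ≤ C * (‖v‖ * t) ^ n * Real.exp (-(π * κ * (‖v‖ * t))) :=
        mul_le_mul (hn v t ht) hexp (Real.exp_pos _).le (by positivity)
    _ = C * ((‖v‖ * t) ^ (n + 4) * Real.exp (-(π * κ * (‖v‖ * t)))) * ((‖v‖ * t) ^ 4)⁻¹ := by
        rw [pow_add]; field_simp
    _ ≤ C * ((n + 4).factorial / (π * κ) ^ (n + 4)) * ((‖v‖ * t) ^ 4)⁻¹ := by
        have := pow_mul_exp_neg_le (mul_pos Real.pi_pos hκ) (u := ‖v‖ * t) (by positivity) (n + 4)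
        gcongr
    _ = _ := by rw [hdecay, mul_pow]; field_simp

end Weights

section ThetaIntegrals

variable {a : (Fin 2 → ℤ) × ℝ → ℂ} {q : ℝ × ℝ × ℝ} {κ : ℝ}

/-- The binary quadratic form `q₁ v₀² + 2 q₂ v₀ v₁ + q₃ v₁²`. -/
def quadForm (q : ℝ × ℝ × ℝ) (v : Fin 2 → ℤ) : ℝ :=
  q.1 * (v 0 : ℝ) ^ 2 + 2 * q.2.1 * ((v 0 : ℝ) * (v 1 : ℝ)) + q.2.2 * (v 1 : ℝ) ^ 2

/-- The coefficient vectors of positive definite binary quadratic forms. -/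
def posForms : Set (ℝ × ℝ × ℝ) :=
  {q | ∃ κ > 0, ∀ v : Fin 2 → ℤ, κ * ‖v‖ ^ 2 ≤ quadForm q v}

theorem quadForm_sub (q r : ℝ × ℝ × ℝ) (v : Fin 2 → ℤ) :
    quadForm (q - r) v = quadForm q v - quadForm r v := by
  simp only [quadForm, Prod.fst_sub, Prod.snd_sub]
  ring

theorem abs_quadForm_le (q : ℝ × ℝ × ℝ) (v : Fin 2 → ℤ) :
    |quadForm q v| ≤ 4 * ‖q‖ * ‖v‖ ^ 2 := by
  have h1 : |q.1| ≤ ‖q‖ := norm_fst_le q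
  have h2 : |q.2.1| ≤ ‖q‖ := (norm_fst_le q.2).trans (norm_snd_le q)
  have h3 : |q.2.2| ≤ ‖q‖ := (norm_snd_le q.2).trans (norm_snd_le q)
  have hv0 := abs_coord_le_norm v 0
  have hv1 := abs_coord_le_norm v 1
  calc |quadForm q v|
      ≤ |q.1 * (v 0 : ℝ) ^ 2| + |2 * q.2.1 * ((v 0 : ℝ) * v 1)| + |q.2.2 * (v 1 : ℝ) ^ 2| :=
        abs_add_three _ _ _
    _ = |q.1| * |(v 0 : ℝ)| ^ 2 + 2 * |q.2.1| * (|(v 0 : ℝ)| * |(v 1 : ℝ)|)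
        + |q.2.2| * |(v 1 : ℝ)| ^ 2 := by simp only [abs_mul, abs_pow, abs_two]
    _ ≤ ‖q‖ * ‖v‖ ^ 2 + 2 * ‖q‖ * (‖v‖ * ‖v‖) + ‖q‖ * ‖v‖ ^ 2 := by gcongr
    _ = 4 * ‖q‖ * ‖v‖ ^ 2 := by ring

theorem exists_ball_le_quadForm (hq : q ∈ posForms) :
    ∃ κ > 0, ∃ ε > 0, ∀ r ∈ Metric.ball q ε, ∀ v : Fin 2 → ℤ, κ * ‖v‖ ^ 2 ≤ quadForm r v := by
  obtain ⟨κ, hκ, h⟩ := hq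
  refine ⟨κ / 2, by positivity, κ / 8, by positivity, fun r hr v => ?_⟩
  rw [Metric.mem_ball, dist_eq_norm] at hr
  have hsub := (abs_le.mp (abs_quadForm_le (r - q) v)).1
  rw [quadForm_sub] at hsub
  have : ‖r - q‖ * ‖v‖ ^ 2 ≤ κ / 8 * ‖v‖ ^ 2 := by gcongr
  linarith [h v]

theorem isOpen_posForms : IsOpen posForms :=
  Metric.isOpen_iff.mpr fun _ hq =>
    have ⟨κ, hκ, ε, hε, h⟩ := exists_ball_le_quadForm hq
    ⟨ε, hε, fun r hr => ⟨κ, hκ, h r hr⟩⟩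

/-- The Gaussian `e^{-π t q(v)}`. -/
def gauss (q : ℝ × ℝ × ℝ) (p : (Fin 2 → ℤ) × ℝ) : ℂ :=
  (Real.exp (-(π * p.2 * quadForm q p.1)) : ℝ)

theorem measurable_gauss (q : ℝ × ℝ × ℝ) : Measurable (gauss q) := by
  unfold gauss quadForm
  fun_prop

theorem norm_gauss_le (h : ∀ v : Fin 2 → ℤ, κ * ‖v‖ ^ 2 ≤ quadForm q v)
    {p : (Fin 2 → ℤ) × ℝ} (hp : 1 < p.2) :
    ‖gauss q p‖ ≤ Real.exp (-(π * p.2 * (κ * ‖p.1‖ ^ 2))) := by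
  rw [gauss, Complex.norm_of_nonneg (Real.exp_pos _).le, Real.exp_le_exp, neg_le_neg_iff]
  gcongr
  exact h p.1

theorem IsWeight.exists_norm_mul_gauss_le (ha : IsWeight a) :
    ∃ (B : ℝ) (N : ℕ), ∀ κ > 0, ∀ q : ℝ × ℝ × ℝ, (∀ v : Fin 2 → ℤ, κ * ‖v‖ ^ 2 ≤ quadForm q v) →
      ∀ p, 1 < p.2 → ‖a p * gauss q p‖ ≤ B / κ ^ N * latticeDecay p := by
  obtain ⟨B, N, h⟩ := ha.exists_norm_mul_exp_le
  refine ⟨B, N, fun κ hκ q hq p hp => ?_⟩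
  rw [norm_mul]
  exact (mul_le_mul_of_nonneg_left (norm_gauss_le hq hp) (norm_nonneg _)).trans (h κ hκ p hp)

theorem IsWeight.aestronglyMeasurable_mul_gauss (ha : IsWeight a) (q : ℝ × ℝ × ℝ) :
    AEStronglyMeasurable (fun p => a p * gauss q p) latticeMeasure :=
  (ha.measurable.mul (measurable_gauss q)).aestronglyMeasurable

theorem IsWeight.integrable (ha : IsWeight a) (hq : q ∈ posForms) :
    Integrable (fun p => a p * gauss q p) latticeMeasure := by
  obtain ⟨κ, hκ, h⟩ := hq
  obtain ⟨B, N, hB⟩ := ha.exists_norm_mul_gauss_le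
  refine (integrable_latticeDecay.const_mul (B / κ ^ N)).mono'
    (ha.aestronglyMeasurable_mul_gauss q) ?_
  filter_upwards [ae_latticeMeasure_one_lt] with p hp using hB κ hκ q h p hp

/-- The theta integral `∑ᵥ ∫₁^∞ a(v, t) e^{-π t q(v)} dt` as a function of the form `q`. -/
def thetaInt (a : (Fin 2 → ℤ) × ℝ → ℂ) (q : ℝ × ℝ × ℝ) : ℂ :=
  ∫ p, a p * gauss q p ∂latticeMeasure

/-- The weight `-π t vᵢ vⱼ a(v, t)`: differentiating `a · gauss q` with respect to a coefficient
of `q` replaces `a` by a multiple of it. -/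
def dWeight (i j : Fin 2) (a : (Fin 2 → ℤ) × ℝ → ℂ) : (Fin 2 → ℤ) × ℝ → ℂ :=
  (fun _ => (-π : ℂ)) * ((fun p => (p.2 : ℂ)) * ((fun p => (p.1 i : ℂ)) *
    ((fun p => (p.1 j : ℂ)) * a)))

protected theorem IsWeight.dWeight (ha : IsWeight a) (i j : Fin 2) : IsWeight (dWeight i j a) :=
  ((ha.coord_mul j).coord_mul i).snd_mul.const_mul _

/-- The linear form `r ↦ r₁ a + 2 r₂ b + r₃ c` with coefficient vector `(a, b, c)`. -/
def coeffForm : ℂ × ℂ × ℂ →L[ℝ] ℝ × ℝ × ℝ →L[ℝ] ℂ :=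
  LinearMap.toContinuousLinearMap <|
    LinearMap.toContinuousLinearMap.toLinearMap ∘ₗ
      LinearMap.mk₂ ℝ (fun (w : ℂ × ℂ × ℂ) (r : ℝ × ℝ × ℝ) =>
        r.1 * w.1 + (r.2.1 * (2 * w.2.1) + r.2.2 * w.2.2))
        (fun _ _ _ => by simp; ring) (fun _ _ _ => by simp; ring)
        (fun _ _ _ => by simp; ring) (fun _ _ _ => by simp; ring)

theorem coeffForm_apply (w : ℂ × ℂ × ℂ) (r : ℝ × ℝ × ℝ) :
    coeffForm w r = r.1 * w.1 + (r.2.1 * (2 * w.2.1) + r.2.2 * w.2.2) :=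
  rfl

/-- The coefficient vector of the differential of `q ↦ a p * gauss q p`. -/
def gaussGradient (a : (Fin 2 → ℤ) × ℝ → ℂ) (q : ℝ × ℝ × ℝ) (p : (Fin 2 → ℤ) × ℝ) : ℂ × ℂ × ℂ :=
  (dWeight 0 0 a p * gauss q p, dWeight 0 1 a p * gauss q p, dWeight 1 1 a p * gauss q p)

theorem hasFDerivAt_mul_gauss (a : (Fin 2 → ℤ) × ℝ → ℂ) (q : ℝ × ℝ × ℝ) (p : (Fin 2 → ℤ) × ℝ) :
    HasFDerivAt (fun q => a p * gauss q p) (coeffForm (gaussGradient a q p)) q := by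
  have hexponent : (fun q => ((-(π * p.2 * quadForm q p.1) : ℝ) : ℂ)) =
      coeffForm (-π * p.2 * p.1 0 ^ 2, -π * p.2 * (p.1 0 * p.1 1), -π * p.2 * p.1 1 ^ 2) := by
    ext q
    rw [coeffForm_apply, quadForm]
    push_cast
    ring
  have hd := ((coeffForm (-π * p.2 * p.1 0 ^ 2, -π * p.2 * (p.1 0 * p.1 1),
    -π * p.2 * p.1 1 ^ 2)).hasFDerivAt (x := q)).cexp.const_mul (a p)
  rw [← hexponent] at hd
  simp only [← Complex.ofReal_exp] at hd
  refine hd.congr_fderiv (ContinuousLinearMap.ext fun r => ?_)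
  simp only [_root_.smul_apply, coeffForm_apply, smul_eq_mul, gaussGradient, dWeight,
    Pi.mul_apply, gauss]
  ring

theorem IsWeight.integrable_gaussGradient (ha : IsWeight a) (hq : q ∈ posForms) :
    Integrable (gaussGradient a q) latticeMeasure :=
  ((ha.dWeight 0 0).integrable hq).prodMk
    (((ha.dWeight 0 1).integrable hq).prodMk ((ha.dWeight 1 1).integrable hq))

theorem IsWeight.integral_gaussGradient (ha : IsWeight a) (hq : q ∈ posForms) :
    ∫ p, gaussGradient a q p ∂latticeMeasure
      = (thetaInt (dWeight 0 0 a) q, thetaInt (dWeight 0 1 a) q, thetaInt (dWeight 1 1 a) q) := by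
  have h00 := (ha.dWeight 0 0).integrable hq
  have h01 := (ha.dWeight 0 1).integrable hq
  have h11 := (ha.dWeight 1 1).integrable hq
  exact (integral_pair h00 (h01.prodMk h11)).trans (congrArg _ (integral_pair h01 h11))

theorem IsWeight.exists_norm_gaussGradient_le (ha : IsWeight a) (hκ : 0 < κ) :
    ∃ B, ∀ q : ℝ × ℝ × ℝ, (∀ v : Fin 2 → ℤ, κ * ‖v‖ ^ 2 ≤ quadForm q v) →
      ∀ p, 1 < p.2 → ‖gaussGradient a q p‖ ≤ B * latticeDecay p := by
  obtain ⟨B₀, N₀, h₀⟩ := (ha.dWeight 0 0).exists_norm_mul_gauss_le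
  obtain ⟨B₁, N₁, h₁⟩ := (ha.dWeight 0 1).exists_norm_mul_gauss_le
  obtain ⟨B₂, N₂, h₂⟩ := (ha.dWeight 1 1).exists_norm_mul_gauss_le
  refine ⟨B₀ / κ ^ N₀ + (B₁ / κ ^ N₁ + B₂ / κ ^ N₂), fun q hq p hp => ?_⟩
  rw [add_mul, add_mul]
  refine (max_le_add_of_nonneg (norm_nonneg _) (norm_nonneg _)).trans
    (add_le_add (h₀ κ hκ q hq p hp) ?_)
  exact (max_le_add_of_nonneg (norm_nonneg _) (norm_nonneg _)).trans
    (add_le_add (h₁ κ hκ q hq p hp) (h₂ κ hκ q hq p hp))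

theorem hasFDerivAt_thetaInt (ha : IsWeight a) (hq : q ∈ posForms) :
    HasFDerivAt (thetaInt a) (coeffForm (thetaInt (dWeight 0 0 a) q,
      thetaInt (dWeight 0 1 a) q, thetaInt (dWeight 1 1 a) q)) q := by
  obtain ⟨κ, hκ, ε, hε, hball⟩ := exists_ball_le_quadForm hq
  obtain ⟨B, hB⟩ := ha.exists_norm_gaussGradient_le hκ
  have hint := ha.integrable_gaussGradient hq
  rw [← ha.integral_gaussGradient hq, ← coeffForm.integral_comp_comm hint]
  refine hasFDerivAt_integral_of_dominated_of_fderiv_le (Metric.ball_mem_nhds q hε)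
    (.of_forall ha.aestronglyMeasurable_mul_gauss) (ha.integrable hq)
    (coeffForm.integrable_comp hint).aestronglyMeasurable ?_
    (integrable_latticeDecay.const_mul (‖coeffForm‖ * B))
    (.of_forall fun p r _ => hasFDerivAt_mul_gauss a r p)
  filter_upwards [ae_latticeMeasure_one_lt] with p hp r hr
  rw [mul_assoc]
  exact coeffForm.le_opNorm_of_le (hB r (hball r hr) p hp)

theorem contDiffOn_thetaInt (ha : IsWeight a) : ContDiffOn ℝ ∞ (thetaInt a) posForms := by
  rw [contDiffOn_infty]
  intro n
  induction n generalizing a with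
  | zero =>
    exact contDiffOn_zero.mpr fun q hq =>
      (hasFDerivAt_thetaInt ha hq).continuousAt.continuousWithinAt
  | succ n ih =>
    rw [Nat.cast_succ, contDiffOn_succ_iff_hasFDerivWithinAt_of_uniqueDiffOn
      isOpen_posForms.uniqueDiffOn]
    exact ⟨fun h => by simp at h, _,
      coeffForm.contDiff.comp_contDiffOn ((ih (ha.dWeight 0 0)).prodMk
        ((ih (ha.dWeight 0 1)).prodMk (ih (ha.dWeight 1 1)))),
      fun q hq => (hasFDerivAt_thetaInt ha hq).hasFDerivWithinAt⟩

end ThetaIntegrals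

/-! ### Kernel integrals on the upper half-plane -/

section Forms

/-- The coefficients of the quadratic form `|c w + d|² / Im w` in `(c, d)`. -/
def formMap (w : ℂ) : ℝ × ℝ × ℝ := (Complex.normSq w / w.im, w.re / w.im, 1 / w.im)

theorem quadForm_formMap (z : ℍ) (v : Fin 2 → ℤ) :
    quadForm (formMap z) v = Complex.normSq (v 0 * z + v 1) / z.im := by
  have h : z.im ≠ 0 := z.im_pos.ne'
  simp only [quadForm, formMap, Complex.normSq_apply, coe_im, coe_re, Complex.add_re,
    Complex.mul_re, Complex.add_im, Complex.mul_im, Complex.intCast_re, Complex.intCast_im]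
  field_simp
  ring

theorem r_sq_mul_le_quadForm (z : ℍ) (v : Fin 2 → ℤ) :
    EisensteinSeries.r z ^ 2 / z.im * ‖v‖ ^ 2 ≤ quadForm (formMap z) v := by
  rw [quadForm_formMap, Complex.normSq_eq_norm_sq]
  obtain rfl | hv := eq_or_ne v 0
  · simp
  · have hr := EisensteinSeries.r_mul_max_le z hv
    have hr0 := EisensteinSeries.r_pos z
    rw [div_mul_eq_mul_div, ← mul_pow]
    have := z.im_pos
    gcongr

theorem formMap_mem_posForms (z : ℍ) : formMap z ∈ posForms :=
  ⟨EisensteinSeries.r z ^ 2 / z.im,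
    div_pos (pow_pos (EisensteinSeries.r_pos z) 2) z.im_pos, r_sq_mul_le_quadForm z⟩

theorem contDiffOn_formMap : ContDiffOn ℝ ∞ formMap {w : ℂ | 0 < w.im} := by
  have him : ContDiff ℝ ∞ Complex.im := Complex.imCLM.contDiff
  have hre : ContDiff ℝ ∞ Complex.re := Complex.reCLM.contDiff
  have hnormSq : ContDiff ℝ ∞ fun w : ℂ => Complex.normSq w := by
    simp only [Complex.normSq_apply]
    exact (hre.mul hre).add (him.mul him)
  have h0 : ∀ w ∈ {w : ℂ | 0 < w.im}, w.im ≠ 0 := fun w hw => ne_of_gt hw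
  exact (hnormSq.contDiffOn.div him.contDiffOn h0).prodMk
    ((hre.contDiffOn.div him.contDiffOn h0).prodMk (contDiffOn_const.div him.contDiffOn h0))

variable {c : ℍ → ℂ} {Θ : ℝ × ℝ × ℝ → ℂ} {Θ' : ℝ × ℝ × ℝ →L[ℝ] ℂ} {z : ℍ}

theorem IsSmooth.comp_formMap (h : ContDiffOn ℝ ∞ Θ posForms) :
    IsSmooth fun z => Θ (formMap z) :=
  (h.comp contDiffOn_formMap fun w hw => formMap_mem_posForms ⟨w, hw⟩).congr
    (eqOn_comp_ofComplex fun _ => rfl)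

theorem hasFDerivAt_comp_formMap (h : HasFDerivAt Θ Θ' (formMap z)) :
    HasFDerivAt ((fun z : ℍ => Θ (formMap z)) ∘ ofComplex) (Θ' ∘L fderiv ℝ formMap z) (z : ℂ) := by
  have hform : HasFDerivAt formMap (fderiv ℝ formMap z) (z : ℂ) :=
    ((contDiffOn_formMap.differentiableOn (by simp)).differentiableAt
      (isOpen_im_pos.mem_nhds z.im_pos)).hasFDerivAt
  exact (h.comp (z : ℂ) hform).congr_of_eventuallyEq
    ((eqOn_comp_ofComplex (F := Θ ∘ formMap) fun _ => rfl).eventuallyEq_of_mem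
      (isOpen_im_pos.mem_nhds z.im_pos))

/-- The derivative in the direction `v` of the form-valued map `formMap`, read off by the linear
form with coefficient vector `w`. -/
def dForm (v : ℂ) (w : ℂ × ℂ × ℂ) : ℍ → ℂ := pd v fun z => coeffForm w (formMap z)

theorem IsSmooth.dForm (v : ℂ) (w : ℂ × ℂ × ℂ) : IsSmooth (dForm v w) :=
  (IsSmooth.comp_formMap (coeffForm w).contDiff.contDiffOn).pd v

theorem dForm_apply (v : ℂ) (w : ℂ × ℂ × ℂ) (z : ℍ) :
    dForm v w z = coeffForm w (fderiv ℝ formMap z v) := by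
  rw [dForm, pd, (hasFDerivAt_comp_formMap (coeffForm w).hasFDerivAt).fderiv]
  rfl

theorem pd_mul_comp_formMap (hc : IsSmooth c) {w : ℂ × ℂ × ℂ}
    (h : HasFDerivAt Θ (coeffForm w) (formMap z)) (v : ℂ) :
    pd v (fun z => c z * Θ (formMap z)) z = pd v c z * Θ (formMap z) +
      (c z * dForm v (1, 0, 0) z * w.1 + (c z * dForm v (0, 1, 0) z * w.2.1 +
        c z * dForm v (0, 0, 1) z * w.2.2)) := by
  have hmul := (hc.differentiableAt z).hasFDerivAt.mul (hasFDerivAt_comp_formMap h)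
  have hcomp : (fun z => c z * Θ (formMap z)) ∘ ofComplex
      = (c ∘ ofComplex) * ((fun z : ℍ => Θ (formMap z)) ∘ ofComplex) := rfl
  simp only [dForm_apply, coeffForm_apply]
  rw [pd, hcomp, hmul.fderiv]
  simp [pd, coeffForm_apply]
  ring

theorem contDiff_gauss (p : (Fin 2 → ℤ) × ℝ) : ContDiff ℝ ∞ fun q => gauss q p := by
  refine Complex.ofRealCLM.contDiff.comp (Real.contDiff_exp.comp ?_)
  unfold quadForm
  fun_prop

end Forms

section Kernels

variable {K L : ℍ → (Fin 2 → ℤ) × ℝ → ℂ} {c : ℍ → ℂ} {a : (Fin 2 → ℤ) × ℝ → ℂ}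

/-- Finite sums of products of a smooth function of `z`, a weight and the Gaussian
`e^{-π t |c z + d|² / y}`. This class of integrands is closed under differentiation in `z`. -/
inductive IsKernel : (ℍ → (Fin 2 → ℤ) × ℝ → ℂ) → Prop
  | base {c : ℍ → ℂ} {a : (Fin 2 → ℤ) × ℝ → ℂ} (hc : IsSmooth c) (ha : IsWeight a) :
      IsKernel fun z p => c z * (a p * gauss (formMap z) p)
  | add {K L : ℍ → (Fin 2 → ℤ) × ℝ → ℂ} (hK : IsKernel K) (hL : IsKernel L) :
      IsKernel fun z p => K z p + L z p

/-- The integral of a kernel over `ℤ² × (1, ∞)`. -/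
def kernelInt (K : ℍ → (Fin 2 → ℤ) × ℝ → ℂ) (z : ℍ) : ℂ := ∫ p, K z p ∂latticeMeasure

theorem IsKernel.integrable (hK : IsKernel K) (z : ℍ) : Integrable (K z) latticeMeasure := by
  induction hK with
  | base _ ha => exact (ha.integrable (formMap_mem_posForms z)).const_mul _
  | add _ _ iK iL => exact iK.add iL

theorem IsKernel.kernelInt_add (hK : IsKernel K) (hL : IsKernel L) :
    kernelInt (fun z p => K z p + L z p) = kernelInt K + kernelInt L :=
  funext fun z => integral_add (hK.integrable z) (hL.integrable z)

theorem kernelInt_mul (c : ℍ → ℂ) (K : ℍ → (Fin 2 → ℤ) × ℝ → ℂ) :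
    kernelInt (fun z p => c z * K z p) = c * kernelInt K :=
  funext fun _ => integral_const_mul _ _

theorem IsKernel.isSmooth (hK : IsKernel K) (p : (Fin 2 → ℤ) × ℝ) : IsSmooth fun z => K z p := by
  induction hK with
  | base hc _ =>
    exact hc.mul ((IsSmooth.const _).mul (IsSmooth.comp_formMap (contDiff_gauss p).contDiffOn))
  | add _ _ iK iL => exact iK.add iL

theorem IsKernel.isSmooth_kernelInt (hK : IsKernel K) : IsSmooth (kernelInt K) := by
  induction hK with
  | base hc ha =>
    rw [kernelInt_mul]
    exact hc.mul (IsSmooth.comp_formMap (contDiffOn_thetaInt ha))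
  | add hK hL iK iL =>
    rw [hK.kernelInt_add hL]
    exact iK.add iL

theorem IsKernel.mul (hK : IsKernel K) (hc : IsSmooth c) : IsKernel fun z p => c z * K z p := by
  induction hK with
  | base hd ha =>
    simp_rw [← mul_assoc (c _)]
    exact .base (hc.mul hd) ha
  | add _ _ iK iL =>
    simp_rw [mul_add]
    exact .add iK iL

theorem pd_mul_gauss (hc : IsSmooth c) (a : (Fin 2 → ℤ) × ℝ → ℂ) (v : ℂ) (z : ℍ)
    (p : (Fin 2 → ℤ) × ℝ) :
    pd v (fun z => c z * (a p * gauss (formMap z) p)) z =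
      pd v c z * (a p * gauss (formMap z) p) +
      ((c * dForm v (1, 0, 0)) z * (dWeight 0 0 a p * gauss (formMap z) p) +
      ((c * dForm v (0, 1, 0)) z * (dWeight 0 1 a p * gauss (formMap z) p) +
        (c * dForm v (0, 0, 1)) z * (dWeight 1 1 a p * gauss (formMap z) p))) :=
  pd_mul_comp_formMap hc (hasFDerivAt_mul_gauss a (formMap z) p) v

theorem pd_mul_thetaInt (hc : IsSmooth c) (ha : IsWeight a) (v : ℂ) (z : ℍ) :
    pd v (fun z => c z * thetaInt a (formMap z)) z =
      pd v c z * thetaInt a (formMap z) +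
      ((c * dForm v (1, 0, 0)) z * thetaInt (dWeight 0 0 a) (formMap z) +
      ((c * dForm v (0, 1, 0)) z * thetaInt (dWeight 0 1 a) (formMap z) +
        (c * dForm v (0, 0, 1)) z * thetaInt (dWeight 1 1 a) (formMap z))) :=
  pd_mul_comp_formMap hc (hasFDerivAt_thetaInt ha (formMap_mem_posForms z)) v

protected theorem IsKernel.pd_add (hK : IsKernel K) (hL : IsKernel L) (v : ℂ) :
    (fun z p => pd v (fun z => K z p + L z p) z) =
      fun z p => pd v (fun z => K z p) z + pd v (fun z => L z p) z :=
  funext₂ fun z p => congrFun (pd_add v (hK.isSmooth p) (hL.isSmooth p)) z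

protected theorem IsKernel.pd (hK : IsKernel K) (v : ℂ) :
    IsKernel (fun z p => pd v (fun z => K z p) z) ∧
      pd v (kernelInt K) = kernelInt fun z p => pd v (fun z => K z p) z := by
  induction hK with
  | @base c a hc ha =>
    have h := IsKernel.base (hc.pd v) ha
    have h00 := IsKernel.base (hc.mul (IsSmooth.dForm v (1, 0, 0))) (ha.dWeight 0 0)
    have h01 := IsKernel.base (hc.mul (IsSmooth.dForm v (0, 1, 0))) (ha.dWeight 0 1)
    have h11 := IsKernel.base (hc.mul (IsSmooth.dForm v (0, 0, 1))) (ha.dWeight 1 1)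
    simp_rw [pd_mul_gauss hc]
    refine ⟨h.add (h00.add (h01.add h11)), ?_⟩
    rw [h.kernelInt_add (h00.add (h01.add h11)), h00.kernelInt_add (h01.add h11),
      h01.kernelInt_add h11]
    simp only [kernelInt_mul]
    exact funext fun z => pd_mul_thetaInt hc ha v z
  | add hK hL iK iL =>
    rw [hK.pd_add hL]
    refine ⟨iK.1.add iL.1, ?_⟩
    rw [hK.kernelInt_add hL, iK.1.kernelInt_add iL.1,
      pd_add v hK.isSmooth_kernelInt hL.isSmooth_kernelInt, iK.2, iL.2]

protected theorem IsKernel.lap (hK : IsKernel K) (k : ℤ) :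
    IsKernel (fun z p => lap k (fun z => K z p) z) ∧
      lap k (kernelInt K) = kernelInt fun z p => lap k (fun z => K z p) z := by
  obtain ⟨hx, ex⟩ := hK.pd 1
  obtain ⟨hy, ey⟩ := hK.pd I
  obtain ⟨hxx, exx⟩ := hx.pd 1
  obtain ⟨hyy, eyy⟩ := hy.pd I
  have hIy := hy.mul (IsSmooth.const I)
  have hsecond := (hxx.add hyy).mul (IsSmooth.im.mul IsSmooth.im)
  have hfirst := (hx.add hIy).mul ((IsSmooth.const (-(I * k))).mul IsSmooth.im)
  have hlap : (fun z p => lap k (fun z => K z p) z) = fun z p =>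
      ((fun z : ℍ => (z.im : ℂ)) * fun z : ℍ => (z.im : ℂ)) z *
        (pd 1 (pd 1 fun z => K z p) z + pd I (pd I fun z => K z p) z) +
      ((fun _ : ℍ => -(I * k)) * fun z : ℍ => (z.im : ℂ)) z *
        (pd 1 (fun z => K z p) z + I * pd I (fun z => K z p) z) := by
    ext z p
    simp only [lap, pdx, pdy, Pi.mul_apply]
    ring
  rw [hlap]
  refine ⟨hsecond.add hfirst, ?_⟩
  rw [hsecond.kernelInt_add hfirst, kernelInt_mul, kernelInt_mul, hxx.kernelInt_add hyy,
    hx.kernelInt_add hIy, kernelInt_mul, ← exx, ← eyy, ← ex, ← ey]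
  ext z
  simp only [lap, pdx, pdy, Pi.mul_apply, Pi.add_apply]
  ring

end Kernels

section LatticeSums

variable {F : (Fin 2 → ℤ) × ℝ → ℂ}

theorem integrableOn_of_integrable_latticeMeasure (hF : Integrable F latticeMeasure)
    (v : Fin 2 → ℤ) : IntegrableOn (fun t => F (v, t)) (Set.Ioi 1) :=
  Measure.ae_count_iff.mp hF.prod_right_ae v

theorem hasSum_integral_latticeMeasure (hF : Integrable F latticeMeasure) :
    HasSum (fun v => ∫ t in Set.Ioi (1 : ℝ), F (v, t)) (∫ p, F p ∂latticeMeasure) := by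
  have hint := hF.integral_prod_left
  have hsum : Summable fun v => ∫ t in Set.Ioi (1 : ℝ), F (v, t) :=
    (integrable_count_iff.mp hint).of_norm
  have htsum : ∫ p, F p ∂latticeMeasure = ∑' v, ∫ t in Set.Ioi (1 : ℝ), F (v, t) := by
    rw [latticeMeasure, integral_prod _ hF, integral_countable hint]
    simp
  rw [htsum]
  exact hsum.hasSum

end LatticeSums

section PolyBdd

variable {w u : ℝ → ℂ}

/-- Measurable functions of at most polynomial growth on `(1, ∞)`. -/
structure IsPolyBdd (w : ℝ → ℂ) : Prop where
  measurable : Measurable w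
  bound : ∃ (C : ℝ) (n : ℕ), 0 ≤ C ∧ ∀ t, 1 < t → ‖w t‖ ≤ C * t ^ n

theorem IsPolyBdd.mul (hw : IsPolyBdd w) (hu : IsPolyBdd u) : IsPolyBdd fun t => w t * u t := by
  obtain ⟨C, n, hC, hwn⟩ := hw.bound
  obtain ⟨D, m, hD, hum⟩ := hu.bound
  refine ⟨hw.measurable.mul hu.measurable, C * D, n + m, by positivity, fun t ht => ?_⟩
  have : 0 < t := one_pos.trans ht
  calc ‖w t * u t‖ = ‖w t‖ * ‖u t‖ := norm_mul _ _
    _ ≤ (C * t ^ n) * (D * t ^ m) :=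
      mul_le_mul (hwn t ht) (hum t ht) (norm_nonneg _) (by positivity)
    _ = C * D * t ^ (n + m) := by ring

theorem IsPolyBdd.add (hw : IsPolyBdd w) (hu : IsPolyBdd u) : IsPolyBdd fun t => w t + u t := by
  obtain ⟨C, n, hC, hwn⟩ := hw.bound
  obtain ⟨D, m, hD, hum⟩ := hu.bound
  refine ⟨hw.measurable.add hu.measurable, C + D, n + m, by positivity, fun t ht => ?_⟩
  calc ‖w t + u t‖ ≤ C * t ^ n + D * t ^ m :=
        (norm_add_le _ _).trans (add_le_add (hwn t ht) (hum t ht))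
    _ ≤ C * t ^ (n + m) + D * t ^ (n + m) := by
        gcongr <;> first | exact ht.le | omega
    _ = (C + D) * t ^ (n + m) := by ring

theorem IsPolyBdd.const (c : ℂ) : IsPolyBdd fun _ => c :=
  ⟨measurable_const, ‖c‖, 0, norm_nonneg _, fun t _ => by simp⟩

theorem IsPolyBdd.ofReal : IsPolyBdd fun t => (t : ℂ) :=
  ⟨Complex.measurable_ofReal, 1, 1, zero_le_one, fun t ht => by
    rw [Complex.norm_of_nonneg (by linarith), one_mul, pow_one]⟩

theorem IsPolyBdd.inv : IsPolyBdd fun t => (t : ℂ)⁻¹ :=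
  ⟨Complex.measurable_ofReal.inv, 1, 0, zero_le_one, fun t ht => by
    rw [norm_inv, Complex.norm_of_nonneg (by linarith), one_mul, pow_zero]
    exact inv_le_one_of_one_le₀ ht.le⟩

theorem IsPolyBdd.log : IsPolyBdd fun t => (Real.log t : ℂ) :=
  ⟨Complex.measurable_ofReal.comp Real.measurable_log, 1, 1, zero_le_one, fun t ht => by
    rw [Complex.norm_of_nonneg (Real.log_nonneg ht.le)]
    linarith [Real.log_le_sub_one_of_pos (by linarith : 0 < t)]⟩

theorem IsPolyBdd.pow (hw : IsPolyBdd w) (n : ℕ) : IsPolyBdd fun t => w t ^ n := by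
  induction n with
  | zero => simpa using IsPolyBdd.const 1
  | succ n ih => simp_rw [pow_succ]; exact ih.mul hw

theorem IsPolyBdd.tendsto_mul_exp (hw : IsPolyBdd w) {x : ℝ} (hx : 0 < x) :
    Tendsto (fun t => w t * (Real.exp (-(x * t)) : ℂ)) atTop (𝓝 0) := by
  obtain ⟨C, n, -, hwn⟩ := hw.bound
  have hlim := ((Real.tendsto_pow_mul_exp_neg_atTop_nhds_zero n).comp
    (tendsto_id.const_mul_atTop hx)).const_mul (C / x ^ n)
  rw [mul_zero] at hlim
  refine squeeze_zero_norm' ?_ hlim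
  filter_upwards [eventually_gt_atTop 1] with t ht
  rw [norm_mul, Complex.norm_of_nonneg (Real.exp_pos _).le]
  calc ‖w t‖ * Real.exp (-(x * t)) ≤ C * t ^ n * Real.exp (-(x * t)) :=
        mul_le_mul_of_nonneg_right (hwn t ht) (Real.exp_pos _).le
    _ = C / x ^ n * ((x * t) ^ n * Real.exp (-(x * t))) := by
        rw [mul_pow]
        field_simp

theorem IsPolyBdd.isWeight_mul (hw : IsPolyBdd w) {b : (Fin 2 → ℤ) → ℂ} (hb : ∀ v, ‖b v‖ ≤ ‖v‖) :
    IsWeight fun p => b p.1 * w p.2 := by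
  obtain ⟨C, n, hC, hwn⟩ := hw.bound
  have hm : Measurable fun p : (Fin 2 → ℤ) × ℝ => b p.1 * w p.2 :=
    ((measurable_of_countable b).comp measurable_fst).mul (hw.measurable.comp measurable_snd)
  refine ⟨hm, fun t => ?_, C, n + 1, hC, fun v t ht => ?_⟩
  · rw [norm_le_zero_iff.mp ((hb 0).trans_eq norm_zero), zero_mul]
  obtain rfl | hv := eq_or_ne v 0
  · simp [norm_le_zero_iff.mp ((hb 0).trans_eq norm_zero)]
  have hv1 := one_le_norm_of_ne_zero hv
  have : 0 < t := one_pos.trans ht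
  calc ‖b v * w t‖ = ‖b v‖ * ‖w t‖ := norm_mul _ _
    _ ≤ ‖v‖ * (C * t ^ n) := mul_le_mul (hb v) (hwn t ht) (norm_nonneg _) (norm_nonneg _)
    _ = C * (‖v‖ * t ^ n) := by ring
    _ ≤ C * (‖v‖ ^ (n + 1) * t ^ (n + 1)) := by
        gcongr
        exacts [le_self_pow₀ hv1 n.succ_ne_zero, ht.le, n.le_succ]
    _ = C * (‖v‖ * t) ^ (n + 1) := by rw [mul_pow]

theorem IsPolyBdd.isWeight (hw : IsPolyBdd w) (i j : Fin 2) :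
    IsWeight fun p => (p.1 i : ℂ) * ((p.1 j : ℂ) * w p.2) :=
  (hw.isWeight_mul (b := fun v => (v j : ℂ)) fun v => by
    simpa only [Complex.norm_intCast] using abs_coord_le_norm v j).coord_mul i

end PolyBdd

section IntegrationByParts

variable {u u' u'' w w' w'' : ℝ → ℂ} {a : ℝ}

theorem integral_Ioi_mul_deriv_deriv (hu : ∀ t, a ≤ t → HasDerivAt u (u' t) t)
    (hu' : ∀ t, a ≤ t → HasDerivAt u' (u'' t) t) (hw : ∀ t, a ≤ t → HasDerivAt w (w' t) t)
    (hw' : ∀ t, a ≤ t → HasDerivAt w' (w'' t) t)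
    (hint : IntegrableOn (fun t => u'' t * w t) (Set.Ioi a))
    (hint' : IntegrableOn (fun t => u t * w'' t) (Set.Ioi a))
    (hlim : Tendsto (fun t => u' t * w t - u t * w' t) atTop (𝓝 0)) :
    ∫ t in Set.Ioi a, u'' t * w t =
      (∫ t in Set.Ioi a, u t * w'' t) + (u a * w' a - u' a * w a) := by
  have hderiv : ∀ t, a ≤ t →
      HasDerivAt (fun t => u' t * w t - u t * w' t) (u'' t * w t - u t * w'' t) t := fun t ht =>
    (((hu' t ht).mul (hw t ht)).sub ((hu t ht).mul (hw' t ht))).congr_deriv (by ring)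
  have hFTC := integral_Ioi_of_hasDerivAt_of_tendsto
    (hderiv a le_rfl).continuousAt.continuousWithinAt (fun t ht => hderiv t (le_of_lt ht))
    (hint.sub hint') hlim
  rw [integral_sub hint hint'] at hFTC
  linear_combination hFTC

theorem hasDerivAt_mul_exp_neg {x t : ℝ} {f' : ℂ} (hw : HasDerivAt w f' t) :
    HasDerivAt (fun t => w t * (Real.exp (-(x * t)) : ℂ))
      ((f' - x * w t) * (Real.exp (-(x * t)) : ℂ)) t := by
  have hexp : HasDerivAt (fun t : ℝ => (Real.exp (-(x * t)) : ℂ))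
      ((Real.exp (-(x * t)) * (-(x * 1)) : ℝ) : ℂ) t :=
    ((hasDerivAt_id t).const_mul x).neg.exp.ofReal_comp
  refine (hw.mul hexp).congr_deriv ?_
  push_cast
  ring

theorem integral_sq_mul_exp_by_parts (hwb : IsPolyBdd w) (hwb' : IsPolyBdd w')
    (hw : ∀ t, 0 < t → HasDerivAt w (w' t) t) (hw' : ∀ t, 0 < t → HasDerivAt w' (w'' t) t)
    {x : ℝ} (hx : 0 < x)
    (hint : IntegrableOn (fun t => (x ^ 2 * t ^ 2 - 4 * x * t + 2) * (Real.exp (-(x * t)) : ℂ)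
      * w t) (Set.Ioi 1))
    (hint' : IntegrableOn (fun t => t ^ 2 * (Real.exp (-(x * t)) : ℂ) * w'' t) (Set.Ioi 1)) :
    ∫ t in Set.Ioi (1 : ℝ), (x ^ 2 * t ^ 2 - 4 * x * t + 2) * (Real.exp (-(x * t)) : ℂ) * w t =
      (∫ t in Set.Ioi (1 : ℝ), t ^ 2 * (Real.exp (-(x * t)) : ℂ) * w'' t) +
        (w' 1 - (2 - x) * w 1) * (Real.exp (-x) : ℂ) := by
  have hid : ∀ t : ℝ, HasDerivAt (fun t : ℝ => (t : ℂ)) 1 t := fun t =>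
    Complex.ofRealCLM.hasDerivAt
  have hu : ∀ t : ℝ, HasDerivAt (fun t : ℝ => (t : ℂ) ^ 2 * (Real.exp (-(x * t)) : ℂ))
      ((2 * t - x * t ^ 2) * (Real.exp (-(x * t)) : ℂ)) t := fun t =>
    (hasDerivAt_mul_exp_neg ((hid t).pow 2)).congr_deriv (by simp)
  have hu' : ∀ t : ℝ,
      HasDerivAt (fun t : ℝ => (2 * (t : ℂ) - x * (t : ℂ) ^ 2) * (Real.exp (-(x * t)) : ℂ))
      ((x ^ 2 * t ^ 2 - 4 * x * t + 2) * (Real.exp (-(x * t)) : ℂ)) t := fun t =>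
    (hasDerivAt_mul_exp_neg (((hid t).const_mul 2).sub
      (((hid t).pow 2).const_mul (x : ℂ)))).congr_deriv (by simp; ring)
  have hpoly : IsPolyBdd fun t : ℝ =>
      (2 * (t : ℂ) + -x * (t : ℂ) ^ 2) * w t + -1 * ((t : ℂ) ^ 2 * w' t) :=
    ((((IsPolyBdd.const 2).mul .ofReal).add ((IsPolyBdd.const _).mul (.pow .ofReal 2))).mul
      hwb).add ((IsPolyBdd.const _).mul ((IsPolyBdd.ofReal.pow 2).mul hwb'))
  have hlim : Tendsto (fun t : ℝ => (2 * (t : ℂ) - x * (t : ℂ) ^ 2) * (Real.exp (-(x * t)) : ℂ) *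
      w t - (t : ℂ) ^ 2 * (Real.exp (-(x * t)) : ℂ) * w' t) atTop (𝓝 0) :=
    (hpoly.tendsto_mul_exp hx).congr fun t => by ring
  rw [integral_Ioi_mul_deriv_deriv (fun t _ => hu t) (fun t _ => hu' t)
    (fun t ht => hw t (one_pos.trans_le ht)) (fun t ht => hw' t (one_pos.trans_le ht))
    hint hint' hlim]
  simp only [Complex.ofReal_one, mul_one]
  ring

end IntegrationByParts

/-! ### The weight two kernel -/

section EisKernel

variable {w : ℝ → ℂ}

/-- The linear form `c z + d` attached to `v = (c, d)`. -/
def linForm (v : Fin 2 → ℤ) (z : ℍ) : ℂ := v 0 * z + v 1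

/-- The function `(c z̄ + d) / y` attached to `v = (c, d)`. It is chosen so that
`linForm v * antiForm v` is the quadratic form `|c z + d|² / y`. -/
def antiForm (v : Fin 2 → ℤ) (z : ℍ) : ℂ := conj (linForm v z) / z.im

theorem conj_linForm (v : Fin 2 → ℤ) (z : ℍ) : conj (linForm v z) = v 0 * conj (z : ℂ) + v 1 := by
  simp [linForm]

theorem linForm_mul_antiForm (v : Fin 2 → ℤ) (z : ℍ) :
    linForm v z * antiForm v z = quadForm (formMap z) v := by
  rw [quadForm_formMap, antiForm, ← mul_div_assoc, Complex.mul_conj, linForm]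
  push_cast
  rfl

theorem gauss_formMap (z : ℍ) (v : Fin 2 → ℤ) (t : ℝ) :
    gauss (formMap z) (v, t) = Complex.exp (-(π * t) * (linForm v z * antiForm v z)) := by
  rw [gauss, linForm_mul_antiForm]
  push_cast
  ring_nf

theorem linForm_sub_im_mul_antiForm (v : Fin 2 → ℤ) (z : ℍ) :
    linForm v z - z.im * antiForm v z = 2 * I * v 0 * z.im := by
  have hzy : (z : ℂ) - conj (z : ℂ) = 2 * I * z.im := by
    rw [Complex.sub_conj, coe_im]
    push_cast
    ring
  rw [antiForm, mul_div_cancel₀ _ (im_ofReal_ne_zero z), conj_linForm, linForm]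
  linear_combination (v 0 : ℂ) * hzy

theorem hasWirtingerAt_linForm (v : Fin 2 → ℤ) (z : ℍ) :
    HasWirtingerAt (linForm v) (v 0) 0 z := by
  convert! ((hasWirtingerAt_const (v 0 : ℂ) z).mul (hasWirtingerAt_coe z)).add
    (hasWirtingerAt_const (v 1 : ℂ) z) using 1 <;> simp

theorem hasWirtingerAt_antiForm (v : Fin 2 → ℤ) (z : ℍ) :
    HasWirtingerAt (antiForm v) (I / 2 * (antiForm v z / z.im))
      (-(I / 2) * (linForm v z / z.im ^ 2)) z := by
  have hy := im_ofReal_ne_zero z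
  have hdiff := linForm_sub_im_mul_antiForm v z
  convert! (hasWirtingerAt_linForm v z).conj.mul
    ((hasWirtingerAt_im z).comp (hasDerivAt_inv hy)) using 1
  · simp only [antiForm, Function.comp_apply, map_zero]
    field_simp
    ring
  · simp only [antiForm, Function.comp_apply, map_intCast] at hdiff ⊢
    field_simp at hdiff ⊢
    linear_combination -I * hdiff - 2 * v 0 * z.im * Complex.I_sq

theorem hasWirtingerAt_linForm_mul_antiForm (v : Fin 2 → ℤ) (z : ℍ) :
    HasWirtingerAt (linForm v * antiForm v) (I / 2 * antiForm v z ^ 2)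
      (-(I / 2) * (linForm v z / z.im) ^ 2) z := by
  have hy := im_ofReal_ne_zero z
  convert! (hasWirtingerAt_linForm v z).mul (hasWirtingerAt_antiForm v z) using 1
  · field_simp
    linear_combination (-I * antiForm v z) * linForm_sub_im_mul_antiForm v z -
      (2 * antiForm v z * v 0 * z.im) * Complex.I_sq
  · field_simp
    ring

theorem lower_antiForm_sq_mul_comp (v : Fin 2 → ℤ) {φ φ' : ℂ → ℂ}
    (hφ : ∀ q, HasDerivAt φ (φ' q) q) :
    lower ((antiForm v * antiForm v) * (φ ∘ (linForm v * antiForm v))) =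
      (fun q => -(I / 2) * (2 * q * φ q + q ^ 2 * φ' q)) ∘ (linForm v * antiForm v) := by
  ext z
  have hR := hasWirtingerAt_antiForm v z
  have hQ := (hasWirtingerAt_linForm_mul_antiForm v z).comp (hφ _)
  rw [lower, ((hR.mul hR).mul hQ).dzbar_eq]
  have hy := im_ofReal_ne_zero z
  simp only [Function.comp_apply, Pi.mul_apply]
  field_simp
  ring

theorem lap_antiForm_sq_mul_comp (v : Fin 2 → ℤ) {φ φ' φ'' : ℂ → ℂ}
    (hφ : ∀ q, HasDerivAt φ (φ' q) q) (hφ' : ∀ q, HasDerivAt φ' (φ'' q) q)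
    (hs : IsSmooth ((antiForm v * antiForm v) * (φ ∘ (linForm v * antiForm v)))) (z : ℍ) :
    lap 2 ((antiForm v * antiForm v) * (φ ∘ (linForm v * antiForm v))) z =
      antiForm v z ^ 2 * ((fun q => 2 * φ q + 4 * q * φ' q + q ^ 2 * φ'' q)
        (linForm v z * antiForm v z)) := by
  have hψ : ∀ q, HasDerivAt (fun q => -(I / 2) * (2 * q * φ q + q ^ 2 * φ' q))
      (-(I / 2) * (2 * φ q + 4 * q * φ' q + q ^ 2 * φ'' q)) q := fun q => by
    refine (((((hasDerivAt_id q).const_mul 2).mul (hφ q)).add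
      (((hasDerivAt_id q).pow 2).mul (hφ' q))).const_mul (-(I / 2))).congr_deriv ?_
    simp only [id, Pi.pow_apply]
    push_cast
    ring
  rw [lap_eq_raise_lower hs, Pi.smul_apply, raise, lower_antiForm_sq_mul_comp v hφ,
    ((hasWirtingerAt_linForm_mul_antiForm v z).comp (hψ _)).dz_eq]
  simp only [Pi.mul_apply, smul_eq_mul, sub_self, Int.cast_zero, zero_div, zero_mul, add_zero]
  generalize linForm v z * antiForm v z = q
  linear_combination (-(2 * φ q + 4 * q * φ' q + q ^ 2 * φ'' q) * antiForm v z ^ 2) * Complex.I_sq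

/-- The kernel `((c z̄ + d) / y)² w(t) e^{-π t |c z + d|² / y}`. -/
def eisKernel (w : ℝ → ℂ) (z : ℍ) (p : (Fin 2 → ℤ) × ℝ) : ℂ :=
  antiForm p.1 z ^ 2 * (w p.2 * gauss (formMap z) p)

theorem eisKernel_eq_add (w : ℝ → ℂ) (z : ℍ) (p : (Fin 2 → ℤ) × ℝ) :
    eisKernel w z p =
      (conj (z : ℂ) / z.im) ^ 2 *
        ((p.1 0 : ℂ) * ((p.1 0 : ℂ) * w p.2) * gauss (formMap z) p) +
      (2 * (conj (z : ℂ) / z.im ^ 2) *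
        ((p.1 0 : ℂ) * ((p.1 1 : ℂ) * w p.2) * gauss (formMap z) p) +
      (1 / z.im) ^ 2 * ((p.1 1 : ℂ) * ((p.1 1 : ℂ) * w p.2) * gauss (formMap z) p)) := by
  rw [eisKernel, antiForm, conj_linForm]
  ring

theorem isKernel_eisKernel (hw : IsPolyBdd w) : IsKernel (eisKernel w) := by
  have hy : IsSmooth (fun z : ℍ => (z.im : ℂ))⁻¹ := IsSmooth.im.inv im_ofReal_ne_zero
  have hzbar : IsSmooth fun z : ℍ => conj (z : ℂ) := IsSmooth.coe.conj
  convert! (IsKernel.base ((hzbar.mul hzbar).mul (hy.mul hy)) (hw.isWeight 0 0)).add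
    ((IsKernel.base ((IsSmooth.const 2).mul (hzbar.mul (hy.mul hy))) (hw.isWeight 0 1)).add
      (IsKernel.base (hy.mul hy) (hw.isWeight 1 1))) using 3 with z p
  rw [eisKernel_eq_add]
  simp only [Pi.mul_apply, Pi.inv_apply]
  ring

theorem lap_eisKernel (hw : IsPolyBdd w) (z : ℍ) (v : Fin 2 → ℤ) (t : ℝ) :
    lap 2 (fun z => eisKernel w z (v, t)) z =
      antiForm v z ^ 2 * (((π * quadForm (formMap z) v) ^ 2 * t ^ 2
        - 4 * (π * quadForm (formMap z) v) * t + 2) * (w t * gauss (formMap z) (v, t))) := by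
  have hexp : ∀ α q : ℂ, HasDerivAt (fun q => α * Complex.exp (-(π * t) * q))
      (α * -(π * t) * Complex.exp (-(π * t) * q)) q := fun α q => by
    refine (((hasDerivAt_id q).const_mul (-(π * t : ℂ))).cexp.const_mul α).congr_deriv ?_
    simp only [id]
    ring
  have hker : (fun z => eisKernel w z (v, t)) = (antiForm v * antiForm v) *
      ((fun q => w t * Complex.exp (-(π * t) * q)) ∘ (linForm v * antiForm v)) := by
    ext z
    simp only [eisKernel, Pi.mul_apply, Function.comp_apply, gauss_formMap]
    ring
  have hs := (isKernel_eisKernel hw).isSmooth (v, t)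
  rw [hker] at hs ⊢
  rw [lap_antiForm_sq_mul_comp v (hexp (w t)) (hexp _) hs, gauss_formMap, ← linForm_mul_antiForm]
  ring

end EisKernel

/-! ### Eisenstein integrals -/

section EisInt

variable {w u w' w'' : ℝ → ℂ}

/-- The Eisenstein integral `∑_{(c,d)} ∫₁^∞ ((c z̄ + d)/y)² w(t) e^{-π t |c z + d|² / y} dt`. -/
def eisInt (w : ℝ → ℂ) : ℍ → ℂ := kernelInt (eisKernel w)

theorem hasSum_eisInt (hw : IsPolyBdd w) (z : ℍ) :
    HasSum (fun v => ∫ t in Set.Ioi (1 : ℝ), eisKernel w z (v, t)) (eisInt w z) :=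
  hasSum_integral_latticeMeasure ((isKernel_eisKernel hw).integrable z)

theorem isSmooth_eisInt (hw : IsPolyBdd w) : IsSmooth (eisInt w) :=
  (isKernel_eisKernel hw).isSmooth_kernelInt

theorem eisInt_add (hw : IsPolyBdd w) (hu : IsPolyBdd u) :
    eisInt (fun t => w t + u t) = eisInt w + eisInt u := by
  rw [eisInt, eisInt, eisInt, ← (isKernel_eisKernel hw).kernelInt_add (isKernel_eisKernel hu)]
  congr 1
  ext z p
  simp only [eisKernel]
  ring

theorem eisInt_const_mul (c : ℂ) (w : ℝ → ℂ) : eisInt (fun t => c * w t) = c • eisInt w := by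
  ext z
  rw [Pi.smul_apply, smul_eq_mul, eisInt, eisInt, kernelInt, kernelInt, ← integral_const_mul]
  simp only [eisKernel, mul_left_comm c, mul_assoc]

theorem eisInt_congr (h : ∀ t, 1 < t → w t = u t) : eisInt w = eisInt u := by
  ext z
  refine integral_congr_ae ?_
  filter_upwards [ae_latticeMeasure_one_lt] with p hp
  simp only [eisKernel, h p.2 hp]

theorem quadForm_formMap_pos (z : ℍ) {v : Fin 2 → ℤ} (hv : v ≠ 0) :
    0 < quadForm (formMap z) v := by
  refine lt_of_lt_of_le ?_ (r_sq_mul_le_quadForm z v)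
  have := one_le_norm_of_ne_zero hv
  have := EisensteinSeries.r_pos z
  have := z.im_pos
  positivity

theorem antiForm_zero (z : ℍ) : antiForm 0 z = 0 := by simp [antiForm, linForm]

theorem antiForm_ne_zero (z : ℍ) {v : Fin 2 → ℤ} (hv : v ≠ 0) : antiForm v z ≠ 0 := by
  refine right_ne_zero_of_mul (a := linForm v z) ?_
  rw [linForm_mul_antiForm]
  exact_mod_cast (quadForm_formMap_pos z hv).ne'

theorem integral_lap_eisKernel (hw : IsPolyBdd w) (hw' : IsPolyBdd w')
    (hw'' : IsPolyBdd fun t => (t : ℂ) ^ 2 * w'' t)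
    (h : ∀ t, 0 < t → HasDerivAt w (w' t) t) (h' : ∀ t, 0 < t → HasDerivAt w' (w'' t) t)
    (z : ℍ) (v : Fin 2 → ℤ) :
    ∫ t in Set.Ioi (1 : ℝ), lap 2 (fun z => eisKernel w z (v, t)) z =
      (∫ t in Set.Ioi (1 : ℝ), eisKernel (fun t => (t : ℂ) ^ 2 * w'' t) z (v, t)) +
        antiForm v z ^ 2 * ((w' 1 - (2 - π * quadForm (formMap z) v) * w 1) *
          gauss (formMap z) (v, 1)) := by
  obtain rfl | hv := eq_or_ne v 0
  · simp only [lap_eisKernel hw, antiForm_zero]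
    simp [eisKernel, antiForm_zero]
  have hR := pow_ne_zero 2 (antiForm_ne_zero z hv)
  have hx : 0 < π * quadForm (formMap z) v := mul_pos Real.pi_pos (quadForm_formMap_pos z hv)
  set x := π * quadForm (formMap z) v with hxdef
  have hgauss : ∀ t : ℝ, gauss (formMap z) (v, t) = (Real.exp (-(x * t)) : ℂ) := fun t => by
    rw [gauss, hxdef]
    ring_nf
  have hlap : (fun t => lap 2 (fun z => eisKernel w z (v, t)) z) = fun t : ℝ =>
      antiForm v z ^ 2 *
        ((x ^ 2 * t ^ 2 - 4 * x * t + 2) * (Real.exp (-(x * t)) : ℂ) * w t) := by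
    ext t
    rw [lap_eisKernel hw, hgauss, hxdef]
    push_cast
    ring
  have hker : (fun t => eisKernel (fun t => (t : ℂ) ^ 2 * w'' t) z (v, t)) = fun t : ℝ =>
      antiForm v z ^ 2 * (t ^ 2 * (Real.exp (-(x * t)) : ℂ) * w'' t) := by
    ext t
    rw [eisKernel, hgauss]
    ring
  have hint := integrableOn_of_integrable_latticeMeasure
    (((isKernel_eisKernel hw).lap 2).1.integrable z) v
  have hint' := integrableOn_of_integrable_latticeMeasure
    ((isKernel_eisKernel hw'').integrable z) v
  rw [hlap] at hint ⊢
  rw [hker] at hint' ⊢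
  rw [IntegrableOn, integrable_const_mul_iff hR.isUnit] at hint hint'
  rw [integral_const_mul, integral_const_mul,
    integral_sq_mul_exp_by_parts hw hw' h h' hx hint hint', hgauss, mul_one, hxdef]
  push_cast
  ring

theorem hasSum_lap_eisInt_sub (hw : IsPolyBdd w) (hw' : IsPolyBdd w')
    (hw'' : IsPolyBdd fun t => (t : ℂ) ^ 2 * w'' t)
    (h : ∀ t, 0 < t → HasDerivAt w (w' t) t) (h' : ∀ t, 0 < t → HasDerivAt w' (w'' t) t)
    (z : ℍ) :
    HasSum (fun v => antiForm v z ^ 2 * ((w' 1 - (2 - π * quadForm (formMap z) v) * w 1) *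
      gauss (formMap z) (v, 1)))
      (lap 2 (eisInt w) z - eisInt (fun t => (t : ℂ) ^ 2 * w'' t) z) := by
  have hlap := (isKernel_eisKernel hw).lap 2
  have hsum := hasSum_integral_latticeMeasure (hlap.1.integrable z)
  rw [eisInt, hlap.2]
  refine (hsum.sub (hasSum_eisInt hw'' z)).congr_fun fun v => ?_
  rw [integral_lap_eisKernel hw hw' hw'' h h', add_sub_cancel_left]

end EisInt

section Modularity

open Matrix

variable {w : ℝ → ℂ}

theorem linForm_smul (v : Fin 2 → ℤ) (γ : SL(2, ℤ)) (z : ℍ) :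
    linForm v (γ • z) = linForm (v ᵥ* γ) z / denom γ z := by
  have hd : denom γ z ≠ 0 := denom_ne_zero _ _
  have hcoe : ((γ • z : ℍ) : ℂ) = (γ 0 0 * z + γ 0 1) / denom γ z := by
    rw [ModularGroup.denom_apply, specialLinearGroup_apply]
    simp
  rw [linForm, hcoe, eq_div_iff hd, add_mul, mul_assoc, div_mul_cancel₀ _ hd,
    ModularGroup.denom_apply]
  simp only [linForm, vecMul, dotProduct, Fin.sum_univ_two]
  push_cast
  ring

theorem antiForm_smul (v : Fin 2 → ℤ) (γ : SL(2, ℤ)) (z : ℍ) :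
    antiForm v (γ • z) = denom γ z * antiForm (v ᵥ* γ) z := by
  have hd : denom γ z ≠ 0 := denom_ne_zero _ _
  have hd' : conj (denom γ z) ≠ 0 := by simp [hd]
  have hy := im_ofReal_ne_zero z
  rw [antiForm, antiForm, linForm_smul, im_smul_eq_div_denom, map_div₀]
  field_simp

theorem eisKernel_smul (w : ℝ → ℂ) (γ : SL(2, ℤ)) (z : ℍ) (v : Fin 2 → ℤ) (t : ℝ) :
    eisKernel w (γ • z) (v, t) = denom γ z ^ 2 * eisKernel w z (v ᵥ* γ, t) := by
  have hd : denom γ z ≠ 0 := denom_ne_zero _ _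
  have hquad : linForm v (γ • z) * antiForm v (γ • z) =
      linForm (v ᵥ* γ) z * antiForm (v ᵥ* γ) z := by
    rw [linForm_smul, antiForm_smul]
    field_simp
  simp only [eisKernel, gauss_formMap]
  rw [hquad, antiForm_smul]
  ring

theorem isModular_eisInt (hw : IsPolyBdd w) : IsModular 2 (eisInt w) := by
  refine isModular_of_apply_smul fun γ z => ?_
  have hγ := hasSum_eisInt hw (γ • z)
  simp_rw [eisKernel_smul, integral_const_mul] at hγ
  have hz := ((γ.transpose.toLin'.toEquiv.hasSum_iff).mpr (hasSum_eisInt hw z)).mul_left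
    (denom γ z ^ 2)
  rw [zpow_ofNat]
  refine hγ.unique (hz.congr_fun fun v => ?_)
  simp only [Function.comp_apply, LinearEquiv.coe_toEquiv, SpecialLinearGroup.toLin'_apply,
    SpecialLinearGroup.coe_transpose, toLin'_apply, mulVec_transpose]

end Modularity

section ModerateGrowth

variable {w : ℝ → ℂ}

theorem IsModular.moderateGrowth_of_verticalStrip {k : ℤ} {f : ℍ → ℂ} (hf : IsModular k f)
    {C : ℝ} {N : ℕ} (h : ∀ z ∈ verticalStrip 1 1, ‖f z‖ ≤ C * z.im ^ N) : ModerateGrowth f := by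
  refine ⟨N, Asymptotics.IsBigO.of_bound C ?_⟩
  have him : ∀ᶠ z : ℍ in atImInfty, 1 ≤ z.im :=
    (tendsto_comap (f := UpperHalfPlane.im)).eventually (eventually_ge_atTop 1)
  filter_upwards [him] with z hz
  have htrans := hf.apply_smul (ModularGroup.T ^ (-⌊z.re⌋)) z
  have hden : denom (ModularGroup.T ^ (-⌊z.re⌋) : SL(2, ℤ)) z = 1 := by
    rw [ModularGroup.denom_apply, ModularGroup.coe_T_zpow]
    simp
  rw [hden, one_zpow, one_mul, modular_T_zpow_smul] at htrans
  rw [← htrans, Real.rpow_natCast, Real.norm_of_nonneg (pow_nonneg z.im_pos.le N)]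
  have hstrip : ((-⌊z.re⌋ : ℤ) : ℝ) +ᵥ z ∈ verticalStrip 1 1 := by
    refine ⟨?_, by simpa using hz⟩
    rw [vadd_re, abs_le]
    push_cast
    constructor <;> linarith [Int.floor_le z.re, Int.lt_floor_add_one z.re]
  simpa using h _ hstrip

theorem quadForm_formMap_nonneg (z : ℍ) (v : Fin 2 → ℤ) : 0 ≤ quadForm (formMap z) v := by
  obtain rfl | hv := eq_or_ne v 0
  · simp [quadForm]
  · exact (quadForm_formMap_pos z hv).le

theorem norm_antiForm_sq (v : Fin 2 → ℤ) (z : ℍ) :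
    ‖antiForm v z‖ ^ 2 = quadForm (formMap z) v / z.im := by
  have hnorm : ‖antiForm v z‖ = ‖linForm v z‖ / z.im := by
    rw [antiForm, norm_div, Complex.norm_conj, Complex.norm_of_nonneg z.im_pos.le]
  have hquad := congrArg norm (linForm_mul_antiForm v z)
  rw [norm_mul, Complex.norm_real, Real.norm_of_nonneg] at hquad
  · rw [← hquad, sq, hnorm]
    ring
  · exact quadForm_formMap_nonneg z v

theorem norm_eisKernel_le (w : ℝ → ℂ) {z : ℍ} (hz : 1 ≤ z.im) {κ : ℝ}
    (hκ : ∀ v : Fin 2 → ℤ, κ * ‖v‖ ^ 2 ≤ quadForm (formMap z) v)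
    {p : (Fin 2 → ℤ) × ℝ} (hp : 1 < p.2) :
    ‖eisKernel w z p‖ ≤
      ‖(‖p.1‖ : ℂ) * w p.2‖ * Real.exp (-(π * p.2 * (κ / 2 * ‖p.1‖ ^ 2))) := by
  obtain ⟨v, t⟩ := p
  obtain rfl | hv := eq_or_ne v 0
  · simp [eisKernel, antiForm_zero]
  set Q := quadForm (formMap z) v
  have hQ : 0 < Q := quadForm_formMap_pos z hv
  have ht : 1 < π * t / 2 := by nlinarith [Real.pi_gt_three, show 1 < t from hp]
  have hdecay : Q * Real.exp (-(π * t / 2 * Q)) ≤ 1 := by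
    refine le_trans (by simpa using pow_mul_exp_neg_le (one_pos.trans ht) hQ.le 1) ?_
    simpa using inv_le_one_of_one_le₀ ht.le
  have hexp : Real.exp (-(π * t / 2 * Q)) ≤ Real.exp (-(π * t * (κ / 2 * ‖v‖ ^ 2))) := by
    rw [Real.exp_le_exp]
    nlinarith [hκ v]
  calc ‖eisKernel w z (v, t)‖
      = Q / z.im * (‖w t‖ * Real.exp (-(π * t * Q))) := by
        rw [eisKernel, norm_mul, norm_pow, norm_antiForm_sq, norm_mul, gauss,
          Complex.norm_of_nonneg (Real.exp_pos _).le]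
    _ ≤ Q * (‖w t‖ * Real.exp (-(π * t * Q))) := by
        gcongr
        exact div_le_self hQ.le hz
    _ = ‖w t‖ * (Q * Real.exp (-(π * t / 2 * Q)) * Real.exp (-(π * t / 2 * Q))) := by
        rw [mul_assoc Q, ← Real.exp_add]
        ring_nf
    _ ≤ ‖w t‖ * (1 * Real.exp (-(π * t * (κ / 2 * ‖v‖ ^ 2)))) := by gcongr
    _ ≤ ‖(‖v‖ : ℂ) * w t‖ * Real.exp (-(π * t * (κ / 2 * ‖v‖ ^ 2))) := by
        rw [one_mul, norm_mul, Complex.norm_of_nonneg (norm_nonneg v)]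
        gcongr
        exact le_mul_of_one_le_left (norm_nonneg _) (one_le_norm_of_ne_zero hv)

theorem exists_norm_eisInt_le (hw : IsPolyBdd w) :
    ∃ (C : ℝ) (N : ℕ), ∀ z ∈ verticalStrip 1 1, ‖eisInt w z‖ ≤ C * z.im ^ N := by
  obtain ⟨B, N, hB⟩ := (hw.isWeight_mul (b := fun v => (‖v‖ : ℂ)) fun v => by
    simp).exists_norm_mul_exp_le
  set r₀ := EisensteinSeries.r ⟨⟨1, 1⟩, one_pos⟩
  have hr₀ : 0 < r₀ := EisensteinSeries.r_pos _
  refine ⟨B / (r₀ ^ 2 / 2) ^ N * ∫ p, latticeDecay p ∂latticeMeasure, N, fun z hz => ?_⟩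
  have := z.im_pos
  have hκ : ∀ v : Fin 2 → ℤ, r₀ ^ 2 / z.im * ‖v‖ ^ 2 ≤ quadForm (formMap z) v := fun v => by
    refine le_trans ?_ (r_sq_mul_le_quadForm z v)
    gcongr
    exact EisensteinSeries.r_lower_bound_on_verticalStrip z one_pos hz
  refine (norm_integral_le_of_norm_le
    (integrable_latticeDecay.const_mul (B / (r₀ ^ 2 / z.im / 2) ^ N)) ?_).trans_eq ?_
  · filter_upwards [ae_latticeMeasure_one_lt] with p hp
    exact (norm_eisKernel_le w hz.2 hκ hp).trans (hB _ (by positivity) p hp)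
  · rw [integral_const_mul, div_right_comm, div_pow _ z.im]
    field_simp

theorem isModerateForm_eisInt (hw : IsPolyBdd w) : IsModerateForm 2 (eisInt w) := by
  obtain ⟨C, N, h⟩ := exists_norm_eisInt_le hw
  exact ⟨isSmooth_eisInt hw, isModular_eisInt hw,
    (isModular_eisInt hw).moderateGrowth_of_verticalStrip h⟩

end ModerateGrowth

/-! ### Logarithmic weights -/

/-- The weight function `(t + (-1)ⁿ) (log t)ⁿ`. -/
def logWeight (n : ℕ) (t : ℝ) : ℂ := (t + (-1) ^ n) * (Real.log t : ℂ) ^ n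

theorem isPolyBdd_logWeight (n : ℕ) : IsPolyBdd (logWeight n) :=
  (IsPolyBdd.ofReal.add (.const _)).mul (IsPolyBdd.log.pow n)

/-- The derivative of `logWeight n`. -/
def logWeightDeriv (n : ℕ) (t : ℝ) : ℂ :=
  (Real.log t : ℂ) ^ n + n * ((1 + (-1) ^ n * (t : ℂ)⁻¹) * (Real.log t : ℂ) ^ (n - 1))

theorem isPolyBdd_logWeightDeriv (n : ℕ) : IsPolyBdd (logWeightDeriv n) :=
  (IsPolyBdd.log.pow n).add ((IsPolyBdd.const n).mul
    (((IsPolyBdd.const 1).add ((IsPolyBdd.const _).mul .inv)).mul (IsPolyBdd.log.pow (n - 1))))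

theorem hasDerivAt_ofReal_log {t : ℝ} (ht : 0 < t) :
    HasDerivAt (fun t : ℝ => (Real.log t : ℂ)) (t : ℂ)⁻¹ t := by
  simpa only [Complex.ofReal_inv] using (Real.hasDerivAt_log ht.ne').ofReal_comp

theorem hasDerivAt_logWeight (n : ℕ) {t : ℝ} (ht : 0 < t) :
    HasDerivAt (logWeight n) (logWeightDeriv n t) t := by
  have hid : HasDerivAt (fun t : ℝ => (t : ℂ)) 1 t := Complex.ofRealCLM.hasDerivAt
  have ht' : (t : ℂ) ≠ 0 := by exact_mod_cast ht.ne'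
  refine ((hid.add_const ((-1 : ℂ) ^ n)).mul ((hasDerivAt_ofReal_log ht).pow n)).congr_deriv ?_
  simp only [logWeightDeriv, Pi.pow_apply]
  field_simp

theorem hasDerivAt_logWeightDeriv (n : ℕ) {t : ℝ} (ht : 0 < t) :
    HasDerivAt (logWeightDeriv n) ((t : ℂ)⁻¹ ^ 2 *
      (n * logWeight (n - 1) t + n * (n - 1) * logWeight (n - 2) t)) t := by
  have ht' : (t : ℂ) ≠ 0 := by exact_mod_cast ht.ne'
  have hid : HasDerivAt (fun t : ℝ => (t : ℂ)) 1 t := Complex.ofRealCLM.hasDerivAt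
  have hlog := hasDerivAt_ofReal_log ht
  refine ((hlog.pow n).add ((((hid.inv ht').const_mul ((-1 : ℂ) ^ n)).const_add 1
    |>.mul (hlog.pow (n - 1))).const_mul (n : ℂ))).congr_deriv ?_
  rcases n with _ | _ | n
  · simp
  · simp [logWeight]
    field_simp
  · simp only [logWeight, Pi.pow_apply, Pi.inv_apply, Nat.add_sub_cancel,
      show n + 1 + 1 - 2 = n by omega, show n + 1 + 1 - 1 = n + 1 by omega]
    push_cast
    field_simp
    ring

/-! ### Fourier transforms of quadratic polynomials times Gaussians -/

section Fourier

variable {f g : ℝ → ℂ} {a b : ℝ}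

theorem fourier_add_apply (hf : Integrable f) (hg : Integrable g) (ξ : ℝ) :
    𝓕 (fun x => f x + g x) ξ = 𝓕 f ξ + 𝓕 g ξ := by
  simp only [Real.fourier_eq, smul_add]
  exact integral_add ((Real.fourierIntegral_convergent_iff ξ).mpr hf)
    ((Real.fourierIntegral_convergent_iff ξ).mpr hg)

theorem fourier_const_mul_apply (c : ℂ) (f : ℝ → ℂ) (ξ : ℝ) :
    𝓕 (fun x => c * f x) ξ = c * 𝓕 f ξ := by
  simp only [Real.fourier_eq, Circle.smul_def, smul_eq_mul, mul_left_comm _ c,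
    integral_const_mul]

theorem fourier_id_mul_apply (hf : Integrable f) (hf' : Integrable fun x : ℝ => (x : ℂ) * f x)
    {ξ : ℝ} {d : ℂ} (hd : HasDerivAt (𝓕 f) d ξ) :
    𝓕 (fun x : ℝ => (x : ℂ) * f x) ξ = I / (2 * π) * d := by
  have hpi : (π : ℂ) ≠ 0 := by exact_mod_cast Real.pi_ne_zero
  have hderiv := hd.unique (Real.hasDerivAt_fourier hf (by simpa using hf') ξ)
  simp only [smul_eq_mul, mul_assoc] at hderiv
  simp only [fourier_const_mul_apply] at hderiv
  rw [hderiv]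
  field_simp
  linear_combination 𝓕 (fun x : ℝ => (x : ℂ) * f x) ξ * Complex.I_sq

theorem integrable_pow_mul_gaussian (ha : 0 < a) (n : ℕ) :
    Integrable fun x : ℝ => (x : ℂ) ^ n * Complex.exp (-π * a * x ^ 2) := by
  have h := integrable_rpow_mul_exp_neg_mul_sq (mul_pos Real.pi_pos ha) (s := n)
    (by linarith [Nat.cast_nonneg (α := ℝ) n])
  refine (h.ofReal (𝕜 := ℂ)).congr (Eventually.of_forall fun x => ?_)
  simp

theorem fourier_gaussian (ha : 0 < a) :
    𝓕 (fun x : ℝ => Complex.exp (-π * a * x ^ 2)) =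
      fun ξ : ℝ => ((√a)⁻¹ : ℝ) * Complex.exp (-π / a * ξ ^ 2) := by
  have hsqrt : 1 / (a : ℂ) ^ (1 / 2 : ℂ) = ((√a)⁻¹ : ℝ) := by
    rw [Real.sqrt_eq_rpow, Complex.ofReal_inv, Complex.ofReal_cpow ha.le, one_div]
    norm_num
  simpa only [hsqrt] using fourier_gaussian_pi (b := (a : ℂ)) (by simpa using ha)

theorem hasDerivAt_gaussian (c : ℂ) (x : ℝ) :
    HasDerivAt (fun x : ℝ => Complex.exp (c * x ^ 2)) (2 * c * x * Complex.exp (c * x ^ 2)) x := by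
  have hid : HasDerivAt (fun x : ℝ => (x : ℂ)) 1 x := Complex.ofRealCLM.hasDerivAt
  refine ((hid.pow 2).const_mul c).cexp.congr_deriv ?_
  simp only [Pi.pow_apply]
  push_cast
  ring

theorem fourier_id_mul_gaussian (ha : 0 < a) :
    𝓕 (fun x : ℝ => (x : ℂ) * Complex.exp (-π * a * x ^ 2)) =
      fun ξ : ℝ => -I * (ξ / a) * (((√a)⁻¹ : ℝ) * Complex.exp (-π / a * ξ ^ 2)) := by
  have hpi : (π : ℂ) ≠ 0 := by exact_mod_cast Real.pi_ne_zero
  ext ξ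
  rw [fourier_id_mul_apply (by simpa using integrable_pow_mul_gaussian ha 0)
    (by simpa using integrable_pow_mul_gaussian ha 1)
    (by rw [fourier_gaussian ha]; exact (hasDerivAt_gaussian _ ξ).const_mul _)]
  field_simp

theorem fourier_sq_mul_gaussian (ha : 0 < a) (ξ : ℝ) :
    𝓕 (fun x : ℝ => (x : ℂ) * (x * Complex.exp (-π * a * x ^ 2))) ξ =
      (1 / (2 * π * a) - (ξ / a) ^ 2) *
        (((√a)⁻¹ : ℝ) * Complex.exp (-π / a * ξ ^ 2)) := by
  have hpi : (π : ℂ) ≠ 0 := by exact_mod_cast Real.pi_ne_zero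
  have ha' : (a : ℂ) ≠ 0 := by exact_mod_cast ha.ne'
  have hid : HasDerivAt (fun x : ℝ => (x : ℂ)) 1 ξ := Complex.ofRealCLM.hasDerivAt
  rw [fourier_id_mul_apply (by simpa using integrable_pow_mul_gaussian ha 1)
    (by simpa only [sq, mul_assoc] using integrable_pow_mul_gaussian ha 2)
    (by
      rw [fourier_id_mul_gaussian ha]
      exact ((hid.div_const _).const_mul _).mul ((hasDerivAt_gaussian _ ξ).const_mul _))]
  generalize ((√a)⁻¹ : ℝ) = κ
  field_simp
  linear_combination (2 * π * ξ ^ 2 - a) * κ * Complex.I_sq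

/-- The function `(x - i b)² e^{-π a x²}`, which the weight two theta series sums along the
rows of the lattice. -/
def quadGauss (a b x : ℝ) : ℂ := (x - I * b) ^ 2 * Complex.exp (-π * a * x ^ 2)

theorem fourier_quadGauss (ha : 0 < a) (b ξ : ℝ) :
    𝓕 (quadGauss a b) ξ = (1 / (2 * π * a) - (ξ / a + b) ^ 2) *
      (((√a)⁻¹ : ℝ) * Complex.exp (-π / a * ξ ^ 2)) := by
  have hint : ∀ n : ℕ, Integrable fun x : ℝ => (x : ℂ) ^ n * Complex.exp (-π * a * x ^ 2) :=
    integrable_pow_mul_gaussian ha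
  have hexpand : quadGauss a b = fun x : ℝ =>
      (x : ℂ) * (x * Complex.exp (-π * a * x ^ 2)) +
        ((-2 * I * b) * (x * Complex.exp (-π * a * x ^ 2)) +
          -(b : ℂ) ^ 2 * Complex.exp (-π * a * x ^ 2)) := by
    ext x
    rw [quadGauss]
    linear_combination (b ^ 2 * Complex.exp (-π * a * x ^ 2)) * Complex.I_sq
  have h₀ := (hint 0).const_mul (-(b : ℂ) ^ 2)
  have h₁ := (hint 1).const_mul (-2 * I * b)
  simp only [pow_zero, one_mul, pow_one] at h₀ h₁
  have h₀₁ : Integrable fun x : ℝ => (-2 * I * b) * (x * Complex.exp (-π * a * x ^ 2)) +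
      -(b : ℂ) ^ 2 * Complex.exp (-π * a * x ^ 2) := h₁.add h₀
  rw [hexpand, fourier_add_apply (by simpa only [sq, mul_assoc] using hint 2) h₀₁,
    fourier_add_apply h₁ h₀, fourier_const_mul_apply, fourier_const_mul_apply,
    fourier_sq_mul_gaussian ha, fourier_id_mul_gaussian ha, fourier_gaussian ha]
  linear_combination (2 * b * (ξ / a) * (((√a)⁻¹ : ℝ) * Complex.exp (-π / a * ξ ^ 2))) *
    Complex.I_sq

theorem quadGauss_isBigO (ha : 0 < a) (b : ℝ) :
    quadGauss a b =O[cocompact ℝ] fun x : ℝ => |x| ^ (-2 : ℝ) := by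
  have hlarge : ∀ᶠ x : ℝ in cocompact ℝ, 1 ≤ |x| :=
    (tendsto_norm_cocompact_atTop (E := ℝ)).eventually (eventually_ge_atTop 1)
  have hgauss := (cexp_neg_quadratic_isLittleO_abs_rpow_cocompact (a := (-π * a : ℂ))
    (by simpa using mul_pos Real.pi_pos ha) 0 (-4)).isBigO
  have hquad : (fun x : ℝ => ((x : ℂ) - I * b) ^ 2) =O[cocompact ℝ]
      fun x : ℝ => |x| ^ (2 : ℝ) := by
    refine Asymptotics.IsBigO.of_bound ((1 + |b|) ^ 2) ?_
    filter_upwards [hlarge] with x hx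
    rw [Real.rpow_two, norm_pow, norm_pow, norm_abs_eq_norm, Real.norm_eq_abs, ← mul_pow]
    gcongr
    refine (norm_sub_le _ _).trans ?_
    simp only [Complex.norm_real, norm_mul, Complex.norm_I, one_mul, Real.norm_eq_abs]
    nlinarith [abs_nonneg b]
  refine (hquad.mul hgauss).congr' (Eventually.of_forall fun x => by simp [quadGauss]) ?_
  filter_upwards [hlarge] with x hx
  rw [← Real.rpow_add (by linarith)]
  norm_num

end Fourier

/-! ### The weight two theta series -/

section Theta

variable {t : ℝ}

theorem summable_quadForm_pow_mul_exp (z : ℍ) {c : ℝ} (hc : 0 < c) (n : ℕ) :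
    Summable fun v : Fin 2 → ℤ =>
      quadForm (formMap z) v ^ n * Real.exp (-(c * quadForm (formMap z) v)) := by
  set κ := EisensteinSeries.r z ^ 2 / z.im
  have hκ : 0 < κ := div_pos (pow_pos (EisensteinSeries.r_pos z) 2) z.im_pos
  have hsum := (EisensteinSeries.summable_one_div_norm_rpow (k := 4) (by norm_num)).mul_left
    ((n + 2).factorial / c ^ (n + 2) / κ ^ 2)
  refine Summable.of_norm_bounded_eventually hsum ?_
  filter_upwards [(Set.finite_singleton (0 : Fin 2 → ℤ)).compl_mem_cofinite] with v hv
  have hv : 0 < ‖v‖ := norm_pos_iff.mpr hv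
  set Q := quadForm (formMap z) v
  have hQ : 0 ≤ Q := quadForm_formMap_nonneg z v
  have hpow : (κ * ‖v‖ ^ 2) ^ 2 ≤ Q ^ 2 :=
    pow_le_pow_left₀ (by positivity) (r_sq_mul_le_quadForm z v) 2
  have hnorm : (‖v‖ : ℝ) ^ (-4 : ℝ) = 1 / ‖v‖ ^ 4 := by
    rw [Real.rpow_neg hv.le, one_div]
    norm_cast
  rw [Real.norm_of_nonneg (by positivity), hnorm, div_mul_div_comm, mul_one,
    le_div_iff₀ (by positivity)]
  calc Q ^ n * Real.exp (-(c * Q)) * (κ ^ 2 * ‖v‖ ^ 4)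
      = (κ * ‖v‖ ^ 2) ^ 2 * (Q ^ n * Real.exp (-(c * Q))) := by ring
    _ ≤ Q ^ 2 * (Q ^ n * Real.exp (-(c * Q))) := by gcongr
    _ = Q ^ (n + 2) * Real.exp (-(c * Q)) := by ring
    _ ≤ _ := pow_mul_exp_neg_le hc hQ (n + 2)

/-- The terms `((c z̄ + d)/y)² e^{-π t |c z + d|² / y}` of the weight two theta series. -/
def thetaTerm (z : ℍ) (t : ℝ) (v : Fin 2 → ℤ) : ℂ :=
  antiForm v z ^ 2 * gauss (formMap z) (v, t)

/-- The weight two theta series `∑ ((c z̄ + d)/y)² e^{-π t |c z + d|² / y}`. -/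
def theta (z : ℍ) (t : ℝ) : ℂ := ∑' v, thetaTerm z t v

theorem norm_thetaTerm (z : ℍ) (t : ℝ) (v : Fin 2 → ℤ) :
    ‖thetaTerm z t v‖ =
      z.im⁻¹ * (quadForm (formMap z) v * Real.exp (-(π * t * quadForm (formMap z) v))) := by
  rw [thetaTerm, norm_mul, norm_pow, norm_antiForm_sq, gauss,
    Complex.norm_of_nonneg (Real.exp_pos _).le]
  ring

theorem summable_thetaTerm (z : ℍ) (ht : 0 < t) : Summable (thetaTerm z t) := by
  refine Summable.of_norm ?_
  simp only [norm_thetaTerm]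
  simpa using (summable_quadForm_pow_mul_exp z (mul_pos Real.pi_pos ht) 1).mul_left z.im⁻¹

theorem hasDerivAt_thetaTerm (z : ℍ) (v : Fin 2 → ℤ) (t : ℝ) :
    HasDerivAt (fun t => thetaTerm z t v)
      (-(π * quadForm (formMap z) v) * thetaTerm z t v) t := by
  have hgauss : HasDerivAt (fun t : ℝ => gauss (formMap z) (v, t))
      ((Real.exp (-(π * t * quadForm (formMap z) v)) *
        (-(π * 1 * quadForm (formMap z) v)) : ℝ) : ℂ) t :=
    (((hasDerivAt_id t).const_mul π).mul_const (quadForm (formMap z) v)).neg.exp.ofReal_comp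
  refine (hgauss.const_mul _).congr_deriv ?_
  simp only [thetaTerm, gauss]
  push_cast
  ring

theorem norm_deriv_thetaTerm_le (z : ℍ) {t₀ : ℝ} (ht : t₀ ≤ t) (v : Fin 2 → ℤ) :
    ‖-(π * quadForm (formMap z) v) * thetaTerm z t v‖ ≤ π * z.im⁻¹ *
      (quadForm (formMap z) v ^ 2 * Real.exp (-(π * t₀ * quadForm (formMap z) v))) := by
  have hQ := quadForm_formMap_nonneg z v
  have := z.im_pos
  have hpi := Real.pi_pos
  rw [norm_mul, norm_neg, norm_mul, Complex.norm_of_nonneg hpi.le, Complex.norm_of_nonneg hQ,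
    norm_thetaTerm]
  calc π * quadForm (formMap z) v * (z.im⁻¹ *
        (quadForm (formMap z) v * Real.exp (-(π * t * quadForm (formMap z) v))))
      = π * z.im⁻¹ *
        (quadForm (formMap z) v ^ 2 * Real.exp (-(π * t * quadForm (formMap z) v))) := by ring
    _ ≤ _ := by gcongr

theorem hasDerivAt_theta (z : ℍ) (ht : 0 < t) :
    Summable (fun v => -(π * quadForm (formMap z) v) * thetaTerm z t v) ∧
    HasDerivAt (theta z) (∑' v, -(π * quadForm (formMap z) v) * thetaTerm z t v) t := by
  have hsum := (summable_quadForm_pow_mul_exp z (mul_pos Real.pi_pos (half_pos ht)) 2).mul_left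
    (π * z.im⁻¹)
  have hmem : t ∈ Set.Ioi (t / 2) := half_lt_self ht
  exact ⟨Summable.of_norm_bounded hsum fun v => norm_deriv_thetaTerm_le z (le_of_lt hmem) v,
    hasDerivAt_tsum_of_isPreconnected hsum isOpen_Ioi (convex_Ioi _).isPreconnected
      (fun v s _ => hasDerivAt_thetaTerm z v s)
      (fun v s hs => norm_deriv_thetaTerm_le z (le_of_lt hs) v) hmem
      (summable_thetaTerm z ht) hmem⟩

/-- The terms of the series obtained from `y² theta z t` by Poisson summation in `d`. -/
def thetaDual (z : ℍ) (t : ℝ) (v : Fin 2 → ℤ) : ℂ :=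
  ((√(t / z.im))⁻¹ : ℝ) * Complex.exp (2 * π * I * (v 0 * v 1 * z.re)) *
    (Real.exp (-(π * z.im * (t * v 0 ^ 2 + v 1 ^ 2 / t))) : ℝ) *
    ((z.im / (2 * π * t) - z.im ^ 2 * (v 1 / t + v 0) ^ 2 : ℝ) : ℂ)

theorem norm_thetaDual_le (z : ℍ) (ht : 0 < t) (v : Fin 2 → ℤ) :
    ‖thetaDual z t v‖ ≤ (√(t / z.im))⁻¹ *
      (Real.exp (-(π * z.im * (t * v 0 ^ 2 + v 1 ^ 2 / t))) *
        (z.im / (2 * π * t) + 2 * z.im ^ 2 / t * (t * v 0 ^ 2 + v 1 ^ 2 / t))) := by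
  have := z.im_pos
  have hphase : ‖Complex.exp (2 * π * I * (v 0 * v 1 * z.re))‖ = 1 := by
    convert Complex.norm_exp_ofReal_mul_I (2 * π * (v 0 * v 1 * z.re)) using 3
    push_cast
    ring
  have hpoly : ‖z.im / (2 * π * t) - z.im ^ 2 * ((v 1 : ℝ) / t + v 0) ^ 2‖ ≤
      z.im / (2 * π * t) + 2 * z.im ^ 2 / t * (t * v 0 ^ 2 + v 1 ^ 2 / t) := by
    refine (norm_sub_le _ _).trans ?_
    rw [Real.norm_of_nonneg (by positivity), Real.norm_of_nonneg (by positivity)]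
    calc z.im / (2 * π * t) + z.im ^ 2 * ((v 1 : ℝ) / t + v 0) ^ 2
        ≤ z.im / (2 * π * t) + z.im ^ 2 * (2 * (((v 1 : ℝ) / t) ^ 2 + v 0 ^ 2)) := by
          gcongr
          exact add_sq_le
      _ = _ := by field_simp; ring
  rw [thetaDual, norm_mul, norm_mul, norm_mul, hphase, mul_one, Complex.norm_real,
    Complex.norm_real, Complex.norm_real, Real.norm_of_nonneg (by positivity),
    Real.norm_of_nonneg (Real.exp_pos _).le, mul_assoc]
  gcongr

theorem summable_thetaDual (z : ℍ) (ht : 0 < t) : Summable (thetaDual z t) := by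
  let τ : ℍ := ⟨t * I, by simpa using ht⟩
  have hτ : ∀ v : Fin 2 → ℤ, quadForm (formMap τ) v = t * v 0 ^ 2 + v 1 ^ 2 / t := fun v => by
    rw [quadForm_formMap, show τ.im = t by simp [τ, UpperHalfPlane.im],
      show (τ : ℂ) = t * I from rfl, Complex.normSq_apply]
    simp only [Complex.add_re, Complex.add_im, Complex.mul_re, Complex.mul_im, Complex.intCast_re,
      Complex.intCast_im, Complex.ofReal_re, Complex.ofReal_im, Complex.I_re, Complex.I_im]
    field_simp
    ring
  have hpi : 0 < π * z.im := mul_pos Real.pi_pos z.im_pos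
  have hsum := ((summable_quadForm_pow_mul_exp τ hpi 0).mul_left (z.im / (2 * π * t))).add
    ((summable_quadForm_pow_mul_exp τ hpi 1).mul_left (2 * z.im ^ 2 / t))
  refine Summable.of_norm_bounded (hsum.mul_left (√(t / z.im))⁻¹) fun v =>
    (norm_thetaDual_le z ht v).trans_eq ?_
  rw [hτ]
  ring

theorem sq_mul_thetaTerm_row (z : ℍ) (t : ℝ) (c d : ℤ) :
    (z.im : ℂ) ^ 2 * thetaTerm z t ![c, d] = (Real.exp (-(π * z.im * (t * c ^ 2))) : ℝ) *
      quadGauss (t / z.im) (c * z.im) (c * z.re + d) := by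
  have hy := im_ofReal_ne_zero z
  have hz : (z : ℂ) = z.re + I * z.im := by apply Complex.ext <;> simp
  have hlin : linForm ![c, d] z = (c * z.re + d : ℝ) + I * (c * z.im : ℝ) := by
    rw [linForm, hz]
    simp only [Matrix.cons_val_zero, Matrix.cons_val_one]
    push_cast
    ring
  have hanti : z.im * antiForm ![c, d] z = (c * z.re + d : ℝ) - I * (c * z.im : ℝ) := by
    rw [antiForm, mul_div_cancel₀ _ hy, hlin, map_add, map_mul, Complex.conj_I,
      Complex.conj_ofReal, Complex.conj_ofReal]
    ring
  have hexp : -(π * t) * (linForm ![c, d] z * antiForm ![c, d] z) =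
      (-(π * z.im * (t * c ^ 2)) : ℝ) +
        -π * (t / z.im : ℝ) * (c * z.re + d : ℝ) ^ 2 := by
    refine mul_left_cancel₀ hy ?_
    linear_combination (norm := skip) (-(π * t) * linForm ![c, d] z) * hanti
    rw [hlin]
    push_cast
    field_simp
    linear_combination (π * t * c ^ 2 * z.im ^ 2) * Complex.I_sq
  rw [thetaTerm, gauss_formMap, hexp, Complex.exp_add, quadGauss, ← hanti, Complex.ofReal_exp]
  ring

theorem thetaDual_row (z : ℍ) (ht : 0 < t) (c m : ℤ) :
    thetaDual z t ![c, m] = (Real.exp (-(π * z.im * (t * c ^ 2))) : ℝ) *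
      (𝓕 (quadGauss (t / z.im) (c * z.im)) m * fourier m ((c * z.re : ℝ) : UnitAddCircle)) := by
  have hy := im_ofReal_ne_zero z
  have ht' : (t : ℂ) ≠ 0 := by exact_mod_cast ht.ne'
  have hpi : (π : ℂ) ≠ 0 := by exact_mod_cast Real.pi_ne_zero
  have hgauss : (-(π * z.im * ((m : ℂ) ^ 2 / t))) = -π / (t / z.im) * (m : ℂ) ^ 2 := by
    field_simp
  have hphase : (2 * π * I * (c * m * z.re) : ℂ) = 2 * π * I * m * (c * z.re) / 1 := by ring
  rw [fourier_quadGauss (div_pos ht z.im_pos), fourier_coe_apply, thetaDual]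
  simp only [Matrix.cons_val_zero, Matrix.cons_val_one, mul_add, neg_add, Real.exp_add]
  push_cast
  rw [hgauss, hphase]
  field_simp

theorem tsum_thetaTerm_row (z : ℍ) (ht : 0 < t) (c : ℤ) :
    (z.im : ℂ) ^ 2 * ∑' d : ℤ, thetaTerm z t ![c, d] = ∑' m : ℤ, thetaDual z t ![c, m] := by
  have hexp : ((Real.exp (-(π * z.im * (t * c ^ 2))) : ℝ) : ℂ) ≠ 0 := by
    exact_mod_cast (Real.exp_pos _).ne'
  have hrow : Summable fun m : ℤ => thetaDual z t ![c, m] :=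
    (summable_thetaDual z ht).comp_injective fun m m' hm => by simpa using congrFun hm 1
  have hfourier : Summable fun m : ℤ => 𝓕 (quadGauss (t / z.im) (c * z.im)) m := by
    simp only [thetaDual_row z ht, summable_mul_left_iff hexp] at hrow
    refine Summable.of_norm (hrow.norm.congr fun m => ?_)
    rw [norm_mul, fourier_apply, Circle.norm_coe, mul_one]
  rw [← tsum_mul_left]
  simp_rw [sq_mul_thetaTerm_row, thetaDual_row z ht]
  rw [tsum_mul_left, tsum_mul_left, Real.tsum_eq_tsum_fourier_of_rpow_decay_of_summable
    (by unfold quadGauss; fun_prop) one_lt_two (quadGauss_isBigO (div_pos ht z.im_pos) _) hfourier]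

theorem tsum_fin_two_arrow {f : (Fin 2 → ℤ) → ℂ} (hf : Summable f) :
    ∑' v, f v = ∑' c : ℤ, ∑' d : ℤ, f ![c, d] := by
  rw [← (finTwoArrowEquiv ℤ).symm.tsum_eq f]
  exact Summable.tsum_prod ((finTwoArrowEquiv ℤ).symm.summable_iff.mpr hf)

theorem sq_mul_theta (z : ℍ) (ht : 0 < t) :
    (z.im : ℂ) ^ 2 * theta z t = ∑' v, thetaDual z t v := by
  rw [theta, tsum_fin_two_arrow (summable_thetaTerm z ht),
    tsum_fin_two_arrow (summable_thetaDual z ht), ← tsum_mul_left]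
  exact tsum_congr fun c => tsum_thetaTerm_row z ht c

theorem thetaDual_inv_swap (z : ℍ) (ht : 0 < t) (v : Fin 2 → ℤ) :
    thetaDual z t⁻¹ (v ∘ Equiv.swap 0 1) = t ^ 3 * thetaDual z t v := by
  have hsqrt : (√(t⁻¹ / z.im))⁻¹ = t * (√(t / z.im))⁻¹ := by
    rw [show t⁻¹ / z.im = t / z.im / t ^ 2 by field_simp, Real.sqrt_div' _ (by positivity),
      Real.sqrt_sq ht.le, inv_div, div_eq_mul_inv]
  have hform : t⁻¹ * (v 1 : ℝ) ^ 2 + v 0 ^ 2 / t⁻¹ = t * v 0 ^ 2 + v 1 ^ 2 / t := by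
    rw [div_inv_eq_mul]
    ring
  have hpoly : z.im / (2 * π * t⁻¹) - z.im ^ 2 * ((v 0 : ℝ) / t⁻¹ + v 1) ^ 2 =
      t ^ 2 * (z.im / (2 * π * t) - z.im ^ 2 * ((v 1 : ℝ) / t + v 0) ^ 2) := by
    field_simp
    ring
  simp only [thetaDual, Function.comp_apply, Equiv.swap_apply_left, Equiv.swap_apply_right]
  rw [hsqrt, hform, hpoly, mul_comm (v 1 : ℂ) (v 0 : ℂ)]
  push_cast
  ring

theorem theta_inv (z : ℍ) (ht : 0 < t) : theta z t⁻¹ = t ^ 3 * theta z t := by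
  refine mul_left_cancel₀ (pow_ne_zero 2 (im_ofReal_ne_zero z)) ?_
  rw [sq_mul_theta z (inv_pos.mpr ht), mul_left_comm, sq_mul_theta z ht, ← tsum_mul_left,
    ← ((Equiv.swap (0 : Fin 2) 1).arrowCongr (Equiv.refl ℤ)).tsum_eq]
  exact tsum_congr fun v => thetaDual_inv_swap z ht v

/-- Obtained by differentiating the functional equation `theta_inv` at `t = 1`. -/
theorem hasSum_three_sub_mul_thetaTerm (z : ℍ) :
    HasSum (fun v => (3 - 2 * (π * quadForm (formMap z) v)) * thetaTerm z 1 v) 0 := by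
  obtain ⟨hsum, hderiv⟩ := hasDerivAt_theta z one_pos
  set D := ∑' v, -(π * quadForm (formMap z) v) * thetaTerm z 1 v with hD
  have hid : HasDerivAt (fun t : ℝ => (t : ℂ)) 1 1 := Complex.ofRealCLM.hasDerivAt
  have hinv : HasDerivAt (fun t : ℝ => t⁻¹) (-1 / 1 ^ 2) 1 :=
    (hasDerivAt_id (1 : ℝ)).fun_inv one_ne_zero
  have hleft : HasDerivAt (fun t : ℝ => theta z t⁻¹) ((-1 / 1 ^ 2 : ℝ) • D) 1 :=
    HasDerivAt.scomp (g₁ := theta z) (h := fun t : ℝ => t⁻¹) 1 (by simpa using hderiv) hinv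
  have hright := (hid.pow 3).mul hderiv
  have hfun : (fun t : ℝ => theta z t⁻¹) =ᶠ[𝓝 1] (fun t : ℝ => (t : ℂ)) ^ 3 * theta z := by
    filter_upwards [Ioi_mem_nhds (zero_lt_one (α := ℝ))] with t ht using theta_inv z ht
  have hderiv_eq := hleft.unique (hright.congr_of_eventuallyEq hfun)
  have hzero : 3 * theta z 1 + 2 * D = 0 := by
    simp at hderiv_eq
    linear_combination -hderiv_eq
  have hcomb := ((summable_thetaTerm z one_pos).hasSum.mul_left 3).add (hsum.hasSum.mul_left 2)
  rw [← hD, ← theta, hzero] at hcomb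
  refine hcomb.congr_fun fun v => ?_
  ring

end Theta

section LapLogWeight

theorem hasSum_boundary_logWeight (n : ℕ) (z : ℍ) :
    HasSum (fun v => antiForm v z ^ 2 *
      ((logWeightDeriv n 1 - (2 - π * quadForm (formMap z) v) * logWeight n 1) *
        gauss (formMap z) (v, 1))) 0 := by
  rcases n with _ | _ | n
  · have htheta := (hasSum_three_sub_mul_thetaTerm z).neg
    rw [neg_zero] at htheta
    refine htheta.congr_fun fun v => ?_
    simp only [logWeight, logWeightDeriv, thetaTerm, Complex.ofReal_one, pow_zero]
    push_cast
    ring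
  all_goals simp [logWeight, logWeightDeriv, hasSum_zero]

theorem lap_eisInt_logWeight (n : ℕ) :
    lap 2 (eisInt (logWeight n)) =
      (n : ℂ) • eisInt (logWeight (n - 1)) + (n * (n - 1) : ℂ) • eisInt (logWeight (n - 2)) := by
  have h₁ : IsPolyBdd fun t => (n : ℂ) * logWeight (n - 1) t :=
    (IsPolyBdd.const _).mul (isPolyBdd_logWeight _)
  have h₂ : IsPolyBdd fun t => (n * (n - 1) : ℂ) * logWeight (n - 2) t :=
    (IsPolyBdd.const _).mul (isPolyBdd_logWeight _)
  rw [← eisInt_const_mul, ← eisInt_const_mul, ← eisInt_add h₁ h₂]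
  ext z
  have hlap := hasSum_lap_eisInt_sub (isPolyBdd_logWeight n) (isPolyBdd_logWeightDeriv n)
    ((IsPolyBdd.ofReal.pow 2).mul ((IsPolyBdd.inv.pow 2).mul (h₁.add h₂)))
    (fun t ht => hasDerivAt_logWeight n ht) (fun t ht => hasDerivAt_logWeightDeriv n ht) z
  rw [sub_eq_zero.mp (hlap.unique (hasSum_boundary_logWeight n z))]
  refine congrFun (eisInt_congr fun t ht => ?_) z
  have : (t : ℂ) ≠ 0 := by exact_mod_cast (one_pos.trans ht).ne'
  field_simp

end LapLogWeight

/-! ### Entire families of Eisenstein integrals -/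

section PowWeight

theorem norm_ofReal_cpow_le_pow {t : ℝ} (ht : 1 < t) {s : ℂ} {M : ℕ} (hs : s.re ≤ M) :
    ‖(t : ℂ) ^ s‖ ≤ t ^ M := by
  rw [Complex.norm_cpow_eq_rpow_re_of_pos (one_pos.trans ht), ← Real.rpow_natCast]
  exact Real.rpow_le_rpow_of_exponent_le ht.le hs

theorem IsPolyBdd.cpow (s : ℂ) : IsPolyBdd fun t => (t : ℂ) ^ s :=
  ⟨Complex.measurable_ofReal.pow_const s, 1, ⌈s.re⌉₊, zero_le_one, fun t ht => by
    rw [one_mul]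
    exact norm_ofReal_cpow_le_pow ht (Nat.le_ceil _)⟩

/-- The weight function `(log t)ⁿ (t^{s+1} + (-1)ⁿ t^{-s})`. It is the `n`-th derivative in `s` of
`t^{s+1} + t^{-s}`, the weight whose Eisenstein integral is the Mellin transform of `theta`. -/
def powWeight (n : ℕ) (s : ℂ) (t : ℝ) : ℂ :=
  (Real.log t : ℂ) ^ n * ((t : ℂ) ^ (s + 1) + (-1) ^ n * (t : ℂ) ^ (-s))

theorem isPolyBdd_powWeight (n : ℕ) (s : ℂ) : IsPolyBdd (powWeight n s) :=
  (IsPolyBdd.log.pow n).mul ((IsPolyBdd.cpow _).add ((IsPolyBdd.const _).mul (.cpow _)))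

theorem hasDerivAt_powWeight (n : ℕ) (s : ℂ) {t : ℝ} (ht : 0 < t) :
    HasDerivAt (fun s => powWeight n s t) (powWeight (n + 1) s t) s := by
  have ht' : (t : ℂ) ≠ 0 := by exact_mod_cast ht.ne'
  have hpow := ((hasDerivAt_id s).add_const 1).const_cpow (c := (t : ℂ)) (Or.inl ht')
  have hneg := (hasDerivAt_id s).neg.const_cpow (c := (t : ℂ)) (Or.inl ht')
  refine ((hpow.add (hneg.const_mul ((-1 : ℂ) ^ n))).const_mul ((Real.log t : ℂ) ^ n)).congr_deriv
    ?_
  simp only [powWeight, id, Pi.neg_apply, Complex.ofReal_log ht.le]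
  ring

theorem norm_powWeight_le (n : ℕ) {s : ℂ} {M : ℕ} (hM : |s.re| + 1 ≤ M) {t : ℝ} (ht : 1 < t) :
    ‖powWeight n s t‖ ≤ 2 * t ^ (n + M) := by
  have hlog : ‖(Real.log t : ℂ) ^ n‖ ≤ t ^ n := by
    rw [norm_pow, Complex.norm_of_nonneg (Real.log_nonneg ht.le)]
    exact pow_le_pow_left₀ (Real.log_nonneg ht.le) (Real.log_le_self (one_pos.trans ht).le) n
  have hpow : ‖(t : ℂ) ^ (s + 1)‖ ≤ t ^ M :=
    norm_ofReal_cpow_le_pow ht <| le_trans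
      (by rw [Complex.add_re, Complex.one_re]; gcongr; exact le_abs_self _) hM
  have hneg : ‖(t : ℂ) ^ (-s)‖ ≤ t ^ M :=
    norm_ofReal_cpow_le_pow ht <| le_trans
      (by rw [Complex.neg_re]; linarith [neg_le_abs s.re]) hM
  calc ‖powWeight n s t‖
      ≤ ‖(Real.log t : ℂ) ^ n‖ * (‖(t : ℂ) ^ (s + 1)‖ + ‖(t : ℂ) ^ (-s)‖) := by
        rw [powWeight, norm_mul]
        gcongr
        refine (norm_add_le _ _).trans_eq ?_
        rw [norm_mul, norm_pow, norm_neg, norm_one, one_pow, one_mul]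
    _ ≤ t ^ n * (t ^ M + t ^ M) := by gcongr
    _ = 2 * t ^ (n + M) := by ring

theorem hasDerivAt_eisInt_powWeight (n : ℕ) (z : ℍ) (s₀ : ℂ) :
    HasDerivAt (fun s => eisInt (powWeight n s) z) (eisInt (powWeight (n + 1) s₀) z) s₀ := by
  set M := ⌈|s₀.re| + 2⌉₊
  set W : ℝ → ℂ := fun t => 2 * (t : ℂ) ^ (n + 1 + M) with hW
  have hWbdd : IsPolyBdd W := (IsPolyBdd.const 2).mul (IsPolyBdd.ofReal.pow _)
  have hbound : ∀ t : ℝ, 1 < t → ∀ s ∈ Metric.ball s₀ 1, ‖powWeight (n + 1) s t‖ ≤ ‖W t‖ := by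
    intro t ht s hs
    have hdist := (Complex.abs_re_le_norm (s - s₀)).trans (mem_ball_iff_norm.mp hs).le
    rw [Complex.sub_re] at hdist
    have hre : |s.re| + 1 ≤ M := by
      linarith [abs_sub_abs_le_abs_sub s.re s₀.re, Nat.le_ceil (|s₀.re| + 2)]
    refine (norm_powWeight_le (n + 1) hre ht).trans_eq ?_
    rw [hW, norm_mul, norm_pow, Complex.norm_of_nonneg (one_pos.trans ht).le, Complex.norm_two]
  refine (hasDerivAt_integral_of_dominated_loc_of_deriv_le (μ := latticeMeasure)
    (F := fun s p => eisKernel (powWeight n s) z p)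
    (F' := fun s p => eisKernel (powWeight (n + 1) s) z p)
    (bound := fun p => ‖eisKernel W z p‖)
    (Metric.ball_mem_nhds s₀ one_pos)
    (Eventually.of_forall fun s => ((isKernel_eisKernel (isPolyBdd_powWeight n s)).integrable z).1)
    ((isKernel_eisKernel (isPolyBdd_powWeight n s₀)).integrable z)
    ((isKernel_eisKernel (isPolyBdd_powWeight (n + 1) s₀)).integrable z).1 ?_
    ((isKernel_eisKernel hWbdd).integrable z).norm ?_).2
  · filter_upwards [ae_latticeMeasure_one_lt] with p hp s hs
    simp only [eisKernel, norm_mul]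
    gcongr
    exact hbound p.2 hp s hs
  · filter_upwards [ae_latticeMeasure_one_lt] with p hp s _
    exact ((hasDerivAt_powWeight n s (one_pos.trans hp)).mul_const _).const_mul _

theorem eisInt_powWeight_zero (n : ℕ) : eisInt (powWeight n 0) = eisInt (logWeight n) := by
  refine eisInt_congr fun t _ => ?_
  simp only [powWeight, logWeight, zero_add, Complex.cpow_one, neg_zero, Complex.cpow_zero, mul_one]
  ring

theorem iteratedDeriv_succ_id_mul {𝕜 : Type*} [NontriviallyNormedField 𝕜] {F : ℕ → 𝕜 → 𝕜}
    (hF : ∀ n s, HasDerivAt (F n) (F (n + 1) s) s) (n : ℕ) :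
    iteratedDeriv (n + 1) (fun s => s * F 0 s) = fun s => s * F (n + 1) s + (n + 1) * F n s := by
  induction n with
  | zero =>
    ext s
    rw [iteratedDeriv_one, ((hasDerivAt_id' s).fun_mul (hF 0 s)).deriv]
    push_cast
    ring
  | succ n ih =>
    ext s
    rw [iteratedDeriv_succ, ih, (((hasDerivAt_id' s).fun_mul (hF (n + 1) s)).fun_add
      ((hF n s).const_mul _)).deriv]
    push_cast
    ring

/-- The entire function of `s` which continues the completed Eisenstein series `eisSeries2 z`. -/
def eisCont (z : ℍ) (s : ℂ) : ℂ := s * (π / 2 * eisInt (powWeight 0 s) z)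

theorem differentiable_eisCont (z : ℍ) : Differentiable ℂ (eisCont z) :=
  differentiable_id.mul (Differentiable.const_mul
    (fun s => (hasDerivAt_eisInt_powWeight 0 z s).differentiableAt) _)

theorem iteratedDeriv_succ_eisCont_zero (n : ℕ) (z : ℍ) :
    iteratedDeriv (n + 1) (eisCont z) 0 = (n + 1) * (π / 2 * eisInt (logWeight n) z) := by
  have hderiv := iteratedDeriv_succ_id_mul
    (F := fun n s => π / 2 * eisInt (powWeight n s) z)
    (fun n s => (hasDerivAt_eisInt_powWeight n z s).const_mul _) n
  exact (congrFun hderiv 0).trans (by simp only [eisInt_powWeight_zero, zero_mul, zero_add])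

end PowWeight

/-! ### The Mellin transform of the theta series -/

section Mellin

variable {w : ℝ → ℂ}

theorem eisKernel_eq_mul_thetaTerm (w : ℝ → ℂ) (z : ℍ) (v : Fin 2 → ℤ) (t : ℝ) :
    eisKernel w z (v, t) = w t * thetaTerm z t v := by
  simp only [eisKernel, thetaTerm]
  ring

theorem integral_count_eisKernel (w : ℝ → ℂ) (z : ℍ) {t : ℝ} (ht : 0 < t) :
    ∫ v, eisKernel w z (v, t) ∂Measure.count = w t * theta z t := by
  simp_rw [eisKernel_eq_mul_thetaTerm]
  rw [integral_const_mul, integral_countable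
    (integrable_count_iff.mpr (summable_thetaTerm z ht).norm)]
  simp [theta]

theorem integrableOn_mul_theta (hw : IsPolyBdd w) (z : ℍ) :
    IntegrableOn (fun t => w t * theta z t) (Set.Ioi 1) := by
  refine ((isKernel_eisKernel hw).integrable z).integral_prod_right.congr ?_
  filter_upwards [ae_restrict_mem measurableSet_Ioi] with t ht
  exact integral_count_eisKernel w z (one_pos.trans ht)

theorem integral_mul_theta (hw : IsPolyBdd w) (z : ℍ) :
    ∫ t in Set.Ioi 1, w t * theta z t = eisInt w z := by
  rw [eisInt, kernelInt, latticeMeasure,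
    integral_prod_symm _ ((isKernel_eisKernel hw).integrable z)]
  exact setIntegral_congr_fun measurableSet_Ioi fun t ht =>
    (integral_count_eisKernel w z (one_pos.trans ht)).symm

theorem hasMellin_indicator_mul_theta (hw : IsPolyBdd w) (z : ℍ) (s : ℂ) :
    HasMellin ((Set.Ioi 1).indicator fun t => w t * theta z t) s
      (eisInt (fun t => (t : ℂ) ^ (s - 1) * w t) z) := by
  have hcpow : IsPolyBdd fun t => (t : ℂ) ^ (s - 1) * w t := (IsPolyBdd.cpow _).mul hw
  have hind : (fun t : ℝ => (t : ℂ) ^ (s - 1) • (Set.Ioi 1).indicator (fun t => w t * theta z t) t)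
      = (Set.Ioi 1).indicator fun t : ℝ => ((t : ℂ) ^ (s - 1) * w t) * theta z t := by
    ext t
    by_cases ht : t ∈ Set.Ioi (1 : ℝ)
    · rw [Set.indicator_of_mem ht, Set.indicator_of_mem ht, smul_eq_mul, mul_assoc]
    · rw [Set.indicator_of_notMem ht, Set.indicator_of_notMem ht, smul_zero]
  constructor
  · rw [MellinConvergent, hind]
    exact ((integrableOn_mul_theta hcpow z).integrable_indicator measurableSet_Ioi).integrableOn
  · rw [mellin, hind, setIntegral_indicator measurableSet_Ioi,
      Set.inter_eq_self_of_subset_right (Set.Ioi_subset_Ioi zero_le_one), integral_mul_theta hcpow]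

theorem eq_indicator_Ioi_add_indicator_inv (f : ℝ → ℂ) {t : ℝ} (ht : 0 < t) (ht₁ : t ≠ 1) :
    f t = (Set.Ioi 1).indicator f t + (Set.Ioi 1).indicator (fun t => f t⁻¹) t⁻¹ := by
  rcases ht₁.lt_or_gt with hlt | hgt
  · rw [Set.indicator_of_notMem (by simpa using hlt.le), zero_add,
      Set.indicator_of_mem (Set.mem_Ioi.mpr ((one_lt_inv₀ ht).mpr hlt)), inv_inv]
  · rw [Set.indicator_of_mem (Set.mem_Ioi.mpr hgt), Set.indicator_of_notMem, add_zero]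
    simpa using inv_le_one_of_one_le₀ hgt.le

theorem mellin_eq_add_of_hasMellin_indicator {f : ℝ → ℂ} {s a b : ℂ}
    (ha : HasMellin ((Set.Ioi 1).indicator f) s a)
    (hb : HasMellin ((Set.Ioi 1).indicator fun t => f t⁻¹) (-s) b) : mellin f s = a + b := by
  set g := (Set.Ioi 1).indicator fun t => f t⁻¹
  have hconv : MellinConvergent (fun t => g t⁻¹) s := by
    have hrpow := (MellinConvergent.comp_rpow (f := g) (s := s) (a := -1) (by norm_num)).mpr
      (by simpa [div_neg] using hb.1)
    simpa only [Real.rpow_neg_one] using hrpow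
  have hsplit : mellin f s = mellin (fun t => (Set.Ioi 1).indicator f t + g t⁻¹) s := by
    refine setIntegral_congr_ae measurableSet_Ioi ?_
    have hne : ∀ᵐ t : ℝ, t ≠ 1 := by simp [ae_iff]
    filter_upwards [hne] with t ht₁ ht
    rw [eq_indicator_Ioi_add_indicator_inv f ht ht₁]
  rw [hsplit, (hasMellin_add ha.1 hconv).2, mellin_comp_inv, ha.2, hb.2]

theorem mellin_theta (z : ℍ) (s : ℂ) : mellin (theta z) (s + 2) = eisInt (powWeight 0 s) z := by
  have hlarge := hasMellin_indicator_mul_theta (IsPolyBdd.const 1) z (s + 2)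
  have hsmall := hasMellin_indicator_mul_theta (IsPolyBdd.ofReal.pow 3) z (-(s + 2))
  have hinv : (Set.Ioi 1).indicator (fun t : ℝ => (t : ℂ) ^ 3 * theta z t) =
      (Set.Ioi 1).indicator fun t => theta z t⁻¹ :=
    Set.indicator_congr fun t ht => (theta_inv z (one_pos.trans ht)).symm
  simp only [one_mul] at hlarge
  rw [hinv] at hsmall
  rw [mellin_eq_add_of_hasMellin_indicator hlarge hsmall, ← Pi.add_apply,
    ← eisInt_add ((IsPolyBdd.cpow _).mul (.const 1)) ((IsPolyBdd.cpow _).mul (.pow .ofReal 3))]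
  refine congrFun (eisInt_congr fun t ht => ?_) z
  have ht' : (t : ℂ) ≠ 0 := by exact_mod_cast (one_pos.trans ht).ne'
  simp only [powWeight, pow_zero, one_mul, mul_one]
  rw [← Complex.cpow_natCast, ← Complex.cpow_add _ _ ht']
  congr 2 <;> push_cast <;> ring

end Mellin

/-! ### The Dirichlet series -/

section EisSeries

variable {z : ℍ} {s : ℂ}

/-- The terms `y^s / ((c z + d)² |c z + d|^{2s})` of the Eisenstein series. At the origin of `ℤ²`
this is the junk value `0`. -/
def eisTerm (z : ℍ) (s : ℂ) (v : Fin 2 → ℤ) : ℂ :=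
  (z.im : ℂ) ^ s / (linForm v z ^ 2 * (‖linForm v z‖ : ℂ) ^ (2 * s))

theorem eisTerm_zero (z : ℍ) (s : ℂ) : eisTerm z s 0 = 0 := by simp [eisTerm, linForm]

theorem norm_eisTerm (z : ℍ) (hs : 0 < s.re) (v : Fin 2 → ℤ) :
    ‖eisTerm z s v‖ = z.im ^ s.re * ‖linForm v z‖ ^ (-(2 + 2 * s.re)) := by
  rw [eisTerm, norm_div, norm_mul, norm_pow, Complex.norm_cpow_eq_rpow_re_of_pos z.im_pos,
    Complex.norm_cpow_eq_rpow_re_of_nonneg (norm_nonneg _) (by simpa using hs.ne'),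
    Real.rpow_neg (norm_nonneg _),
    Real.rpow_add_of_nonneg (norm_nonneg _) zero_le_two (by positivity),
    Real.rpow_two, div_eq_mul_inv]
  simp

theorem summable_norm_eisTerm (z : ℍ) (hs : 0 < s.re) : Summable fun v => ‖eisTerm z s v‖ := by
  have hsum := (EisensteinSeries.summable_one_div_norm_rpow (k := 2 + 2 * s.re)
    (by linarith)).mul_left (z.im ^ s.re * EisensteinSeries.r z ^ (-(2 + 2 * s.re)))
  refine hsum.of_nonneg_of_le (fun v => norm_nonneg _) fun v => ?_
  rw [norm_eisTerm z hs, mul_assoc]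
  have := z.im_pos
  gcongr
  exact EisensteinSeries.summand_bound z (by linarith) v

theorem linForm_ne_zero (z : ℍ) {v : Fin 2 → ℤ} (hv : v ≠ 0) : linForm v z ≠ 0 := by
  refine left_ne_zero_of_mul (b := antiForm v z) ?_
  rw [linForm_mul_antiForm]
  exact_mod_cast (quadForm_formMap_pos z hv).ne'

theorem quadForm_formMap_cpow (z : ℍ) (s : ℂ) {v : Fin 2 → ℤ} (hv : v ≠ 0) :
    (quadForm (formMap z) v : ℂ) ^ s = (‖linForm v z‖ : ℂ) ^ (2 * s) / (z.im : ℂ) ^ s := by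
  have hnorm : (‖linForm v z‖ : ℂ) ≠ 0 := by simpa using linForm_ne_zero z hv
  have hsq : ((‖linForm v z‖ ^ 2 : ℝ) : ℂ) ^ s = (‖linForm v z‖ : ℂ) ^ (2 * s) := by
    rw [sq, Complex.ofReal_mul, Complex.mul_cpow_ofReal_nonneg (norm_nonneg _) (norm_nonneg _),
      ← Complex.cpow_add _ _ hnorm, two_mul]
  have harg : Complex.arg (z.im : ℂ) ≠ π := by
    rw [Complex.arg_ofReal_of_nonneg z.im_pos.le]
    exact Real.pi_pos.ne
  rw [quadForm_formMap, ← linForm, Complex.normSq_eq_norm_sq, div_eq_mul_inv, Complex.ofReal_mul,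
    Complex.mul_cpow_ofReal_nonneg (by positivity) (inv_pos.mpr z.im_pos).le, hsq,
    Complex.ofReal_inv, Complex.inv_cpow _ _ harg, div_eq_mul_inv]

theorem antiForm_sq_div_cpow (z : ℍ) (s : ℂ) {v : Fin 2 → ℤ} (hv : v ≠ 0) :
    antiForm v z ^ 2 / (quadForm (formMap z) v : ℂ) ^ (s + 2) = eisTerm z s v := by
  have hlin := linForm_ne_zero z hv
  have hanti := antiForm_ne_zero z hv
  rw [Complex.cpow_add _ _ (by exact_mod_cast (quadForm_formMap_pos z hv).ne'),
    quadForm_formMap_cpow z s hv, Complex.cpow_ofNat, ← linForm_mul_antiForm, eisTerm]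
  field_simp

theorem hasSum_mellin_theta (z : ℍ) (hs : 0 < s.re) :
    HasSum (fun v => (π : ℂ) ^ (-(s + 2)) * Complex.Gamma (s + 2) * eisTerm z s v)
      (mellin (theta z) (s + 2)) := by
  have hmellin := hasSum_mellin_pi_mul (ι := Fin 2 → ℤ) (a := fun v => antiForm v z ^ 2)
    (q := fun v => quadForm (formMap z) v) (F := theta z) (s := s + 2) (fun v => ?_)
    (by rw [Complex.add_re, Complex.re_ofNat]; linarith) (fun t ht => ?_) ?_
  · refine hmellin.congr_fun fun v => ?_
    obtain rfl | hv := eq_or_ne v 0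
    · simp [eisTerm_zero, antiForm_zero]
    · rw [mul_div_assoc, antiForm_sq_div_cpow z s hv]
  · obtain rfl | hv := eq_or_ne v 0
    · simp [antiForm_zero]
    · exact Or.inr (quadForm_formMap_pos z hv)
  · refine (summable_thetaTerm z ht).hasSum.congr_fun fun v => ?_
    rw [thetaTerm, gauss]
    congr 4
    ring
  · refine (summable_norm_eisTerm z hs).congr fun v => ?_
    obtain rfl | hv := eq_or_ne v 0
    · simp [eisTerm_zero, antiForm_zero]
    · rw [← antiForm_sq_div_cpow z s hv, norm_div,
        Complex.norm_cpow_eq_rpow_re_of_pos (quadForm_formMap_pos z hv)]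

theorem eisTerm_nsmul (z : ℍ) (s : ℂ) {n : ℕ} (hn : n ≠ 0) (v : Fin 2 → ℤ) :
    eisTerm z s (n • v) = 1 / (n : ℂ) ^ (2 * s + 2) * eisTerm z s v := by
  have hlin : linForm (n • v) z = n * linForm v z := by
    simp [linForm]
    ring
  rw [eisTerm, eisTerm, hlin, norm_mul, Complex.norm_natCast, Complex.ofReal_mul,
    Complex.mul_cpow_ofReal_nonneg (Nat.cast_nonneg n) (norm_nonneg _),
    Complex.cpow_add _ _ (Nat.cast_ne_zero.mpr hn), Complex.cpow_ofNat, Complex.ofReal_natCast]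
  simp only [div_eq_mul_inv, mul_inv, mul_pow]
  ring

theorem tsum_coprime (f : (Fin 2 → ℤ) → ℂ) :
    ∑' p : {p : ℤ × ℤ // IsCoprime p.1 p.2}, f ![p.1.1, p.1.2] =
      ∑' v : EisensteinSeries.gammaSet 1 1 0, f v := by
  let φ : {p : ℤ × ℤ // IsCoprime p.1 p.2} ≃ EisensteinSeries.gammaSet 1 1 0 :=
    (finTwoArrowEquiv ℤ).symm.subtypeEquiv fun p => by
      rw [EisensteinSeries.mem_gammaSet_one]
      rfl
  exact φ.tsum_eq fun v => f v

theorem tsum_gammaSet_eisTerm (z : ℍ) (hs : 2 * s + 2 ≠ 0) (n : ℕ) :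
    ∑' v : EisensteinSeries.gammaSet 1 n 0, eisTerm z s v = 1 / (n : ℂ) ^ (2 * s + 2) *
      ∑' v : EisensteinSeries.gammaSet 1 1 0, eisTerm z s v := by
  obtain rfl | hn := eq_or_ne n 0
  · have hzero : ∀ v : EisensteinSeries.gammaSet 1 0 0, eisTerm z s v = 0 := fun v => by
      rw [EisensteinSeries.gammaSet_eq_gcd_mul_divIntMap v.2, zero_smul, eisTerm_zero]
    rw [tsum_congr hzero, tsum_zero, Nat.cast_zero, Complex.zero_cpow hs, div_zero, zero_mul]
  · have : NeZero n := ⟨hn⟩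
    rw [← tsum_mul_left, ← (EisensteinSeries.gammaSetDivGcdEquiv n).tsum_eq]
    refine tsum_congr fun v => ?_
    rw [EisensteinSeries.gammaSetDivGcdEquiv_eq, ← eisTerm_nsmul z s hn,
      ← EisensteinSeries.gammaSet_eq_gcd_mul_divIntMap v.2]

theorem tsum_eisTerm (z : ℍ) (hs : 0 < s.re) :
    ∑' v, eisTerm z s v = riemannZeta (2 * s + 2) *
      ∑' p : {p : ℤ × ℤ // IsCoprime p.1 p.2}, eisTerm z s ![p.1.1, p.1.2] := by
  have hre : 1 < (2 * s + 2).re := by simp; linarith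
  have hne : 2 * s + 2 ≠ 0 := fun h => by rw [h] at hre; norm_num at hre
  have hgcd : ∑' v, eisTerm z s v =
      ∑' (n : ℕ) (v : EisensteinSeries.gammaSet 1 n 0), eisTerm z s v :=
    (EisensteinSeries.gammaSetDivGcdSigmaEquiv.symm.tsum_eq (eisTerm z s)).symm.trans
      (EisensteinSeries.gammaSetDivGcdSigmaEquiv.symm.summable_iff.mpr
        (summable_norm_eisTerm z hs).of_norm).tsum_sigma
  rw [hgcd, tsum_coprime (eisTerm z s), zeta_eq_tsum_one_div_nat_cpow hre, ← tsum_mul_right]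
  exact tsum_congr fun n => tsum_gammaSet_eisTerm z hne n

theorem eisCont_eq_eisSeries2 (z : ℍ) (hs : 0 < s.re) : eisCont z s = eisSeries2 z s := by
  have hpi : (π : ℂ) ≠ 0 := by exact_mod_cast Real.pi_ne_zero
  have hs₁ : s + 1 ≠ 0 := Complex.ne_zero_of_re_pos (by simp; linarith)
  have hsum := (hasSum_mellin_theta z hs).tsum_eq
  rw [tsum_mul_left, tsum_eisTerm z hs, mellin_theta] at hsum
  have hGamma : Complex.Gamma (s + 2) = (s + 1) * Complex.Gamma (s + 1) := by
    rw [← Complex.Gamma_add_one _ hs₁, add_assoc, one_add_one_eq_two]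
  have hpow : (π : ℂ) ^ (-(s + 1)) = π * (π : ℂ) ^ (-(s + 2)) := by
    rw [show -(s + 1) = 1 + -(s + 2) by ring, Complex.cpow_add _ _ hpi, Complex.cpow_one]
  rw [eisCont, eisSeries2, ← hsum, hGamma, hpow]
  simp only [eisTerm, linForm, Matrix.cons_val_zero, Matrix.cons_val_one]
  ring

theorem isContinuation_eisCont (z : ℍ) : IsContinuation z (eisCont z) :=
  ⟨differentiable_eisCont z, fun _ hs => eisCont_eq_eisSeries2 z (one_pos.trans hs)⟩

theorem isContinuation_E2 (z : ℍ) : IsContinuation z (E2 z) :=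
  Classical.epsilon_spec ⟨_, isContinuation_eisCont z⟩

theorem IsContinuation.unique {g h : ℂ → ℂ} (hg : IsContinuation z g) (hh : IsContinuation z h) :
    g = h := by
  have hganal : AnalyticOnNhd ℂ g Set.univ := fun s _ => hg.entire.analyticAt s
  have hhanal : AnalyticOnNhd ℂ h Set.univ := fun s _ => hh.entire.analyticAt s
  refine hganal.eq_of_eventuallyEq hhanal (z₀ := 2) ?_
  filter_upwards [(isOpen_lt continuous_const Complex.continuous_re).mem_nhds
    (show (1 : ℝ) < (2 : ℂ).re by norm_num)] with s hs
  rw [hg.eq_series s hs, hh.eq_series s hs]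

theorem E2_eq_eisCont (z : ℍ) : E2 z = eisCont z :=
  (isContinuation_E2 z).unique (isContinuation_eisCont z)

theorem G_zero (z : ℍ) : G 0 z = 0 := by
  simp [G, E2_eq_eisCont, eisCont]

theorem G_succ (n : ℕ) : G (n + 1) = (π / (2 * n.factorial) : ℂ) • eisInt (logWeight n) := by
  ext z
  have hfact : (n.factorial : ℂ) ≠ 0 := by exact_mod_cast n.factorial_ne_zero
  have hsucc : (n : ℂ) + 1 ≠ 0 := by exact_mod_cast n.succ_ne_zero
  rw [G, E2_eq_eisCont, iteratedDeriv_succ_eisCont_zero, Pi.smul_apply, smul_eq_mul,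
    Nat.factorial_succ]
  push_cast
  field_simp

end EisSeries

/-! ### Nonvanishing of the first Taylor coefficient -/

section Nonvanishing

/-- The point `2i`, at which the theta series is positive. The fixed point `i` would not do, since
forms of weight two vanish there. -/
def twoI : ℍ := ⟨2 * I, by simp⟩

theorem quadForm_twoI (v : Fin 2 → ℤ) :
    quadForm (formMap twoI) v = (4 * (v 0 : ℝ) ^ 2 + (v 1 : ℝ) ^ 2) / 2 := by
  rw [quadForm_formMap]
  simp [twoI, Complex.normSq_apply, UpperHalfPlane.im]
  ring

theorem antiForm_twoI_sq_re (v : Fin 2 → ℤ) :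
    (antiForm v twoI ^ 2).re = (v 1 : ℝ) ^ 2 / 4 - (v 0 : ℝ) ^ 2 := by
  have hanti : antiForm v twoI = (v 1 / 2 : ℝ) - (v 0 : ℝ) * I := by
    have him : twoI.im = 2 := by simp [twoI, UpperHalfPlane.im]
    have hcoe : (twoI : ℂ) = 2 * I := rfl
    rw [antiForm, conj_linForm, him, hcoe, map_mul, Complex.conj_ofNat, Complex.conj_I]
    push_cast
    ring
  rw [hanti, sq]
  simp only [Complex.mul_re, Complex.sub_re, Complex.sub_im, Complex.mul_im, Complex.ofReal_re,
    Complex.ofReal_im, Complex.I_re, Complex.I_im]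
  ring

theorem thetaTerm_twoI_re (t : ℝ) (v : Fin 2 → ℤ) :
    (thetaTerm twoI t v).re = ((v 1 : ℝ) ^ 2 / 4 - (v 0 : ℝ) ^ 2) *
      Real.exp (-(π * t / 2)) ^ (4 * (v 0).natAbs ^ 2 + (v 1).natAbs ^ 2) := by
  have hgauss : gauss (formMap twoI) (v, t) =
      ((Real.exp (-(π * t / 2)) ^ (4 * (v 0).natAbs ^ 2 + (v 1).natAbs ^ 2) : ℝ) : ℂ) := by
    rw [gauss, ← Real.exp_nat_mul, quadForm_twoI]
    congr 2
    push_cast [Nat.cast_natAbs]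
    rw [sq_abs, sq_abs]
    ring
  rw [thetaTerm, hgauss, Complex.re_mul_ofReal, antiForm_twoI_sq_re]

theorem exp_neg_pi_mul_half_le {t : ℝ} (ht : 1 ≤ t) : Real.exp (-(π * t / 2)) ≤ 1 / 4 := by
  have hfour : (4 : ℝ) ≤ Real.exp (3 / 2) := by
    rw [show (3 / 2 : ℝ) = 1 + 1 / 2 by norm_num, Real.exp_add]
    nlinarith [Real.exp_one_gt_d9, Real.add_one_le_exp (1 / 2 : ℝ)]
  have hmono : Real.exp (3 / 2) ≤ Real.exp (π * t / 2) :=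
    Real.exp_le_exp.mpr (by nlinarith [Real.pi_gt_three])
  rw [Real.exp_neg, ← one_div]
  exact one_div_le_one_div_of_le (by norm_num) (hfour.trans hmono)

theorem sq_mul_pow_le {x : ℝ} (hx₀ : 0 ≤ x) (hx : x ≤ 1 / 4) (n : ℕ) :
    (n : ℝ) ^ 2 * x ^ (4 * n ^ 2) ≤ x / 16 * (1 / 4) ^ n := by
  rcases n with _ | n
  · simpa using div_nonneg hx₀ (by norm_num : (0 : ℝ) ≤ 16)
  have hsq : ((n + 1 : ℕ) : ℝ) ^ 2 ≤ 4 ^ n := by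
    have htwo : ((n + 1 : ℕ) : ℝ) ≤ 2 ^ n := by exact_mod_cast Nat.lt_two_pow_self
    calc ((n + 1 : ℕ) : ℝ) ^ 2 ≤ (2 ^ n) ^ 2 := by gcongr
      _ = 4 ^ n := by rw [← pow_mul, mul_comm, pow_mul]; norm_num
  have hpow : x ^ (4 * (n + 1) ^ 2) ≤ x * ((1 / 4) ^ n * (1 / 4) ^ (n + 3)) := by
    calc x ^ (4 * (n + 1) ^ 2) ≤ x ^ (1 + (n + (n + 3))) :=
          pow_le_pow_of_le_one hx₀ (by linarith) (by nlinarith)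
      _ = x * (x ^ n * x ^ (n + 3)) := by rw [pow_add, pow_one, pow_add]
      _ ≤ _ := by gcongr
  calc ((n + 1 : ℕ) : ℝ) ^ 2 * x ^ (4 * (n + 1) ^ 2)
      ≤ 4 ^ n * (x * ((1 / 4) ^ n * (1 / 4) ^ (n + 3))) := by gcongr
    _ = (4 * (1 / 4)) ^ n * (x * (1 / 4) ^ (n + 3)) := by rw [mul_pow]; ring
    _ = x / 16 * (1 / 4) ^ (n + 1) := by
        rw [mul_one_div_cancel four_ne_zero, one_pow]
        ring

theorem hasSum_pow_natAbs {r : ℝ} (hr₀ : 0 ≤ r) (hr : r < 1) :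
    HasSum (fun n : ℤ => r ^ n.natAbs) ((1 + r) / (1 - r)) := by
  have hgeom := hasSum_geometric_of_lt_one hr₀ hr
  have hnonneg : HasSum (fun n : ℕ => r ^ (n : ℤ).natAbs) (1 - r)⁻¹ := by simpa using hgeom
  have hneg : HasSum (fun n : ℕ => r ^ (-((n : ℤ) + 1)).natAbs) (r * (1 - r)⁻¹) := by
    refine (hgeom.mul_left r).congr_fun fun n => ?_
    rw [Int.natAbs_neg, show ((n : ℤ) + 1).natAbs = n + 1 by omega, pow_succ, mul_comm]
  have hadd := HasSum.of_nat_of_neg_add_one (f := fun n : ℤ => r ^ n.natAbs) hnonneg hneg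
  rwa [← one_add_mul, ← div_eq_mul_inv] at hadd

theorem hasSum_pow_natAbs_mul_pow_natAbs {r : ℝ} (hr₀ : 0 ≤ r) (hr : r < 1) :
    HasSum (fun v : Fin 2 → ℤ => r ^ (v 0).natAbs * r ^ (v 1).natAbs)
      ((1 + r) / (1 - r) * ((1 + r) / (1 - r))) := by
  have hrow := hasSum_pow_natAbs hr₀ hr
  have hsum := hrow.summable.mul_of_nonneg hrow.summable (fun n => pow_nonneg hr₀ _)
    (fun n => pow_nonneg hr₀ _)
  exact (finTwoArrowEquiv ℤ).hasSum_iff.mpr (hrow.mul hrow hsum)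

theorem le_thetaTerm_twoI_re {t : ℝ} (ht : 1 ≤ t) (v : Fin 2 → ℤ) :
    Pi.single (M := fun _ => ℝ) ![0, 1] (Real.exp (-(π * t / 2)) / 4) v -
        Real.exp (-(π * t / 2)) / 16 * ((1 / 4) ^ (v 0).natAbs * (1 / 4) ^ (v 1).natAbs) ≤
      (thetaTerm twoI t v).re := by
  have hx := exp_neg_pi_mul_half_le ht
  rw [thetaTerm_twoI_re, sub_mul]
  set x := Real.exp (-(π * t / 2))
  have hx₀ : 0 ≤ x := (Real.exp_pos _).le
  refine sub_le_sub ?_ ?_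
  · obtain rfl | hv := eq_or_ne v ![0, 1]
    · simp
      linarith
    · rw [Pi.single_eq_of_ne hv]
      positivity
  · have hpow : x ^ (v 1).natAbs ^ 2 ≤ (1 / 4) ^ (v 1).natAbs :=
      (pow_le_pow_left₀ hx₀ hx _).trans
        (pow_le_pow_of_le_one (by norm_num) (by norm_num) (Nat.le_self_pow two_ne_zero _))
    calc (v 0 : ℝ) ^ 2 * x ^ (4 * (v 0).natAbs ^ 2 + (v 1).natAbs ^ 2)
        = ((v 0).natAbs : ℝ) ^ 2 * x ^ (4 * (v 0).natAbs ^ 2) * x ^ (v 1).natAbs ^ 2 := by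
          rw [Nat.cast_natAbs, Int.cast_abs, sq_abs, pow_add, mul_assoc]
      _ ≤ x / 16 * (1 / 4) ^ (v 0).natAbs * (1 / 4) ^ (v 1).natAbs :=
          mul_le_mul (sq_mul_pow_le hx₀ hx _) hpow (by positivity) (by positivity)
      _ = _ := mul_assoc _ _ _

theorem theta_twoI_re_pos {t : ℝ} (ht : 1 ≤ t) : 0 < (theta twoI t).re := by
  have htheta := Complex.hasSum_re (summable_thetaTerm twoI (one_pos.trans_le ht)).hasSum
  have hbound := (hasSum_pi_single (![0, 1] : Fin 2 → ℤ) (Real.exp (-(π * t / 2)) / 4)).sub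
    ((hasSum_pow_natAbs_mul_pow_natAbs (r := 1 / 4) (by norm_num) (by norm_num)).mul_left
      (Real.exp (-(π * t / 2)) / 16))
  refine lt_of_lt_of_le ?_ (hasSum_le (le_thetaTerm_twoI_re ht) hbound htheta)
  linarith [Real.exp_pos (-(π * t / 2))]

theorem eisInt_logWeight_zero_ne_zero : eisInt (logWeight 0) ≠ 0 := by
  intro hzero
  have hint := integrableOn_mul_theta (isPolyBdd_logWeight 0) twoI
  have hre : ∫ t in Set.Ioi 1, (logWeight 0 t * theta twoI t).re = 0 := by
    have hcomm := Complex.reCLM.integral_comp_comm hint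
    rwa [integral_mul_theta (isPolyBdd_logWeight 0), hzero, Pi.zero_apply, map_zero] at hcomm
  have hpos : ∀ t ∈ Set.Ioi (1 : ℝ), 0 < (logWeight 0 t * theta twoI t).re := fun t ht => by
    have hweight : logWeight 0 t = ((t + 1 : ℝ) : ℂ) := by simp [logWeight]
    rw [hweight, Complex.re_ofReal_mul]
    exact mul_pos (add_pos (one_pos.trans ht) one_pos) (theta_twoI_re_pos (le_of_lt ht))
  have hsupport : Set.Ioi (1 : ℝ) ⊆
      Function.support fun t => RCLike.re (logWeight 0 t * theta twoI t) :=
    fun t ht => (hpos t ht).ne'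
  refine hre.not_gt ((setIntegral_pos_iff_support_of_nonneg_ae ?_ hint.re).mpr ?_)
  · filter_upwards [ae_restrict_mem measurableSet_Ioi] with t ht using (hpos t ht).le
  · rw [Set.inter_eq_self_of_subset_right hsupport, Real.volume_Ioi]
    exact ENNReal.zero_lt_top

end Nonvanishing

/-! ### The basis theorem -/

section Basis

theorem G_one_ne_zero : G 1 ≠ 0 := by
  rw [G_succ]
  refine smul_ne_zero ?_ eisInt_logWeight_zero_ne_zero
  simp [Real.pi_ne_zero]

theorem lap_G_succ_eq (n : ℕ) : lap 2 (G (n + 1)) = (π / (2 * n.factorial) : ℂ) •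
    ((n : ℂ) • eisInt (logWeight (n - 1)) + (n * (n - 1) : ℂ) • eisInt (logWeight (n - 2))) := by
  rw [G_succ, lap_smul _ _ (isSmooth_eisInt (isPolyBdd_logWeight _)), lap_eisInt_logWeight]

theorem lap_G_one : lap 2 (G 1) = 0 := by
  simp [lap_G_succ_eq 0]

theorem lap_G_add_two (n : ℕ) : lap 2 (G (n + 2)) = G (n + 1) + G n := by
  have hfact : (n.factorial : ℂ) ≠ 0 := by exact_mod_cast n.factorial_ne_zero
  have hsucc : (n : ℂ) + 1 ≠ 0 := by exact_mod_cast n.succ_ne_zero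
  rw [lap_G_succ_eq, G_succ, smul_add, smul_smul, smul_smul, Nat.add_sub_cancel,
    Nat.factorial_succ]
  congr 1
  · congr 1
    push_cast
    field_simp
  · rcases n with _ | n
    · ext z
      simp [G_zero]
    · rw [G_succ, show n + 1 + 1 - 2 = n by omega]
      congr 1
      rw [Nat.factorial_succ] at hfact ⊢
      push_cast at hfact hsucc ⊢
      field_simp
      ring

theorem isModerateForm_G (n : ℕ) : IsModerateForm 2 (G n) := by
  rcases n with _ | n
  · rw [show G 0 = 0 from funext G_zero]
    exact IsModerateForm.zero 2
  · rw [G_succ]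
    exact (isModerateForm_eisInt (isPolyBdd_logWeight n)).smul _

theorem lap_iterate_succ_G_add_two (m n : ℕ) :
    (lap 2)^[m + 1] (G (n + 2)) = (lap 2)^[m] (G (n + 1)) + (lap 2)^[m] (G n) := by
  rw [Function.iterate_succ_apply, lap_G_add_two,
    lap_iterate_add 2 (isModerateForm_G _).smooth (isModerateForm_G _).smooth]

theorem lap_iterate_G_eq_zero {n m : ℕ} (h : n ≤ m) : (lap 2)^[m] (G n) = 0 := by
  induction m generalizing n with
  | zero =>
    rw [Nat.le_zero.mp h]
    exact funext G_zero
  | succ m ih =>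
    rcases n with _ | _ | n
    · rw [show G 0 = 0 from funext G_zero, lap_iterate_zero]
    · rw [Function.iterate_succ_apply, zero_add, lap_G_one, lap_iterate_zero]
    · rw [lap_iterate_succ_G_add_two, ih (by omega), ih (by omega), add_zero]

theorem lap_iterate_G_succ (m : ℕ) : (lap 2)^[m] (G (m + 1)) = G 1 := by
  induction m with
  | zero => rfl
  | succ m ih => rw [lap_iterate_succ_G_add_two, ih, lap_iterate_G_eq_zero le_rfl, add_zero]

theorem G_mem_V {n m : ℕ} (h : n ≤ m) : G n ∈ V 2 m :=
  ⟨isModerateForm_G n, lap_iterate_G_eq_zero h⟩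

theorem G_succ_notMem_V (m : ℕ) : G (m + 1) ∉ V 2 m := fun h =>
  G_one_ne_zero ((lap_iterate_G_succ m).symm.trans h.2)

theorem exists_sub_smul_G_mem_V {m : ℕ} {f : ℍ → ℂ} (hf : f ∈ V 2 (m + 1)) :
    ∃ c : ℂ, f - c • G (m + 1) ∈ V 2 m := by
  have hlap : lap 2 ((lap 2)^[m] f) = 0 :=
    (Function.iterate_succ_apply' (lap 2) m f).symm.trans hf.2
  obtain ⟨c, hc⟩ := (hf.1.isWeakForm.lap_iterate m).exists_eq_smul
    (isModerateForm_G 1).isWeakForm hlap lap_G_one G_one_ne_zero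
  have hG := isModerateForm_G (m + 1)
  refine ⟨c, ?_⟩
  rw [sub_eq_add_neg, ← _root_.neg_smul]
  refine ⟨hf.1.add (hG.smul _), ?_⟩
  rw [lap_iterate_add 2 hf.1.smooth (hG.smooth.smul _), lap_iterate_smul 2 _ hG.smooth,
    lap_iterate_G_succ, hc, _root_.neg_smul, add_neg_cancel]

theorem V_le_span (m : ℕ) : V 2 m ≤ Submodule.span ℂ (Set.range fun i : Fin m => G (i + 1)) := by
  induction m with
  | zero =>
    intro f hf
    rw [show f = 0 from hf.2]
    exact Submodule.zero_mem _
  | succ m ih =>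
    intro f hf
    obtain ⟨c, hc⟩ := exists_sub_smul_G_mem_V hf
    have hmono : Submodule.span ℂ (Set.range fun i : Fin m => G (i + 1)) ≤
        Submodule.span ℂ (Set.range fun i : Fin (m + 1) => G (i + 1)) := by
      refine Submodule.span_mono ?_
      rintro _ ⟨i, rfl⟩
      exact ⟨i.castSucc, rfl⟩
    have hlast : G (m + 1) ∈ Submodule.span ℂ (Set.range fun i : Fin (m + 1) => G (i + 1)) :=
      Submodule.subset_span ⟨Fin.last m, rfl⟩
    rw [← sub_add_cancel f (c • G (m + 1))]
    exact Submodule.add_mem _ (hmono (ih hc)) (Submodule.smul_mem _ c hlast)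

theorem linearIndependent_G (m : ℕ) : LinearIndependent ℂ fun i : Fin m => G (i + 1) := by
  induction m with
  | zero => exact linearIndependent_empty_type
  | succ m ih =>
    rw [linearIndependent_finSucc']
    refine ⟨ih, fun h => G_succ_notMem_V m (Submodule.span_le.mpr ?_ h)⟩
    rintro _ ⟨i, rfl⟩
    exact G_mem_V i.isLt

/-- The Taylor coefficients `G 1, …, G m` as a basis of `V 2 m`. -/
def basisG (m : ℕ) : Module.Basis (Fin m) ℂ (V 2 m) :=
  Module.Basis.mk (v := fun i : Fin m => ⟨G (i + 1), G_mem_V i.isLt⟩)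
    (LinearIndependent.of_comp (V 2 m).subtype (linearIndependent_G m)) fun f _ => by
      rw [← Submodule.apply_mem_span_image_iff_mem_span (V 2 m).injective_subtype, ← Set.range_comp]
      exact V_le_span m f.2

theorem V_eq_VHalf (m : ℕ) : V 2 m = VHalf 2 m := by
  refine le_antisymm (fun f hf => ⟨hf.1, ?_⟩) fun f hf => ⟨hf.1, hf.2.eq_zero_of_weight_two⟩
  rw [hf.2]
  exact IsHolModForm.zero 2

end Basis

end

end PolyMaass

theorem theorem1p2 :
    -- the doubly-completed series continues to an entire function of `s`
    (∀ z : UpperHalfPlane, PolyMaass.IsContinuation z (PolyMaass.E2 z)) ∧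
    (∀ z : UpperHalfPlane, PolyMaass.G 0 z = 0) ∧
    ∀ m : ℕ,
      PolyMaass.V 2 m = PolyMaass.VHalf 2 m ∧
      Module.rank ℂ (PolyMaass.V 2 m) = (m : Cardinal) ∧
      ∃ b : Module.Basis (Fin m) ℂ (PolyMaass.V 2 m),
        ∀ i : Fin m, (b i : UpperHalfPlane → ℂ) = PolyMaass.G ((i : ℕ) + 1) := by
  refine ⟨PolyMaass.isContinuation_E2, PolyMaass.G_zero, fun m =>
    ⟨PolyMaass.V_eq_VHalf m, ?_, PolyMaass.basisG m, fun i => ?_⟩⟩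
  · rw [rank_eq_card_basis (PolyMaass.basisG m), Fintype.card_fin]
  · rw [PolyMaass.basisG, Module.Basis.mk_apply]
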